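/- Let $\Omega\subset\mathbb R^2$ be a (bounded) polygonal domain, $\mu>0$ and $g\in L^2(\Omega)^2$. For a conforming triangulation $\mathcal T$ of $\overline\Omega$ let $\nabla_{\mathcal T}$ and $\operatorname{div}_{\mathcal T}$ be the elementwise gradient and divergence, let $$H^1(\mathcal T)=\{v\in L^2(\Omega): v|_K\in H^1(K)\ \text{for all } K\in\mathcal T\},$$ let $V_{\mathcal T}$ be the space of all $v\in L^2(\Omega)^2$ with $v|_K\in P_1(K)^2$ for all $K\in\mathcal T$, $\int_E[v]\,ds=0$ for every interior edge $E$ of $\mathcal T$ (where $[v]$ is the jump across $E$) and $\int_E v\,ds=0$ for every edge $E\subset\partial\Omega$ of $\mathcal T$, and let $Q_{\mathcal T}$ be the space of all $q\in L^2(\Omega)$ with $\int_\Omega q\,dx=0$ that are constant on each $K\in\mathcal T$. Put $$a_{\mathcal T}(u,v)=\mu(\nabla_{\mathcal T}u,\nabla_{\mathcal T}v)_{L^2(\Omega)},\qquad b_{\mathcal T}(v,q)=(\operatorname{div}_{\mathcal T}v,q)_{L^2(\Omega)}.$$ Lemma. For every $\kappa$ there is a constant $C>0$, depending only on $\kappa$,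 such that the following holds. Let $\mathcal T_{k-1}$ be a conforming triangulation of $\overline\Omega$ and let $\mathcal T_k$ be a nested conforming refinement of it (for instance one produced by newest vertex bisection), both shape regular with constant $\kappa$, that is, $\operatorname{diam}K\le\kappa\rho_K$ for every element $K$, where $\rho_K$ is the diameter of the largest disc contained in $K$. Let $(u_{k-1},p_{k-1})\in V_{\mathcal T_{k-1}}\times Q_{\mathcal T_{k-1}}$ be a solution of the discrete Stokes problem $$a_{\mathcal T_{k-1}}(u_{k-1},v)+b_{\mathcal T_{k-1}}(v,p_{k-1})+b_{\mathcal T_{k-1}}(u_{k-1},q)=(g,v)_{L^2(\Omega)}\quad\text{for all }(v,q)\in V_{\mathcal T_{k-1}}\times Q_{\mathcal T_{k-1}},$$ and let $$\operatorname{Res}_{k-1}(v)=(g,v)_{L^2(\Omega)}-a_{\mathcal T_k}(u_{k-1},v)-b_{\mathcal T_k}(v,p_{k-1}),\qquad v\in H^1(\mathcal T_k)^2 .$$ Then, with $h_K=|K|^{1/2}$, $$|\operatorname{Res}_{k-1}(v_k)|\le C\Big(\sum_{K\in\mathcal T_{k-1}\setminus\mathcal T_k}h_K^2\|g\|_{L^2(K)}^2\Big)^{1/2}\|\nabla_{\mathcal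 T_k}v_k\|_{L^2(\Omega)}\qquad\text{for all } v_k\in V_{\mathcal T_k}.$$ -/

import Mathlib

open MeasureTheory Set
open scoped ContDiff

noncomputable section

namespace StokesCR

/-- The Euclidean plane `ℝ²`. -/
abbrev Plane := EuclideanSpace ℝ (Fin 2)

/-- A bounded polygonal domain of the plane: open, connected and non-empty, with a boundary made
of finitely many segments. The condition `interior (closure Ω) = Ω` says that `Ω` has no slits or
punctures, so that it has a well-defined outward normal on its boundary edges. -/
structure IsPolygonalDomain (Ω : Set Plane) : Prop where
  isOpen : IsOpen Ω
  isConnected : IsConnected Ω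
  isBounded : Bornology.IsBounded Ω
  interior_closure : interior (closure Ω) = Ω
  frontier_eq : ∃ S : Finset (Plane × Plane), frontier Ω = ⋃ s ∈ S, segment ℝ s.1 s.2

/-- The closed triangle with vertex set `K`. -/
abbrev tri (K : Finset Plane) : Set Plane := convexHull ℝ (K : Set Plane)

/-- A conforming triangulation that covers `closure Ω` exactly. An element is given by the set of
its three vertices; two elements meet in the convex hull of their common vertices, that is, they
are disjoint, or share exactly a vertex or exactly an edge, or coincide. -/
structure Triangulation (Ω : Set Plane) where
  elems : Finset (Finset Plane)
  card_eq : ∀ K ∈ elems, K.card = 3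
  indep : ∀ K ∈ elems, AffineIndependent ℝ ((↑) : K → Plane)
  inter_eq : ∀ K ∈ elems, ∀ L ∈ elems,
    tri K ∩ tri L = convexHull ℝ ((K : Set Plane) ∩ (L : Set Plane))
  cover : ⋃ K ∈ elems, tri K = closure Ω

/-- Shape regularity with constant `κ`: the quotient of the diameter of each element and of the
diameter `2 r` of (the largest) disc inscribed in it is at most `κ`. -/
def Triangulation.ShapeRegular {Ω : Set Plane} (T : Triangulation Ω) (κ : ℝ) : Prop :=
  ∀ K ∈ T.elems, ∃ (x : Plane) (r : ℝ), 0 < r ∧ Metric.closedBall x r ⊆ tri K ∧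
    Metric.diam (tri K) ≤ κ * (2 * r)

/-- `T'` is a nested refinement of `T`: every element of `T'` lies in an element of `T`. -/
def Triangulation.Refines {Ω : Set Plane} (T' T : Triangulation Ω) : Prop :=
  ∀ K' ∈ T'.elems, ∃ K ∈ T.elems, tri K' ⊆ tri K

open Classical in
/-- `T \ T'`: the elements of `T` that are not elements of `T'`. -/
def Triangulation.refined {Ω : Set Plane} (T T' : Triangulation Ω) : Finset (Finset Plane) :=
  T.elems \ T'.elems

/-- The element size `h_K = |K|^{1/2}`. -/
def elemSize (K : Finset Plane) : ℝ := Real.sqrt (volume.real (tri K))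

/-- The `L²` norm over the set `S` of a vector field. -/
def normL2 (S : Set Plane) (f : Plane → Plane) : ℝ :=
  Real.sqrt (∫ x in S, ‖f x‖ ^ 2)

/-- The `L²` inner product over the set `S` of two vector fields. -/
def innerL2 (S : Set Plane) (f g : Plane → Plane) : ℝ := ∫ x in S, inner ℝ (f x) (g x)

/-- The arc-length integral of `w` over the segment with end points `a` and `b`. -/
def edgeIntegral (a b : Plane) (w : Plane → Plane) : Plane :=
  dist a b • ∫ t in (0 : ℝ)..1, w (AffineMap.lineMap a b t)

/-- `h` is the weak partial derivative in direction `j` of `f` on the open set `U`. -/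
def IsWeakPartial (U : Set Plane) (j : Fin 2) (f h : Plane → ℝ) : Prop :=
  ∀ φ : Plane → ℝ, ContDiff ℝ ∞ φ → HasCompactSupport φ → tsupport φ ⊆ U →
    ∫ x in U, f x * fderiv ℝ φ x (EuclideanSpace.single j 1) = - ∫ x in U, h x * φ x

/-- `G` is square integrable on `Ω` and is on (the interior of) every element of `T` the weak
gradient of `v`; the entry `(i, j)` is the derivative of the component `i` in direction `j`. -/
def IsBrokenGrad {Ω : Set Plane} (T : Triangulation Ω) (v : Plane → Plane)
    (G : Plane → Matrix (Fin 2) (Fin 2) ℝ) : Prop :=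
  (∀ i j, MemLp (fun x => G x i j) 2 (volume.restrict Ω)) ∧
    ∀ K ∈ T.elems, ∀ i j,
      IsWeakPartial (interior (tri K)) j (fun x => v x i) (fun x => G x i j)

/-- The broken Sobolev space `H¹(T)²`. -/
def brokenH1 {Ω : Set Plane} (T : Triangulation Ω) : Set (Plane → Plane) :=
  {v | MemLp v 2 (volume.restrict Ω) ∧ ∃ G, IsBrokenGrad T v G}

open Classical in
/-- The elementwise gradient of `v ∈ H¹(T)²`, determined almost everywhere on `Ω`. -/
def brokenGrad {Ω : Set Plane} (T : Triangulation Ω) (v : Plane → Plane) :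
    Plane → Matrix (Fin 2) (Fin 2) ℝ :=
  if h : ∃ G, IsBrokenGrad T v G then h.choose else 0

/-- The elementwise divergence. -/
def brokenDiv {Ω : Set Plane} (T : Triangulation Ω) (v : Plane → Plane) (x : Plane) : ℝ :=
  (brokenGrad T v x).trace

/-- `‖∇_T v‖_{L²(Ω)}`, with the Frobenius norm of matrices. -/
def brokenGradNorm {Ω : Set Plane} (T : Triangulation Ω) (v : Plane → Plane) : ℝ :=
  Real.sqrt (∫ x in Ω, ∑ i, ∑ j, brokenGrad T v x i j ^ 2)

/-- `a_T(u, v) = μ (∇_T u, ∇_T v)_{L²(Ω)}`. -/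
def formA {Ω : Set Plane} (T : Triangulation Ω) (μ : ℝ) (u v : Plane → Plane) : ℝ :=
  μ * ∫ x in Ω, ∑ i, ∑ j, brokenGrad T u x i j * brokenGrad T v x i j

/-- `b_T(v, q) = (div_T v, q)_{L²(Ω)}`. -/
def formB {Ω : Set Plane} (T : Triangulation Ω) (v : Plane → Plane) (q : Plane → ℝ) : ℝ :=
  ∫ x in Ω, brokenDiv T v x * q x

/-- The nonconforming `P₁` (Crouzeix–Raviart) space: square integrable fields `v` that are affine
on each element (`A K` is the polynomial `v|_K`), whose jumps have mean zero over the interior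
edges and which have mean zero over the edges on the boundary. -/
def velocitySpace {Ω : Set Plane} (T : Triangulation Ω) : Set (Plane → Plane) :=
  {v | MemLp v 2 (volume.restrict Ω) ∧
    ∃ A : Finset Plane → (Plane →ᵃ[ℝ] Plane),
      (∀ K ∈ T.elems, v =ᵐ[volume.restrict (tri K)] A K) ∧
      (∀ K ∈ T.elems, ∀ L ∈ T.elems, K ≠ L → ∀ a b : Plane, a ≠ b →
        a ∈ K → b ∈ K → a ∈ L → b ∈ L → edgeIntegral a b (fun x => A K x - A L x) = 0) ∧
      (∀ K ∈ T.elems, ∀ a b : Plane, a ≠ b → a ∈ K → b ∈ K →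
        segment ℝ a b ⊆ frontier Ω → edgeIntegral a b (A K) = 0)}

/-- The discrete pressures: square integrable, of mean zero, constant on each element. -/
def pressureSpace {Ω : Set Plane} (T : Triangulation Ω) : Set (Plane → ℝ) :=
  {q | MemLp q 2 (volume.restrict Ω) ∧ ∫ x in Ω, q x = 0 ∧
    ∀ K ∈ T.elems, ∃ c : ℝ, q =ᵐ[volume.restrict (tri K)] fun _ => c}

/-- `(u, p)` solves the discrete Stokes problem on `T` with viscosity `μ` and right-hand side
`g`. -/
def IsDiscreteSolution {Ω : Set Plane} (T : Triangulation Ω) (μ : ℝ) (g : Plane → Plane)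
    (u : Plane → Plane) (p : Plane → ℝ) : Prop :=
  u ∈ velocitySpace T ∧ p ∈ pressureSpace T ∧
    ∀ v ∈ velocitySpace T, ∀ q ∈ pressureSpace T,
      formA T μ u v + formB T v p + formB T u q = innerL2 Ω g v

/-- The residual `(g, v) - a_T(u, v) - b_T(v, p)` for `v ∈ H¹(T)²`; it will be used with the
discrete solution `(u, p)` on a mesh that is coarser than `T`. -/
def residual {Ω : Set Plane} (T : Triangulation Ω) (μ : ℝ) (g : Plane → Plane)
    (u : Plane → Plane) (p : Plane → ℝ) (v : Plane → Plane) : ℝ :=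
  innerL2 Ω g v - formA T μ u v - formB T v p

end StokesCR

end

/-! A fine velocity `v` has an interpolant `w` in the coarse Crouzeix–Raviart space, whose value at
the midpoint of a coarse edge is the mean of `v` over that edge. This mean is well defined because
`v` has a single mean on every fine edge. By the divergence theorem on a coarse element `K`, where
the contributions of the fine edges inside `K` cancel, the gradient of `w` on `K` is the mean over
`K` of the elementwise gradient of `v` (`linear_crInterp`). The gradient of `u` and the pressure `p`
are constant on `K`, so the two bilinear forms do not distinguish `v` from `w`, and the discrete
problem tested with `(w, 0)` turns the residual into `(g, v - w)` (`residual_eq`). On an element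
that is not refined `w = v` (`crInterp_eq_of_mem`). On the others it remains to bound the `L²` norm
of `v - w` by `h_K` times that of the gradient (`exists_interp_error_le`).

The constant must not depend on the number of fine elements in `K`. The estimate therefore rests on
a Poincaré inequality for nonconforming fields (`exists_sum_norm_cen_sub_sq_le`), proved in the way
of Gagliardo and Nirenberg for the embedding of `W^{1,1}` into `L²` in the plane. Elements with a
common edge agree at its midpoint, so their centroid values differ at most by the sum of their
oscillations `diam T * |∇A|`. A segment that avoids all vertices changes elements only across edges,
which bounds the variation along it by the oscillations of the elements it meets. Each point of `K`
is joined to a fixed good point in two ways along lines on which one barycentric coordinate is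
constant; the product of the two bounds is a function of one coordinate times a function of another,
and Fubini applies. Integration over the lines produces `∑ diam(T)² |∇A|`, by shape regularity at
most a multiple of the `L¹` norm of the gradient.

The divergence theorem is pure algebra (`green`, `sum_green`): the field `y ↦ α y + d` has a
constant normal component on each edge, so the midpoint rule is exact for its product with an affine
field. The choice `α = 0` gives mean gradients, and `α = 1` relates the centroid values. -/

noncomputable section

namespace StokesCR

open scoped Classical Pointwise ENNReal Topology

/-! ### Triangles and barycentric coordinates -/

/-- `K` is the vertex set of a non-degenerate triangle. -/
structure IsTriangle (K : Finset Plane) : Prop where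
  card_eq : K.card = 3
  indep : AffineIndependent ℝ ((↑) : K → Plane)

theorem Triangulation.isTriangle {Ω : Set Plane} (T : Triangulation Ω) {K : Finset Plane}
    (hK : K ∈ T.elems) : IsTriangle K :=
  ⟨T.card_eq K hK, T.indep K hK⟩

namespace IsTriangle

variable {K L : Finset Plane}

/-- The affine basis formed by the vertices. -/
def basis (h : IsTriangle K) : AffineBasis K ℝ Plane :=
  ⟨(↑), h.indep, h.indep.affineSpan_eq_top_iff_card_eq_finrank_add_one.2 (by simp [h.card_eq])⟩

end IsTriangle

/-- The barycentric coordinate of the vertex `c` in the triangle `K`. -/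
def bary (K : Finset Plane) (c : Plane) : Plane →ᵃ[ℝ] ℝ :=
  if h : IsTriangle K ∧ c ∈ K then h.1.basis.coord ⟨c, h.2⟩ else 0

theorem affineMap_add {V : Type*} [AddCommGroup V] [Module ℝ V] (A : Plane →ᵃ[ℝ] V)
    (x d : Plane) : A (x + d) = A x + A.linear d := by
  have := A.map_vadd x d
  rwa [vadd_eq_add, vadd_eq_add, add_comm d, add_comm (A.linear d)] at this

theorem affineMap_sum_smul {V : Type*} [AddCommGroup V] [Module ℝ V]
    (A : Plane →ᵃ[ℝ] V) {ι : Type*} (s : Finset ι) (w : ι → ℝ) (p : ι → Plane)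
    (hw : ∑ i ∈ s, w i = 1) : A (∑ i ∈ s, w i • p i) = ∑ i ∈ s, w i • A (p i) := by
  have key : ∀ x, A x = A 0 + A.linear x := fun x => by
    simpa using affineMap_add A 0 x
  have h1 : ∑ i ∈ s, w i • A (p i) = ∑ i ∈ s, (w i • A 0 + w i • A.linear (p i)) :=
    Finset.sum_congr rfl fun i _ => by rw [key (p i), smul_add]
  rw [h1, Finset.sum_add_distrib, ← Finset.sum_smul, hw, one_smul, key, map_sum]
  simp only [map_smul]

namespace IsTriangle

variable {K L : Finset Plane} {a b c x : Plane}

theorem bary_eq (h : IsTriangle K) (hc : c ∈ K) : bary K c = h.basis.coord ⟨c, hc⟩ :=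
  dif_pos ⟨h, hc⟩

theorem bary_self (h : IsTriangle K) (hc : c ∈ K) : bary K c c = 1 := by
  rw [h.bary_eq hc]; exact h.basis.coord_apply_eq ⟨c, hc⟩

theorem bary_ne (h : IsTriangle K) (hc : c ∈ K) (ha : a ∈ K) (hac : a ≠ c) : bary K c a = 0 := by
  rw [h.bary_eq hc]
  exact h.basis.coord_apply_ne (i := ⟨c, hc⟩) (j := ⟨a, ha⟩) (by simpa using hac.symm)

theorem sum_bary (h : IsTriangle K) (x : Plane) : ∑ c ∈ K, bary K c x = 1 := by
  rw [← Finset.sum_coe_sort, ← h.basis.sum_coord_apply_eq_one x]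
  exact Finset.sum_congr rfl fun i _ => by rw [h.bary_eq i.2]

theorem sum_bary_smul (h : IsTriangle K) (x : Plane) : ∑ c ∈ K, bary K c x • c = x := by
  rw [← Finset.sum_coe_sort]
  conv_rhs => rw [← h.basis.linear_combination_coord_eq_self x]
  exact Finset.sum_congr rfl fun i _ => by rw [h.bary_eq i.2]; rfl

theorem sum_bary_linear (h : IsTriangle K) (d : Plane) : ∑ c ∈ K, (bary K c).linear d = 0 := by
  have h1 := h.sum_bary (0 + d)
  simp only [affineMap_add, Finset.sum_add_distrib, h.sum_bary] at h1
  linarith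

theorem sum_bary_linear_smul (h : IsTriangle K) (d : Plane) :
    ∑ c ∈ K, (bary K c).linear d • c = d := by
  have h1 := h.sum_bary_smul (0 + d)
  simp only [affineMap_add, add_smul, Finset.sum_add_distrib, h.sum_bary_smul] at h1
  simpa using h1

theorem map_eq (h : IsTriangle K) {V : Type*} [AddCommGroup V] [Module ℝ V]
    (A : Plane →ᵃ[ℝ] V) (x : Plane) : A x = ∑ c ∈ K, bary K c x • A c := by
  rw [← affineMap_sum_smul A K _ _ (h.sum_bary x), h.sum_bary_smul]

theorem linear_eq (h : IsTriangle K) {V : Type*} [AddCommGroup V] [Module ℝ V]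
    (A : Plane →ᵃ[ℝ] V) (d : Plane) : A.linear d = ∑ c ∈ K, (bary K c).linear d • A c := by
  have h1 := h.map_eq A (0 + d)
  simp only [affineMap_add, add_smul, Finset.sum_add_distrib] at h1
  rw [← h.map_eq A 0] at h1
  exact add_left_cancel h1

theorem coe_eq_range (h : IsTriangle K) : (K : Set Plane) = range h.basis := by
  ext x
  constructor
  · intro hx; exact ⟨⟨x, hx⟩, rfl⟩
  · rintro ⟨i, rfl⟩; exact i.2

theorem mem_tri (h : IsTriangle K) : x ∈ tri K ↔ ∀ c ∈ K, 0 ≤ bary K c x := by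
  rw [tri, h.coe_eq_range, h.basis.convexHull_eq_nonneg_coord]
  constructor
  · intro hx c hc; rw [h.bary_eq hc]; exact hx _
  · intro hx i; have := hx i i.2; rwa [h.bary_eq i.2] at this

theorem mem_interior (h : IsTriangle K) : x ∈ interior (tri K) ↔ ∀ c ∈ K, 0 < bary K c x := by
  rw [tri, h.coe_eq_range, h.basis.interior_convexHull]
  constructor
  · intro hx c hc; rw [h.bary_eq hc]; exact hx _
  · intro hx i; have := hx i i.2; rwa [h.bary_eq i.2] at this

theorem bary_le_one (h : IsTriangle K) (hc : c ∈ K) (hx : x ∈ tri K) : bary K c x ≤ 1 := by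
  rw [← h.sum_bary x]
  exact Finset.single_le_sum (fun i hi => h.mem_tri.1 hx i hi) hc

/-- A barycentric coordinate vanishes on the face opposite to its vertex. -/
theorem bary_eq_zero_of_mem_convexHull (h : IsTriangle K) {S : Set Plane} (hS : S ⊆ K)
    (hc : c ∈ K) (hcS : c ∉ S) (hx : x ∈ convexHull ℝ S) : bary K c x = 0 := by
  have h1 : convexHull ℝ S ⊆ (bary K c) ⁻¹' {0} := by
    refine convexHull_min (fun y hy => ?_)
      ((convex_singleton (𝕜 := ℝ) (0 : ℝ)).affine_preimage (bary K c))
    exact h.bary_ne hc (hS hy) (fun e => hcS (e ▸ hy))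
  exact h1 hx

theorem isCompact_tri (K : Finset Plane) : IsCompact (tri K) :=
  K.finite_toSet.isCompact_convexHull (𝕜 := ℝ)

theorem isClosed_tri (K : Finset Plane) : IsClosed (tri K) := (isCompact_tri K).isClosed

theorem interior_nonempty (h : IsTriangle K) : (interior (tri K)).Nonempty := by
  rw [tri, interior_convexHull_nonempty_iff_affineSpan_eq_top, h.coe_eq_range]
  exact h.basis.tot

theorem closure_interior (h : IsTriangle K) : closure (interior (tri K)) = tri K := by
  rw [(convex_convexHull ℝ _).closure_interior_eq_closure_of_nonempty_interior
    h.interior_nonempty, (isClosed_tri K).closure_eq]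

theorem subset_tri (K : Finset Plane) : (K : Set Plane) ⊆ tri K := subset_convexHull ℝ _

theorem mem_tri_of_mem {K : Finset Plane} (hx : x ∈ K) : x ∈ tri K := subset_tri K hx

end IsTriangle

/-- The two-dimensional cross product. -/
def cross (p q : Plane) : ℝ := p 0 * q 1 - p 1 * q 0

theorem cross_add_right (p q r : Plane) : cross p (q + r) = cross p q + cross p r := by
  simp [cross]; ring

theorem cross_smul_right (p q : Plane) (t : ℝ) : cross p (t • q) = t * cross p q := by
  simp [cross]; ring

theorem cross_smul_left (p q : Plane) (t : ℝ) : cross (t • p) q = t * cross p q := by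
  simp [cross]; ring

theorem cross_self (p : Plane) : cross p p = 0 := by
  simp [cross]; ring

namespace IsTriangle

variable {a b c : Plane}

theorem sum_three {M : Type*} [AddCommMonoid M] (f : Plane → M) (hab : a ≠ b) (hac : a ≠ c)
    (hbc : b ≠ c) : ∑ x ∈ ({a, b, c} : Finset Plane), f x = f a + f b + f c := by
  rw [Finset.sum_insert (by simp [hab, hac]), Finset.sum_pair hbc, add_assoc]

/-- The vertices of a triangle, starting from the vertices different from `c`. -/
theorem exists_eq {K : Finset Plane} (h : IsTriangle K) {c : Plane} (hc : c ∈ K) :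
    ∃ a b, a ≠ b ∧ a ≠ c ∧ b ≠ c ∧ K = {a, b, c} ∧ K.erase c = {a, b} := by
  have h1 : (K.erase c).card = 2 := by rw [Finset.card_erase_of_mem hc, h.card_eq]
  obtain ⟨a, b, hab, he⟩ := Finset.card_eq_two.1 h1
  have ha : a ∈ K.erase c := by simp [he]
  have hb : b ∈ K.erase c := by simp [he]
  refine ⟨a, b, hab, Finset.ne_of_mem_erase ha, Finset.ne_of_mem_erase hb, ?_, he⟩
  rw [← Finset.insert_erase hc, he]
  ext x; simp; tauto

theorem ne_of_insert (h : IsTriangle {a, b, c}) : a ≠ b ∧ a ≠ c ∧ b ≠ c := by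
  have h3 := h.card_eq
  have h1 := Finset.card_le_two (a := a) (b := c)
  have h2 := Finset.card_le_two (a := a) (b := b)
  refine ⟨?_, ?_, ?_⟩ <;> rintro rfl
  · rw [Finset.insert_eq_of_mem (by simp)] at h3; omega
  · rw [Finset.insert_eq_of_mem (by simp)] at h3
    have := Finset.card_le_two (a := b) (b := a); omega
  · rw [Finset.pair_eq_singleton] at h3; have := Finset.card_le_two (a := a) (b := b); omega

end IsTriangle

/-! ### Areas -/

/-- The unit vectors of the plane. -/
def unitVec (j : Fin 2) : Plane := EuclideanSpace.single j 1

/-- The area of the reference triangle. -/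
def refArea : ℝ := volume.real (convexHull ℝ ({0, unitVec 0, unitVec 1} : Set Plane))

/-- The linear map that sends the two unit vectors to `u` and `v`. -/
def frameMap (u v : Plane) : Plane →ₗ[ℝ] Plane :=
  Matrix.toLin (EuclideanSpace.basisFun (Fin 2) ℝ).toBasis (EuclideanSpace.basisFun (Fin 2) ℝ).toBasis
    !![u 0, v 0; u 1, v 1]

theorem frameMap_det (u v : Plane) : LinearMap.det (frameMap u v) = cross u v := by
  rw [frameMap, LinearMap.det_toLin, Matrix.det_fin_two_of, cross]; ring

theorem frameMap_unitVec_zero (u v : Plane) : frameMap u v (unitVec 0) = u := by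
  have h : unitVec 0 = (EuclideanSpace.basisFun (Fin 2) ℝ).toBasis 0 := by simp [unitVec]
  rw [h, frameMap, Matrix.toLin_self]
  ext i; fin_cases i <;> simp

theorem frameMap_unitVec_one (u v : Plane) : frameMap u v (unitVec 1) = v := by
  have h : unitVec 1 = (EuclideanSpace.basisFun (Fin 2) ℝ).toBasis 1 := by simp [unitVec]
  rw [h, frameMap, Matrix.toLin_self]
  ext i; fin_cases i <;> simp

/-- The triangle is a translated linear image of the reference triangle, and the determinant scales
its area. The value of `refArea` is never needed, as the flux identities are linear in it. -/
theorem volume_tri (a b c : Plane) :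
    volume.real (tri {a, b, c}) = refArea * |cross (b - a) (c - a)| := by
  have h1 : tri {a, b, c} = a +ᵥ
      (frameMap (b - a) (c - a) '' convexHull ℝ ({0, unitVec 0, unitVec 1} : Set Plane)) := by
    rw [LinearMap.image_convexHull, ← convexHull_vadd]
    simp [image_insert_eq, frameMap_unitVec_zero, frameMap_unitVec_one, tri,
      Set.vadd_set_insert]
  rw [h1, Measure.real, measure_vadd, Measure.addHaar_image_linearMap, frameMap_det, refArea,
    ENNReal.toReal_mul, ENNReal.toReal_ofReal (abs_nonneg _), mul_comm]
  rfl

namespace IsTriangle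

variable {K L : Finset Plane} {a b c x : Plane}

theorem volume_tri_lt_top (K : Finset Plane) : volume (tri K) < ⊤ :=
  (isCompact_tri K).measure_lt_top

theorem volume_tri_pos (h : IsTriangle K) : 0 < volume.real (tri K) :=
  ENNReal.toReal_pos (Measure.measure_pos_of_nonempty_interior _ h.interior_nonempty).ne'
    (volume_tri_lt_top K).ne

theorem cross_ne_zero (h : IsTriangle {a, b, c}) : cross (b - a) (c - a) ≠ 0 := by
  intro h0
  have := h.volume_tri_pos
  rw [volume_tri, h0] at this
  simp at this

/-- Cramer's rule: the cross product with `b - a` removes the component of `x - a` along the edge.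
It ties the sign of a barycentric coordinate to a side of the line through `a` and `b`. -/
theorem bary_mul_cross (h : IsTriangle {a, b, c}) (x : Plane) :
    bary {a, b, c} c x * cross (b - a) (c - a) = cross (b - a) (x - a) := by
  obtain ⟨hab, hac, hbc⟩ := h.ne_of_insert
  have h1 := h.sum_bary x
  have h2 := h.sum_bary_smul x
  rw [sum_three _ hab hac hbc] at h1 h2
  set s := bary {a, b, c} a x
  set t := bary {a, b, c} b x
  set r := bary {a, b, c} c x
  have h3 : x - a = t • (b - a) + r • (c - a) := by
    rw [← h2, show s = 1 - t - r by linarith]; module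
  rw [h3, cross_add_right, cross_smul_right, cross_smul_right, cross_self]; ring

theorem bary_linear_mul_cross (h : IsTriangle {a, b, c}) (d : Plane) :
    (bary {a, b, c} c).linear d * cross (b - a) (c - a) = cross (b - a) d := by
  have h1 := h.bary_mul_cross (a + d)
  obtain ⟨hab, hac, hbc⟩ := h.ne_of_insert
  rw [affineMap_add, h.bary_ne (by simp) (by simp) hac] at h1
  simpa using h1

/-- The flux of a constant field through an edge in terms of the cross product. -/
theorem volume_mul_bary_linear (h : IsTriangle {a, b, c}) (d : Plane) :
    volume.real (tri {a, b, c}) * (bary {a, b, c} c).linear d =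
      refArea * SignType.sign (cross (b - a) (c - a)) * cross (b - a) d := by
  rw [volume_tri, ← h.bary_linear_mul_cross d]
  have h0 := h.cross_ne_zero
  rcases lt_or_gt_of_ne h0 with h1 | h1
  · simp [sign_neg h1, abs_of_neg h1]; ring
  · simp [sign_pos h1, abs_of_pos h1]; ring

/-- The area of the convex hull of at most two vertices of a triangle vanishes. -/
theorem volume_convexHull_eq_zero (h : IsTriangle K) {S : Set Plane} (hS : S ⊆ K)
    (hc : c ∈ K) (hcS : c ∉ S) : volume (convexHull ℝ S) = 0 := by
  have h1 : convexHull ℝ S ⊆ tri K \ interior (tri K) := fun x hx =>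
    ⟨convexHull_mono hS hx, fun hi => (h.mem_interior.1 hi c hc).ne'
      (h.bary_eq_zero_of_mem_convexHull hS hc hcS hx)⟩
  refine measure_mono_null (h1.trans ?_) ((convex_convexHull ℝ (K : Set Plane)).addHaar_frontier volume)
  rw [← (isClosed_tri K).frontier_eq]

theorem interior_ae_eq (K : Finset Plane) : interior (tri K) =ᵐ[volume] tri K :=
  interior_ae_eq_of_null_frontier ((convex_convexHull ℝ (K : Set Plane)).addHaar_frontier volume)

end IsTriangle

/-! ### Conforming families of triangles -/

/-- A finite conforming family of triangles. -/
structure IsMesh (S : Finset (Finset Plane)) : Prop where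
  isTriangle : ∀ K ∈ S, IsTriangle K
  inter_eq : ∀ K ∈ S, ∀ L ∈ S, tri K ∩ tri L = convexHull ℝ ((K : Set Plane) ∩ (L : Set Plane))

theorem Triangulation.isMesh {Ω : Set Plane} (T : Triangulation Ω) : IsMesh T.elems :=
  ⟨fun _ => T.isTriangle, T.inter_eq⟩

namespace IsMesh

variable {S S' : Finset (Finset Plane)} {K L : Finset Plane}

theorem mono (h : IsMesh S) (hS : S' ⊆ S) : IsMesh S' :=
  ⟨fun K hK => h.isTriangle K (hS hK), fun K hK L hL => h.inter_eq K (hS hK) L (hS hL)⟩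

theorem exists_mem_notMem (h : IsMesh S) (hK : K ∈ S) (hL : L ∈ S) (hKL : K ≠ L) :
    ∃ c ∈ K, c ∉ L := by
  by_contra! hc
  exact hKL (Finset.eq_of_subset_of_card_le hc
    (by rw [(h.isTriangle K hK).card_eq, (h.isTriangle L hL).card_eq]))

/-- Two elements coincide if one meets the interior of the other. -/
theorem eq_of_mem_interior (h : IsMesh S) (hK : K ∈ S) (hL : L ∈ S) {x : Plane}
    (hx : x ∈ interior (tri K)) (hxL : x ∈ tri L) : K = L := by
  by_contra hKL
  obtain ⟨c, hc, hcL⟩ := h.exists_mem_notMem hK hL hKL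
  have h1 : x ∈ convexHull ℝ ((K : Set Plane) ∩ L) := by
    rw [← h.inter_eq K hK L hL]; exact ⟨interior_subset hx, hxL⟩
  exact ((h.isTriangle K hK).mem_interior.1 hx c hc).ne'
    ((h.isTriangle K hK).bary_eq_zero_of_mem_convexHull inter_subset_left hc
      (fun hcc => hcL hcc.2) h1)

theorem aedisjoint (h : IsMesh S) (hK : K ∈ S) (hL : L ∈ S) (hKL : K ≠ L) :
    AEDisjoint volume (tri K) (tri L) := by
  obtain ⟨c, hc, hcL⟩ := h.exists_mem_notMem hK hL hKL
  rw [AEDisjoint, h.inter_eq K hK L hL]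
  exact (h.isTriangle K hK).volume_convexHull_eq_zero inter_subset_left hc (fun hcc => hcL hcc.2)

/-- If a point of two elements has a positive barycentric coordinate with respect to a vertex of
the first one, then this vertex belongs to the second one as well. -/
theorem mem_of_bary_ne_zero (h : IsMesh S) (hK : K ∈ S) (hL : L ∈ S) {x c : Plane}
    (hx : x ∈ tri K) (hxL : x ∈ tri L) (hc : c ∈ K) (h0 : bary K c x ≠ 0) : c ∈ L := by
  by_contra hcL
  have h1 : x ∈ convexHull ℝ ((K : Set Plane) ∩ L) := by
    rw [← h.inter_eq K hK L hL]; exact ⟨hx, hxL⟩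
  exact h0 ((h.isTriangle K hK).bary_eq_zero_of_mem_convexHull inter_subset_left hc
      (fun hcc => hcL hcc.2) h1)

theorem setIntegral_biUnion (h : IsMesh S) {E : Type*} [NormedAddCommGroup E] [NormedSpace ℝ E]
    {f : Plane → E} (hf : ∀ K ∈ S, IntegrableOn f (tri K)) :
    ∫ x in ⋃ K ∈ S, tri K, f x = ∑ K ∈ S, ∫ x in tri K, f x := by
  -- The closed elements overlap on edges; their interiors are genuinely disjoint and differ from
  -- them by null sets.
  have h1 : (⋃ K ∈ S, tri K) =ᵐ[volume] ⋃ K ∈ S, interior (tri K) := by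
    refine (Finset.eventuallyEq_iUnion S fun K _ => ?_).symm
    exact IsTriangle.interior_ae_eq K
  rw [setIntegral_congr_set h1, integral_biUnion_finset]
  · exact Finset.sum_congr rfl fun K _ => setIntegral_congr_set (IsTriangle.interior_ae_eq K)
  · exact fun K _ => isOpen_interior.measurableSet
  · intro K hK L hL hKL
    refine Set.disjoint_left.2 fun x hx hxL => hKL (h.eq_of_mem_interior hK hL hx ?_)
    exact interior_subset hxL
  · exact fun K hK => (hf K hK).mono_set interior_subset

theorem volume_biUnion (h : IsMesh S) :
    volume.real (⋃ K ∈ S, tri K) = ∑ K ∈ S, volume.real (tri K) := by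
  have h1 := h.setIntegral_biUnion (f := fun _ => (1 : ℝ)) fun K _ =>
    integrableOn_const (IsTriangle.volume_tri_lt_top K).ne
  simpa using h1

end IsMesh

/-! ### Affine fields that are continuous at the midpoints of the edges -/

/-- The Frobenius norm of a linear map of the plane. -/
def frob (L : Plane →ₗ[ℝ] Plane) : ℝ := Real.sqrt (∑ i, ∑ j, (L (unitVec j) i) ^ 2)

theorem frob_nonneg (L : Plane →ₗ[ℝ] Plane) : 0 ≤ frob L := Real.sqrt_nonneg _

theorem frob_sq (L : Plane →ₗ[ℝ] Plane) : frob L ^ 2 = ∑ i, ∑ j, (L (unitVec j) i) ^ 2 :=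
  Real.sq_sqrt (by positivity)

theorem linear_apply_coord (L : Plane →ₗ[ℝ] Plane) (x : Plane) (i : Fin 2) :
    L x i = ∑ j, x j * L (unitVec j) i := by
  have h : x = ∑ j, x j • unitVec j := by
    ext i; fin_cases i <;> simp [unitVec]
  conv_lhs => rw [h, map_sum]
  simp

theorem norm_apply_le_frob (L : Plane →ₗ[ℝ] Plane) (x : Plane) : ‖L x‖ ≤ frob L * ‖x‖ := by
  refine abs_le_of_sq_le_sq' ?_ (by have := frob_nonneg L; positivity) |>.2
  rw [mul_pow, frob_sq, EuclideanSpace.real_norm_sq_eq, EuclideanSpace.real_norm_sq_eq]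
  simp only [linear_apply_coord L x, Fin.sum_univ_two]
  -- Lagrange's identity: in each row the gap in the Cauchy–Schwarz inequality is the square of a
  -- determinant.
  nlinarith [sq_nonneg (x 0 * L (unitVec 1) 0 - x 1 * L (unitVec 0) 0),
    sq_nonneg (x 0 * L (unitVec 1) 1 - x 1 * L (unitVec 0) 1)]

/-- The centroid of a triangle. -/
def cen (K : Finset Plane) : Plane := ∑ p ∈ K, (3⁻¹ : ℝ) • p

/-- The bound `diam K * ‖∇ A‖` of the oscillation of an affine field on `K`. -/
def osc (A : Finset Plane → Plane →ᵃ[ℝ] Plane) (K : Finset Plane) : ℝ :=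
  Metric.diam (tri K) * frob (A K).linear

/-- The affine fields `A K` take the same values at the midpoints of common edges. -/
def IsCR (S : Finset (Finset Plane)) (A : Finset Plane → Plane →ᵃ[ℝ] Plane) : Prop :=
  ∀ K ∈ S, ∀ L ∈ S, ∀ a b : Plane, a ≠ b → a ∈ K → b ∈ K → a ∈ L → b ∈ L →
    A K (midpoint ℝ a b) = A L (midpoint ℝ a b)

theorem osc_nonneg (A : Finset Plane → Plane →ᵃ[ℝ] Plane) (K : Finset Plane) : 0 ≤ osc A K :=
  mul_nonneg Metric.diam_nonneg (frob_nonneg _)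

theorem norm_affine_sub_le (A : Plane →ᵃ[ℝ] Plane) (x y : Plane) :
    ‖A x - A y‖ ≤ frob A.linear * ‖x - y‖ := by
  have h := A.linearMap_vsub x y
  simp only [vsub_eq_sub] at h
  rw [← h]
  exact norm_apply_le_frob _ _

namespace IsTriangle

variable {K : Finset Plane} {x y a b : Plane}

theorem norm_sub_le_osc (A : Finset Plane → Plane →ᵃ[ℝ] Plane) (hx : x ∈ tri K) (hy : y ∈ tri K) :
    ‖A K x - A K y‖ ≤ osc A K := by
  refine (norm_affine_sub_le _ _ _).trans ?_
  rw [osc, mul_comm, ← dist_eq_norm]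
  gcongr
  · exact frob_nonneg _
  · exact Metric.dist_le_diam_of_mem (isCompact_tri K).isBounded hx hy

theorem bary_cen (h : IsTriangle K) {c : Plane} (hc : c ∈ K) : bary K c (cen K) = 3⁻¹ := by
  rw [cen, affineMap_sum_smul _ _ _ _ (by simp [h.card_eq])]
  rw [Finset.sum_eq_single c]
  · simp [h.bary_self hc]
  · intro b hb hbc; simp [h.bary_ne hc hb hbc]
  · exact fun h' => absurd hc h'

theorem cen_mem (h : IsTriangle K) : cen K ∈ tri K :=
  h.mem_tri.2 fun c hc => by rw [h.bary_cen hc]; norm_num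

theorem midpoint_mem (ha : a ∈ K) (hb : b ∈ K) : midpoint ℝ a b ∈ tri K :=
  (convex_convexHull ℝ (K : Set Plane)).segment_subset (mem_tri_of_mem ha) (mem_tri_of_mem hb)
    (midpoint_mem_segment a b)

/-- A point that is no vertex has at least two non-zero barycentric coordinates. -/
theorem exists_two_bary_ne_zero (h : IsTriangle K) (hx : x ∉ K) :
    ∃ a ∈ K, ∃ b ∈ K, a ≠ b ∧ bary K a x ≠ 0 ∧ bary K b x ≠ 0 := by
  have h1 := h.sum_bary x
  obtain ⟨a, ha, ha0⟩ : ∃ a ∈ K, bary K a x ≠ 0 := by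
    by_contra! h0
    rw [Finset.sum_eq_zero h0] at h1
    norm_num at h1
  by_contra! hall
  have h2 : ∀ b ∈ K, b ≠ a → bary K b x = 0 := fun b hb hba => hall a ha b hb hba.symm ha0
  have h3 := h.sum_bary_smul x
  rw [Finset.sum_eq_single_of_mem a ha h2] at h1
  rw [Finset.sum_eq_single_of_mem a ha (fun b hb hba => by rw [h2 b hb hba, zero_smul]), h1,
    one_smul] at h3
  exact hx (h3 ▸ ha)

end IsTriangle

/-- Telescoping along a walk uses each visited vertex at most twice, and a path visits no vertex
twice. The bound is thus independent of the length of the chain. -/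
theorem norm_sub_le_of_reachable {V E : Type*} [Fintype V] [SeminormedAddCommGroup E]
    (G : SimpleGraph V) (f : V → E) (o : V → ℝ) (ho : ∀ v, 0 ≤ o v)
    (hadj : ∀ u v, G.Adj u v → ‖f u - f v‖ ≤ o u + o v) {u v : V} (h : G.Reachable u v) :
    ‖f u - f v‖ ≤ 2 * ∑ w, o w := by
  -- The additional `o u` on the left pays for the edge that a longer walk puts in front of `u`.
  have key : ∀ {u v : V} (p : G.Walk u v),
      ‖f u - f v‖ + o u ≤ 2 * (p.support.map o).sum := by
    intro u v p
    induction p with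
    | nil => rename_i u; simp; linarith [ho u]
    | @cons u v w huv p ih =>
      rw [SimpleGraph.Walk.support_cons, List.map_cons, List.sum_cons]
      have := norm_sub_le_norm_sub_add_norm_sub (f u) (f v) (f w)
      linarith [hadj u v huv]
  obtain ⟨p⟩ := h
  have h1 := key p.toPath.1
  have h2 : (p.toPath.1.support.map o).sum ≤ ∑ w, o w := by
    rw [← List.sum_toFinset o p.toPath.2.support_nodup]
    exact Finset.sum_le_sum_of_subset_of_nonneg (Finset.subset_univ _) fun w _ _ => ho w
  linarith [ho u]

/-- The values at the centroids of two triangles differ at most by twice the sum of the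
oscillations over the triangles that meet a segment which joins them and avoids all vertices. -/
theorem IsMesh.norm_cen_sub_cen_le {S : Finset (Finset Plane)} (hS : IsMesh S)
    {A : Finset Plane → Plane →ᵃ[ℝ] Plane} (hA : IsCR S A) {x y : Plane} {T T' : Finset Plane}
    (hT : T ∈ S) (hT' : T' ∈ S) (hx : x ∈ tri T) (hy : y ∈ tri T')
    (hsub : segment ℝ x y ⊆ ⋃ K ∈ S, tri K)
    (hvert : ∀ K ∈ S, ∀ p ∈ K, p ∉ segment ℝ x y) :
    ‖A T (cen T) - A T' (cen T')‖ ≤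
      2 * ∑ K ∈ S with (tri K ∩ segment ℝ x y).Nonempty, osc A K := by
  set R := S.filter fun K => (tri K ∩ segment ℝ x y).Nonempty with hR
  let G : SimpleGraph R :=
    { Adj := fun K L => K ≠ L ∧ ∃ a b, a ≠ b ∧ a ∈ K.1 ∧ b ∈ K.1 ∧ a ∈ L.1 ∧ b ∈ L.1
      symm := ⟨fun K L ⟨h, a, b, hab, h1, h2, h3, h4⟩ => ⟨h.symm, a, b, hab, h3, h4, h1, h2⟩⟩
      loopless := ⟨fun K h => h.1 rfl⟩ }
  have hmem : ∀ K : R, K.1 ∈ S := fun K => (Finset.mem_filter.1 K.2).1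
  have hTR : T ∈ R := Finset.mem_filter.2 ⟨hT, x, hx, left_mem_segment ℝ x y⟩
  have hTR' : T' ∈ R := Finset.mem_filter.2 ⟨hT', y, hy, right_mem_segment ℝ x y⟩
  -- If `T'` were unreachable, the reachable and the unreachable elements would form two closed sets
  -- that cover the connected segment, so they would share a point of it.
  have hreach : G.Reachable ⟨T, hTR⟩ ⟨T', hTR'⟩ := by
    by_contra hnot
    have hcl : ∀ P : R → Prop, IsClosed (⋃ K : {K : R // P K}, tri K.1.1) := fun P =>
      isClosed_iUnion_of_finite fun K => IsTriangle.isClosed_tri _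
    obtain ⟨z, hz, hz1, hz2⟩ := isPreconnected_closed_iff.1
      (convex_segment x y).isPreconnected _ _ (hcl fun K => G.Reachable ⟨T, hTR⟩ K)
      (hcl fun K => ¬ G.Reachable ⟨T, hTR⟩ K)
      (by
        intro z hz
        obtain ⟨K, hK, hzK⟩ := mem_iUnion₂.1 (hsub hz)
        have hKR : K ∈ R := Finset.mem_filter.2 ⟨hK, z, hzK, hz⟩
        by_cases hr : G.Reachable ⟨T, hTR⟩ ⟨K, hKR⟩
        · exact Or.inl (mem_iUnion.2 ⟨⟨⟨K, hKR⟩, hr⟩, hzK⟩)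
        · exact Or.inr (mem_iUnion.2 ⟨⟨⟨K, hKR⟩, hr⟩, hzK⟩))
      ⟨x, left_mem_segment ℝ x y, mem_iUnion.2 ⟨⟨⟨T, hTR⟩, SimpleGraph.Reachable.refl _⟩, hx⟩⟩
      ⟨y, right_mem_segment ℝ x y, mem_iUnion.2 ⟨⟨⟨T', hTR'⟩, hnot⟩, hy⟩⟩
    obtain ⟨⟨K, hK⟩, hzK⟩ := mem_iUnion.1 hz1
    obtain ⟨⟨L, hL⟩, hzL⟩ := mem_iUnion.1 hz2
    -- The common point is no vertex, so two vertices of `K` carry non-zero coordinates there.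
    -- Conformity makes them vertices of `L`, and `K` and `L` share an edge.
    obtain ⟨a, ha, b, hb, hab, ha0, hb0⟩ := (hS.isTriangle K (hmem K)).exists_two_bary_ne_zero
      (x := z) fun h => hvert K (hmem K) z h hz
    have haL := hS.mem_of_bary_ne_zero (hmem K) (hmem L) hzK hzL ha ha0
    have hbL := hS.mem_of_bary_ne_zero (hmem K) (hmem L) hzK hzL hb hb0
    refine hL (hK.trans (SimpleGraph.Adj.reachable ⟨?_, a, b, hab, ha, hb, haL, hbL⟩))
    rintro rfl
    exact hL hK
  have h := norm_sub_le_of_reachable G (fun K => A K.1 (cen K.1)) (fun K => osc A K.1)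
    (fun K => osc_nonneg A _) (by
      rintro K L ⟨-, a, b, hab, ha, hb, haL, hbL⟩
      have h1 := IsTriangle.norm_sub_le_osc A (hS.isTriangle K (hmem K)).cen_mem
        (IsTriangle.midpoint_mem ha hb)
      have h2 := IsTriangle.norm_sub_le_osc A (IsTriangle.midpoint_mem haL hbL)
        (hS.isTriangle L (hmem L)).cen_mem
      rw [← hA K (hmem K) L (hmem L) a b hab ha hb haL hbL] at h2
      exact (norm_sub_le_norm_sub_add_norm_sub _ _ _).trans (add_le_add h1 h2)) hreach
  rwa [Finset.sum_coe_sort R (fun K => osc A K)] at h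

/-! ### Change of variables to barycentric coordinates -/

namespace IsTriangle

variable {K : Finset Plane} {i j x : Plane}

theorem continuous_bary (K : Finset Plane) (c : Plane) : Continuous (bary K c) :=
  (bary K c).continuous_of_finiteDimensional

theorem exists_third (h : IsTriangle K) (hi : i ∈ K) (hj : j ∈ K) (hij : i ≠ j) :
    ∃ k ∈ K, i ≠ k ∧ j ≠ k ∧ K = {i, j, k} := by
  have h1 : ((K.erase i).erase j).card = 1 := by
    rw [Finset.card_erase_of_mem (Finset.mem_erase.2 ⟨hij.symm, hj⟩), Finset.card_erase_of_mem hi,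
      h.card_eq]
  obtain ⟨k, hk⟩ := Finset.card_eq_one.1 h1
  have hk' : k ∈ (K.erase i).erase j := by simp [hk]
  simp only [Finset.mem_erase] at hk'
  refine ⟨k, hk'.2.2, hk'.2.1.symm, hk'.1.symm, ?_⟩
  rw [← hk, Finset.insert_erase (Finset.mem_erase.2 ⟨hij.symm, hj⟩), Finset.insert_erase hi]

/-- Two barycentric coordinates as a linear equivalence. -/
theorem exists_linearEquiv (h : IsTriangle K) (hi : i ∈ K) (hj : j ∈ K) (hij : i ≠ j) :
    ∃ M : Plane ≃ₗ[ℝ] ℝ × ℝ, ∀ d, M d = ((bary K i).linear d, (bary K j).linear d) := by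
  have hinj : Function.Injective ((bary K i).linear.prod (bary K j).linear) := by
    rw [← LinearMap.ker_eq_bot, LinearMap.ker_eq_bot']
    intro d hd
    have h1 : (bary K i).linear d = 0 := congrArg Prod.fst hd
    have h2 : (bary K j).linear d = 0 := congrArg Prod.snd hd
    obtain ⟨k, hk, hik, hjk, hK⟩ := h.exists_third hi hj hij
    have h3 := h.sum_bary_linear d
    have h4 := h.sum_bary_linear_smul d
    rw [hK, sum_three _ hij hik hjk, ← hK, h1, h2] at h3 h4
    have h5 : (bary K k).linear d = 0 := by simpa using h3
    simpa [h5] using h4.symm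
  exact ⟨LinearEquiv.ofInjectiveOfFinrankEq _ hinj (by simp), fun d => rfl⟩

/-- The image measure is a Haar measure, hence a multiple of Lebesgue measure. The factor stays
implicit; it is compared with the area of `K` by testing with squares. -/
theorem exists_map_eq_smul (h : IsTriangle K) (hi : i ∈ K) (hj : j ∈ K) (hij : i ≠ j) :
    ∃ q : ℝ≥0∞, q ≠ ⊤ ∧
      (volume : Measure Plane).map (fun x => (bary K i x, bary K j x)) = q • volume := by
  obtain ⟨M, hM⟩ := h.exists_linearEquiv hi hj hij
  have h1 : (fun x => (bary K i x, bary K j x)) =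
      (fun z => (bary K i 0, bary K j 0) + z) ∘ M.toContinuousLinearEquiv := by
    ext x
    · simpa [hM] using affineMap_add (bary K i) 0 x
    · simpa [hM] using affineMap_add (bary K j) 0 x
  have h2 : ((volume : Measure Plane).map M.toContinuousLinearEquiv).IsAddHaarMeasure :=
    M.toContinuousLinearEquiv.isAddHaarMeasure_map _
  refine ⟨Measure.addHaarScalarFactor ((volume : Measure Plane).map M.toContinuousLinearEquiv)
    volume, ENNReal.coe_ne_top, ?_⟩
  rw [h1, ← Measure.map_map (by fun_prop) (by fun_prop), map_add_left_eq_self]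
  exact Measure.isAddLeftInvariant_eq_smul _ _

end IsTriangle

/-! ### Area comparisons and Fubini in barycentric coordinates -/

namespace IsTriangle

variable {K : Finset Plane} {i j x : Plane}

theorem measurable_bary (K : Finset Plane) (c : Plane) : Measurable (bary K c) :=
  (continuous_bary K c).measurable

theorem exists_ne (h : IsTriangle K) (i : Plane) : ∃ j ∈ K, i ≠ j := by
  by_contra! h1
  have h2 : K ⊆ {i} := fun x hx => by simp [h1 x hx]
  have := Finset.card_le_card h2
  rw [h.card_eq] at this
  simp at this

theorem volume_bary_eq (h : IsTriangle K) (hi : i ∈ K) (s : ℝ) :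
    volume {x | bary K i x = s} = 0 := by
  obtain ⟨j, hj, hij⟩ := h.exists_ne i
  obtain ⟨q, -, hmap⟩ := h.exists_map_eq_smul hi hj hij
  have h1 : {x | bary K i x = s} =
      (fun x => (bary K i x, bary K j x)) ⁻¹' ({s} ×ˢ univ) := by ext x; simp
  rw [h1, ← Measure.map_apply ((measurable_bary K i).prodMk (measurable_bary K j))
    ((measurableSet_singleton s).prod MeasurableSet.univ), hmap, Measure.smul_apply,
    Measure.volume_eq_prod, Measure.prod_prod]
  simp

/-- The part of the triangle in which all barycentric coordinates are at most `1 / 2`. -/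
def _root_.StokesCR.medial (K : Finset Plane) : Set Plane :=
  {x | x ∈ tri K ∧ ∀ c ∈ K, bary K c x ≤ 2⁻¹}

/-- In two barycentric coordinates the triangle lies in the unit square, while the medial triangle
contains the square `[1/4, 1/2]²`, where the third coordinate lies between `0` and `1/2`. The areas
of the squares have ratio 16. -/
theorem volume_le_volume_medial (h : IsTriangle K) : volume (tri K) ≤ 16 * volume (medial K) := by
  obtain ⟨i, hi⟩ : K.Nonempty := Finset.card_pos.1 (by rw [h.card_eq]; norm_num)
  obtain ⟨j, hj, hij⟩ := h.exists_ne i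
  obtain ⟨k, hk, hik, hjk, hK⟩ := h.exists_third hi hj hij
  obtain ⟨q, -, hmap⟩ := h.exists_map_eq_smul hi hj hij
  have hq : ∀ a b : ℝ, volume ((fun x => (bary K i x, bary K j x)) ⁻¹' (Icc a b ×ˢ Icc a b)) =
      q * (ENNReal.ofReal (b - a) * ENNReal.ofReal (b - a)) := fun a b => by
    rw [← Measure.map_apply ((measurable_bary K i).prodMk (measurable_bary K j))
      (measurableSet_Icc.prod measurableSet_Icc), hmap, Measure.smul_apply,
      Measure.volume_eq_prod, Measure.prod_prod, Real.volume_Icc, smul_eq_mul]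
  have h1 : volume (tri K) ≤ q := by
    refine (measure_mono fun x hx => ?_).trans_eq ((hq 0 1).trans (by simp))
    exact ⟨⟨h.mem_tri.1 hx i hi, h.bary_le_one hi hx⟩, h.mem_tri.1 hx j hj, h.bary_le_one hj hx⟩
  have h2 : q * (ENNReal.ofReal (4⁻¹) * ENNReal.ofReal (4⁻¹)) ≤ volume (medial K) := by
    have h3 := hq 4⁻¹ 2⁻¹
    rw [show (2⁻¹ - 4⁻¹ : ℝ) = 4⁻¹ by norm_num] at h3
    rw [← h3]
    refine measure_mono fun x hx => ?_
    obtain ⟨⟨h4, h5⟩, h6, h7⟩ := hx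
    simp only at h4 h5 h6 h7
    have h8 := h.sum_bary x
    rw [hK, sum_three _ hij hik hjk, ← hK] at h8
    have h9 : ∀ c ∈ K, c = i ∨ c = j ∨ c = k := fun c hc => by rw [hK] at hc; simpa using hc
    refine ⟨h.mem_tri.2 fun c hc => ?_, fun c hc => ?_⟩ <;>
      rcases h9 c hc with rfl | rfl | rfl <;> linarith
  have h4 : (16 : ℝ≥0∞) * (ENNReal.ofReal (4⁻¹) * ENNReal.ofReal (4⁻¹)) = 1 := by
    rw [← ENNReal.ofReal_mul (by norm_num), ← ENNReal.ofReal_ofNat, ← ENNReal.ofReal_mul (by norm_num)]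
    norm_num
  calc volume (tri K) ≤ q := h1
    _ = 16 * (q * (ENNReal.ofReal (4⁻¹) * ENNReal.ofReal (4⁻¹))) := by
      rw [mul_left_comm, h4, mul_one]
    _ ≤ _ := by gcongr

/-- Fubini in the coordinates of `i` and `j` after enlarging the triangle to the unit square. The
Jacobian factor `q` is at most `4 |K|` since the preimage of `[0, 1/2]²` lies in the triangle. -/
theorem setLIntegral_mul_bary_le (h : IsTriangle K) (hi : i ∈ K) (hj : j ∈ K) (hij : i ≠ j)
    {f g : ℝ → ℝ≥0∞} (hf : Measurable f) (hg : Measurable g) :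
    ∫⁻ x in tri K, f (bary K i x) * g (bary K j x) ≤
      4 * volume (tri K) * ((∫⁻ s in Icc 0 1, f s) * ∫⁻ s in Icc 0 1, g s) := by
  obtain ⟨k, hk, hik, hjk, hK⟩ := h.exists_third hi hj hij
  obtain ⟨q, -, hmap⟩ := h.exists_map_eq_smul hi hj hij
  have hm : Measurable fun x => (bary K i x, bary K j x) :=
    (measurable_bary K i).prodMk (measurable_bary K j)
  have h1 : q ≤ 4 * volume (tri K) := by
    have h2 : q * (ENNReal.ofReal 2⁻¹ * ENNReal.ofReal 2⁻¹) ≤ volume (tri K) := by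
      have h3 : volume ((fun x => (bary K i x, bary K j x)) ⁻¹' (Icc 0 2⁻¹ ×ˢ Icc 0 2⁻¹)) =
          q * (ENNReal.ofReal 2⁻¹ * ENNReal.ofReal 2⁻¹) := by
        rw [← Measure.map_apply hm (measurableSet_Icc.prod measurableSet_Icc), hmap,
          Measure.smul_apply, Measure.volume_eq_prod, Measure.prod_prod, Real.volume_Icc,
          smul_eq_mul, sub_zero]
      rw [← h3]
      refine measure_mono fun x hx => ?_
      obtain ⟨⟨h4, h5⟩, h6, h7⟩ := hx
      simp only at h4 h5 h6 h7
      have h8 := h.sum_bary x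
      rw [hK, sum_three _ hij hik hjk, ← hK] at h8
      refine h.mem_tri.2 fun c hc => ?_
      rw [hK, Finset.mem_insert, Finset.mem_insert, Finset.mem_singleton] at hc
      rcases hc with rfl | rfl | rfl <;> linarith
    have h4 : (4 : ℝ≥0∞) * (ENNReal.ofReal (2⁻¹) * ENNReal.ofReal (2⁻¹)) = 1 := by
      rw [← ENNReal.ofReal_mul (by norm_num), ← ENNReal.ofReal_ofNat,
        ← ENNReal.ofReal_mul (by norm_num)]
      norm_num
    calc q = 4 * (q * (ENNReal.ofReal (2⁻¹) * ENNReal.ofReal (2⁻¹))) := by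
          rw [mul_left_comm, h4, mul_one]
      _ ≤ _ := by gcongr
  have hF : Measurable fun z : ℝ × ℝ => (Icc 0 1).indicator f z.1 * (Icc 0 1).indicator g z.2 :=
    ((hf.indicator measurableSet_Icc).comp measurable_fst).mul
      ((hg.indicator measurableSet_Icc).comp measurable_snd)
  calc ∫⁻ x in tri K, f (bary K i x) * g (bary K j x)
      ≤ ∫⁻ x in tri K, (Icc 0 1).indicator f (bary K i x) * (Icc 0 1).indicator g (bary K j x) := by
        refine setLIntegral_mono' (isClosed_tri K).measurableSet fun x hx => ?_
        have h2 : bary K i x ∈ Icc (0 : ℝ) 1 := ⟨h.mem_tri.1 hx i hi, h.bary_le_one hi hx⟩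
        have h3 : bary K j x ∈ Icc (0 : ℝ) 1 := ⟨h.mem_tri.1 hx j hj, h.bary_le_one hj hx⟩
        rw [indicator_of_mem h2, indicator_of_mem h3]
    _ ≤ ∫⁻ x, (Icc 0 1).indicator f (bary K i x) * (Icc 0 1).indicator g (bary K j x) :=
        setLIntegral_le_lintegral _ _
    _ = ∫⁻ z, (Icc 0 1).indicator f z.1 * (Icc 0 1).indicator g z.2
          ∂((volume : Measure Plane).map (fun x => (bary K i x, bary K j x))) :=
        (lintegral_map hF hm).symm
    _ = q * ((∫⁻ s in Icc 0 1, f s) * ∫⁻ s in Icc 0 1, g s) := by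
        rw [hmap, lintegral_smul_measure, Measure.volume_eq_prod, lintegral_prod_mul
          (hf.indicator measurableSet_Icc).aemeasurable
          (hg.indicator measurableSet_Icc).aemeasurable, lintegral_indicator measurableSet_Icc,
          lintegral_indicator measurableSet_Icc, smul_eq_mul]
    _ ≤ _ := by gcongr

end IsTriangle

/-! ### A Poincaré inequality for the values at the centroids -/

/-- Twice the sum of the oscillations over the elements that meet the line `bary K i = s`. -/
def lineOsc (S : Finset (Finset Plane)) (A : Finset Plane → Plane →ᵃ[ℝ] Plane)
    (K : Finset Plane) (i : Plane) (s : ℝ) : ℝ :=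
  2 * ∑ T ∈ S, (bary K i '' tri T).indicator (fun _ => osc A T) s

theorem lineOsc_nonneg (S : Finset (Finset Plane)) (A : Finset Plane → Plane →ᵃ[ℝ] Plane)
    (K : Finset Plane) (i : Plane) (s : ℝ) : 0 ≤ lineOsc S A K i s :=
  mul_nonneg zero_le_two (Finset.sum_nonneg fun T _ => indicator_nonneg (fun _ _ => osc_nonneg A T) s)

theorem measurableSet_bary_image (K T : Finset Plane) (i : Plane) :
    MeasurableSet (bary K i '' tri T) :=
  ((IsTriangle.isCompact_tri T).image (IsTriangle.continuous_bary K i)).isClosed.measurableSet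

theorem measurable_lineOsc (S : Finset (Finset Plane)) (A : Finset Plane → Plane →ᵃ[ℝ] Plane)
    (K : Finset Plane) (i : Plane) : Measurable (lineOsc S A K i) :=
  (Finset.measurable_sum S fun T _ =>
    measurable_const.indicator (measurableSet_bary_image K T i)).const_mul 2

/-- An element `T` is counted only for `s` in its image under the coordinate, a set of length at
most `Λ * diam T`. -/
theorem lintegral_lineOsc_le {S : Finset (Finset Plane)} {A : Finset Plane → Plane →ᵃ[ℝ] Plane}
    {K : Finset Plane} {i : Plane} {Λ : ℝ}
    (hΛ : ∀ x y, |bary K i x - bary K i y| ≤ Λ * ‖x - y‖) (hΛ0 : 0 ≤ Λ) :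
    ∫⁻ s in Icc 0 1, ENNReal.ofReal (lineOsc S A K i s) ≤
      ENNReal.ofReal (2 * ∑ T ∈ S, Λ * Metric.diam (tri T) * osc A T) := by
  have h1 : ∀ s, ENNReal.ofReal (lineOsc S A K i s) =
      2 * ∑ T ∈ S, (bary K i '' tri T).indicator (fun _ => ENNReal.ofReal (osc A T)) s := fun s => by
    rw [lineOsc, ENNReal.ofReal_mul zero_le_two, ENNReal.ofReal_ofNat,
      ENNReal.ofReal_sum_of_nonneg fun T _ => indicator_nonneg (fun _ _ => osc_nonneg A T) s]
    congr 1
    refine Finset.sum_congr rfl fun T _ => ?_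
    by_cases hs : s ∈ bary K i '' tri T <;> simp [hs]
  have h2 : ∀ T : Finset Plane, Measurable
      ((bary K i '' tri T).indicator fun _ : ℝ => ENNReal.ofReal (osc A T)) := fun T =>
    measurable_const.indicator (measurableSet_bary_image K T i)
  calc ∫⁻ s in Icc 0 1, ENNReal.ofReal (lineOsc S A K i s)
      ≤ ∫⁻ s, ENNReal.ofReal (lineOsc S A K i s) := setLIntegral_le_lintegral _ _
    _ = 2 * ∑ T ∈ S, ENNReal.ofReal (osc A T) * volume (bary K i '' tri T) := by
        simp_rw [h1]
        rw [lintegral_const_mul _ (Finset.measurable_sum S fun T _ => h2 T),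
          lintegral_finsetSum S fun T _ => h2 T]
        congr 1
        refine Finset.sum_congr rfl fun T _ => ?_
        rw [lintegral_indicator_const (measurableSet_bary_image K T i)]
    _ ≤ 2 * ∑ T ∈ S, ENNReal.ofReal (osc A T) * ENNReal.ofReal (Λ * Metric.diam (tri T)) := by
        gcongr with T hT
        refine (Real.volume_le_diam _).trans (Metric.ediam_le ?_)
        rintro _ ⟨x, hx, rfl⟩ _ ⟨y, hy, rfl⟩
        rw [edist_dist]
        refine ENNReal.ofReal_le_ofReal ?_
        rw [Real.dist_eq]
        refine (hΛ x y).trans ?_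
        rw [← dist_eq_norm]
        gcongr
        exact Metric.dist_le_diam_of_mem (IsTriangle.isCompact_tri T).isBounded hx hy
    _ = _ := by
        rw [ENNReal.ofReal_mul zero_le_two, ENNReal.ofReal_ofNat, ENNReal.ofReal_sum_of_nonneg
          fun T _ => mul_nonneg (mul_nonneg hΛ0 Metric.diam_nonneg) (osc_nonneg A T)]
        congr 1
        refine Finset.sum_congr rfl fun T _ => ?_
        rw [mul_comm, ENNReal.ofReal_mul (mul_nonneg hΛ0 Metric.diam_nonneg)]

namespace IsMesh

variable {S : Finset (Finset Plane)} {A : Finset Plane → Plane →ᵃ[ℝ] Plane} {K T T' : Finset Plane}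
  {i j x y z : Plane}

/-- The segment from `x` to `y` stays in `K` and on one level line of the coordinate, so every
element that it meets is counted in `lineOsc`. -/
theorem norm_cen_sub_cen_le_lineOsc (hS : IsMesh S) (hA : IsCR S A)
    (hK : ⋃ T ∈ S, tri T = tri K) (hT : T ∈ S) (hT' : T' ∈ S) (hx : x ∈ tri T) (hy : y ∈ tri T')
    (hxy : bary K i x = bary K i y) (hvert : ∀ L ∈ S, ∀ p ∈ L, bary K i p ≠ bary K i x) :
    ‖A T (cen T) - A T' (cen T')‖ ≤ lineOsc S A K i (bary K i x) := by
  have hmem : ∀ {L z}, L ∈ S → z ∈ tri L → z ∈ tri K := fun hL hz => by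
    rw [← hK]; exact mem_iUnion₂.2 ⟨_, hL, hz⟩
  have hseg : segment ℝ x y ⊆ (bary K i) ⁻¹' {bary K i x} :=
    ((convex_singleton (𝕜 := ℝ) (bary K i x)).affine_preimage (bary K i)).segment_subset rfl hxy.symm
  refine (hS.norm_cen_sub_cen_le hA hT hT' hx hy ?_ fun L hL p hp hps =>
    hvert L hL p hp (hseg hps)).trans ?_
  · rw [hK]
    exact (convex_convexHull ℝ (K : Set Plane)).segment_subset (hmem hT hx) (hmem hT' hy)
  · rw [lineOsc, Finset.sum_filter]
    gcongr with L hL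
    split_ifs with h
    · obtain ⟨z, hzL, hz⟩ := h
      rw [indicator_of_mem]
      exact ⟨z, hzL, hseg hz⟩
    · exact indicator_nonneg (fun _ _ => osc_nonneg A L) _

theorem exists_mem_of_mem_tri (hK : ⋃ T ∈ S, tri T = tri K) (hx : x ∈ tri K) :
    ∃ T ∈ S, x ∈ tri T := by
  rw [← hK] at hx
  simpa using hx

/-- Two points are joined by a path along a line `bary K i = const` and a line
`bary K j = const`. -/
theorem norm_cen_sub_cen_le_add (hS : IsMesh S) (hA : IsCR S A) (h : IsTriangle K)
    (hK : ⋃ T ∈ S, tri T = tri K) (hT : T ∈ S) (hT' : T' ∈ S) (hx : x ∈ tri T) (hy : y ∈ tri T')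
    (hi : i ∈ K) (hj : j ∈ K) (hij : i ≠ j) (hsum : bary K i x + bary K j y ≤ 1)
    (hvi : ∀ L ∈ S, ∀ p ∈ L, bary K i p ≠ bary K i x)
    (hvj : ∀ L ∈ S, ∀ p ∈ L, bary K j p ≠ bary K j y) :
    ‖A T (cen T) - A T' (cen T')‖ ≤
      lineOsc S A K i (bary K i x) + lineOsc S A K j (bary K j y) := by
  have hmem : ∀ {L z}, L ∈ S → z ∈ tri L → z ∈ tri K := fun hL hz => by
    rw [← hK]; exact mem_iUnion₂.2 ⟨_, hL, hz⟩
  obtain ⟨k, hk, hik, hjk, hKe⟩ := h.exists_third hi hj hij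
  set s := bary K i x with hs
  set t := bary K j y with ht
  -- Barycentric coordinates of the corner of the path, where the level lines through `x` and `y`
  -- cross; `hsum` keeps it inside `K`.
  let w : Plane → ℝ := fun c => if c = i then s else if c = j then t else 1 - s - t
  have hw : ∑ c ∈ K, w c = 1 := by
    rw [hKe, IsTriangle.sum_three _ hij hik hjk]
    simp [w, hij.symm, hik.symm, hjk.symm]
  have hb : ∀ c ∈ K, bary K c (∑ c ∈ K, w c • c) = w c := fun c hc => by
    rw [affineMap_sum_smul _ _ _ _ hw, Finset.sum_eq_single c]
    · simp [h.bary_self hc]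
    · intro b hb hbc; simp [h.bary_ne hc hb hbc]
    · exact fun h' => absurd hc h'
  have hz : ∑ c ∈ K, w c • c ∈ tri K := h.mem_tri.2 fun c hc => by
    rw [hb c hc]
    simp only [w]
    split_ifs
    · exact h.mem_tri.1 (hmem hT hx) i hi
    · exact h.mem_tri.1 (hmem hT' hy) j hj
    · linarith
  obtain ⟨L, hL, hzL⟩ := exists_mem_of_mem_tri hK hz
  have hwi : w i = s := by simp [w]
  have hwj : w j = t := by simp [w, hij.symm]
  have h1 := hS.norm_cen_sub_cen_le_lineOsc hA hK hT hL hx hzL ((hb i hi).trans hwi).symm hvi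
  have h2 := hS.norm_cen_sub_cen_le_lineOsc hA hK hT' hL hy hzL ((hb j hj).trans hwj).symm hvj
  rw [norm_sub_rev] at h2
  exact (norm_sub_le_norm_sub_add_norm_sub _ _ _).trans (add_le_add h1 h2)

/-- **Poincaré inequality** for the centroid values of a Crouzeix–Raviart field on a triangulated
triangle, in terms of the `L¹` norm of the elementwise gradient. -/
theorem exists_sum_norm_cen_sub_sq_le (hS : IsMesh S) (hA : IsCR S A) (h : IsTriangle K)
    (hK : ⋃ T ∈ S, tri T = tri K) {Λ : ℝ} (hΛ0 : 0 ≤ Λ)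
    (hΛ : ∀ i ∈ K, ∀ x y, |bary K i x - bary K i y| ≤ Λ * ‖x - y‖) :
    ∃ c : Plane, ∑ T ∈ S, volume.real (tri T) * ‖A T (cen T) - c‖ ^ 2 ≤
      24 * 193 ^ 2 * volume.real (tri K) *
        (2 * ∑ T ∈ S, Λ * Metric.diam (tri T) * osc A T) ^ 2 := by
  set ρ := 2 * ∑ T ∈ S, Λ * Metric.diam (tri T) * osc A T with hρ
  have hρ0 : 0 ≤ ρ := mul_nonneg zero_le_two (Finset.sum_nonneg fun T _ =>
    mul_nonneg (mul_nonneg hΛ0 Metric.diam_nonneg) (osc_nonneg A T))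
  have hR : ∀ i ∈ K, ∫⁻ s in Icc 0 1, ENNReal.ofReal (lineOsc S A K i s) ≤ ENNReal.ofReal ρ :=
    fun i hi => lintegral_lineOsc_le (hΛ i hi) hΛ0
  clear_value ρ
  have hRm : ∀ i, Measurable fun s => ENNReal.ofReal (lineOsc S A K i s) := fun i =>
    (measurable_lineOsc S A K i).ennreal_ofReal
  -- The points on a level line through some mesh vertex form a null set. Outside of it all segments
  -- avoid the vertices.
  set N : Set Plane := ⋃ i ∈ K, ⋃ T ∈ S, ⋃ p ∈ T, {x | bary K i x = bary K i p} with hN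
  have hN0 : volume N = 0 := by
    refine (measure_biUnion_null_iff K.countable_toSet).2 fun i hi => ?_
    refine (measure_biUnion_null_iff S.countable_toSet).2 fun T _ => ?_
    exact (measure_biUnion_null_iff T.countable_toSet).2 fun p _ => h.volume_bary_eq hi _
  have hNmem : ∀ {x}, x ∉ N → ∀ i ∈ K, ∀ L ∈ S, ∀ p ∈ L, bary K i p ≠ bary K i x := by
    intro x hx i hi L hL p hp he
    exact hx (mem_iUnion₂.2 ⟨i, hi, mem_iUnion₂.2 ⟨L, hL, mem_iUnion₂.2 ⟨p, hp, he.symm⟩⟩⟩)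
  -- a good point of the medial triangle
  obtain ⟨y, hyD, hyN, hy⟩ : ∃ y ∈ medial K, y ∉ N ∧
      ∀ i ∈ K, lineOsc S A K i (bary K i y) ≤ 192 * ρ := by
    have hD0 : volume (medial K) ≠ 0 := by
      intro h0
      have h1 := h.volume_le_volume_medial
      rw [h0, mul_zero] at h1
      exact (Measure.measure_pos_of_nonempty_interior _ h.interior_nonempty).not_ge h1
    have hDtop : volume (medial K) ≠ ⊤ :=
      ((measure_mono fun x hx => hx.1).trans_lt (IsTriangle.volume_tri_lt_top K)).ne
    set F : Plane → ℝ≥0∞ := fun x => ∑ i ∈ K, ENNReal.ofReal (lineOsc S A K i (bary K i x)) with hF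
    have hFm : Measurable F := Finset.measurable_sum K fun i _ =>
      (hRm i).comp (IsTriangle.measurable_bary K i)
    -- The constant is `192 = 3 * 4 * 16`: three coordinates, the Jacobian bound, and the area ratio
    -- of `K` and its medial triangle. Some point outside `N` does not exceed the resulting average.
    have hFint : ∫⁻ x in medial K, F x ≤ volume (medial K) * ENNReal.ofReal (192 * ρ) := by
      calc ∫⁻ x in medial K, F x ≤ ∫⁻ x in tri K, F x :=
            lintegral_mono_set fun x hx => hx.1
        _ = ∑ i ∈ K, ∫⁻ x in tri K, ENNReal.ofReal (lineOsc S A K i (bary K i x)) :=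
            lintegral_finsetSum K fun i _ => (hRm i).comp (IsTriangle.measurable_bary K i)
        _ ≤ ∑ i ∈ K, 4 * volume (tri K) * ENNReal.ofReal ρ := by
            refine Finset.sum_le_sum fun i hi => ?_
            obtain ⟨j, hj, hij⟩ := h.exists_ne i
            have h1 := h.setLIntegral_mul_bary_le hi hj hij (hRm i) (measurable_const (a := 1))
            simp only [mul_one] at h1
            refine h1.trans ?_
            have h2 : ∫⁻ _ in Icc (0 : ℝ) 1, (1 : ℝ≥0∞) = 1 := by simp
            rw [h2, mul_one]
            gcongr
            exact hR i hi
        _ = 12 * volume (tri K) * ENNReal.ofReal ρ := by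
            rw [Finset.sum_const, h.card_eq, nsmul_eq_mul, ← mul_assoc, ← mul_assoc]
            norm_num
        _ ≤ 12 * (16 * volume (medial K)) * ENNReal.ofReal ρ := by
            gcongr; exact h.volume_le_volume_medial
        _ = _ := by
            rw [ENNReal.ofReal_mul (by norm_num), ENNReal.ofReal_ofNat]
            ring_nf
    have hpos := measure_le_setLAverage_pos hD0 hDtop hFm.aemeasurable
    rw [← measure_sdiff_null hN0] at hpos
    obtain ⟨y, ⟨hyD, hy⟩, hyN⟩ := nonempty_of_measure_ne_zero hpos.ne'
    refine ⟨y, hyD, hyN, fun i hi => ?_⟩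
    have h1 : F y ≤ ENNReal.ofReal (192 * ρ) := by
      refine hy.trans ?_
      rw [setLAverage_eq]
      refine ENNReal.div_le_of_le_mul' hFint
    have h2 : ENNReal.ofReal (lineOsc S A K i (bary K i y)) ≤ F y :=
      Finset.single_le_sum (f := fun i => ENNReal.ofReal (lineOsc S A K i (bary K i y)))
        (fun _ _ => zero_le) hi
    exact (ENNReal.ofReal_le_ofReal_iff (by positivity)).1 (h2.trans h1)
  obtain ⟨T₀, hT₀, hyT₀⟩ := exists_mem_of_mem_tri hK hyD.1
  refine ⟨A T₀ (cen T₀), ?_⟩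
  -- Each summand separates into functions of single coordinates. The sum over all ordered pairs
  -- avoids a choice of the pair depending on `x`.
  set Φ : Plane → ℝ≥0∞ := fun x => ∑ i ∈ K, ∑ j ∈ K.erase i,
    ENNReal.ofReal (lineOsc S A K i (bary K i x) + 192 * ρ) *
      ENNReal.ofReal (lineOsc S A K j (bary K j x) + 192 * ρ) with hΦ
  have hΦm : ∀ i, Measurable fun s => ENNReal.ofReal (lineOsc S A K i s + 192 * ρ) := fun i =>
    ((measurable_lineOsc S A K i).add_const _).ennreal_ofReal
  have hpt : ∀ T ∈ S, ∀ x ∈ tri T, x ∉ N →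
      ENNReal.ofReal (‖A T (cen T) - A T₀ (cen T₀)‖ ^ 2) ≤ Φ x := by
    intro T hT x hx hxN
    have hxK : x ∈ tri K := by rw [← hK]; exact mem_iUnion₂.2 ⟨T, hT, hx⟩
    -- At most one coordinate of `x` exceeds `1/2`. As all coordinates of `y` are at most `1/2`, the
    -- corners of both paths, with `i` and `j` in either role, lie in `K`.
    obtain ⟨i, hi, j, hj, hij, hi2, hj2⟩ : ∃ i ∈ K, ∃ j ∈ K, i ≠ j ∧
        bary K i x ≤ 2⁻¹ ∧ bary K j x ≤ 2⁻¹ := by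
      obtain ⟨i, hi⟩ : K.Nonempty := Finset.card_pos.1 (by rw [h.card_eq]; norm_num)
      obtain ⟨j, hj, hij⟩ := h.exists_ne i
      obtain ⟨k, hk, hik, hjk, hKe⟩ := h.exists_third hi hj hij
      have h8 := h.sum_bary x
      rw [hKe, IsTriangle.sum_three _ hij hik hjk, ← hKe] at h8
      have hi0 := h.mem_tri.1 hxK i hi
      have hj0 := h.mem_tri.1 hxK j hj
      have hk0 := h.mem_tri.1 hxK k hk
      by_cases h1 : bary K i x ≤ 2⁻¹
      · by_cases h2 : bary K j x ≤ 2⁻¹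
        · exact ⟨i, hi, j, hj, hij, h1, h2⟩
        · exact ⟨i, hi, k, hk, hik, h1, by linarith⟩
      · exact ⟨j, hj, k, hk, hjk, by linarith, by linarith⟩
    have h1 := hS.norm_cen_sub_cen_le_add hA h hK hT hT₀ hx hyT₀ hi hj hij
      (by linarith [hyD.2 j hj]) (hNmem hxN i hi) (hNmem hyN j hj)
    have h2 := hS.norm_cen_sub_cen_le_add hA h hK hT hT₀ hx hyT₀ hj hi hij.symm
      (by linarith [hyD.2 i hi]) (hNmem hxN j hj) (hNmem hyN i hi)
    -- The first path bounds the difference by a function of coordinate `i` of `x`, the second one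
    -- by a function of coordinate `j`; the square is at most their product.
    have h3 : ‖A T (cen T) - A T₀ (cen T₀)‖ ^ 2 ≤
        (lineOsc S A K i (bary K i x) + 192 * ρ) * (lineOsc S A K j (bary K j x) + 192 * ρ) := by
      rw [sq]
      refine mul_le_mul (h1.trans ?_) (h2.trans ?_) (norm_nonneg _) ?_
      · linarith [hy j hj]
      · linarith [hy i hi]
      · have := lineOsc_nonneg S A K i (bary K i x); positivity
    refine (ENNReal.ofReal_le_ofReal h3).trans ?_
    rw [ENNReal.ofReal_mul (by have := lineOsc_nonneg S A K i (bary K i x); positivity)]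
    refine le_trans ?_ (Finset.single_le_sum (f := fun i => ∑ j ∈ K.erase i,
      ENNReal.ofReal (lineOsc S A K i (bary K i x) + 192 * ρ) *
      ENNReal.ofReal (lineOsc S A K j (bary K j x) + 192 * ρ)) (fun _ _ => zero_le) hi)
    exact Finset.single_le_sum (f := fun j =>
      ENNReal.ofReal (lineOsc S A K i (bary K i x) + 192 * ρ) *
      ENNReal.ofReal (lineOsc S A K j (bary K j x) + 192 * ρ)) (fun _ _ => zero_le)
      (Finset.mem_erase.2 ⟨hij.symm, hj⟩)
  have hone : ∀ i ∈ K, ∫⁻ s in Icc 0 1, ENNReal.ofReal (lineOsc S A K i s + 192 * ρ) ≤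
      ENNReal.ofReal (193 * ρ) := by
    intro i hi
    have h1 : ∀ s, ENNReal.ofReal (lineOsc S A K i s + 192 * ρ) =
        ENNReal.ofReal (lineOsc S A K i s) + ENNReal.ofReal (192 * ρ) := fun s =>
      ENNReal.ofReal_add (lineOsc_nonneg S A K i s) (by positivity)
    simp_rw [h1]
    rw [lintegral_add_right _ measurable_const, show 193 * ρ = ρ + 192 * ρ by ring,
      ENNReal.ofReal_add hρ0 (by positivity)]
    refine add_le_add (hR i hi) ?_
    simp
  -- Six ordered pairs, each with the factor `4 |K|`, give 24; each one-dimensional integral is at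
  -- most `(1 + 192) ρ`.
  have hΦint : ∫⁻ x in tri K, Φ x ≤
      ENNReal.ofReal (24 * 193 ^ 2 * volume.real (tri K) * ρ ^ 2) := by
    have hmm : ∀ i j, Measurable fun x => ENNReal.ofReal (lineOsc S A K i (bary K i x) + 192 * ρ) *
      ENNReal.ofReal (lineOsc S A K j (bary K j x) + 192 * ρ) := fun i j =>
        ((hΦm i).comp (IsTriangle.measurable_bary K i)).mul
          ((hΦm j).comp (IsTriangle.measurable_bary K j))
    calc ∫⁻ x in tri K, Φ x = ∑ i ∈ K, ∑ j ∈ K.erase i, ∫⁻ x in tri K,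
          ENNReal.ofReal (lineOsc S A K i (bary K i x) + 192 * ρ) *
            ENNReal.ofReal (lineOsc S A K j (bary K j x) + 192 * ρ) := by
          rw [hΦ, lintegral_finsetSum K fun i _ => Finset.measurable_sum _ fun j _ => hmm i j]
          exact Finset.sum_congr rfl fun i _ => lintegral_finsetSum _ fun j _ => hmm i j
      _ ≤ ∑ i ∈ K, ∑ j ∈ K.erase i, 4 * volume (tri K) *
            (ENNReal.ofReal (193 * ρ) * ENNReal.ofReal (193 * ρ)) := by
          refine Finset.sum_le_sum fun i hi => Finset.sum_le_sum fun j hj => ?_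
          obtain ⟨hji, hj⟩ := Finset.mem_erase.1 hj
          refine (h.setLIntegral_mul_bary_le hi hj hji.symm (hΦm i) (hΦm j)).trans ?_
          gcongr
          exacts [hone i hi, hone j hj]
      _ = ∑ i ∈ K, 2 • (4 * volume (tri K) *
            (ENNReal.ofReal (193 * ρ) * ENNReal.ofReal (193 * ρ))) := by
          refine Finset.sum_congr rfl fun i hi => ?_
          rw [Finset.sum_const, Finset.card_erase_of_mem hi, h.card_eq]
      _ = _ := by
          rw [Finset.sum_const, h.card_eq, ← ENNReal.ofReal_mul (p := 193 * ρ) (by positivity),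
            show 24 * 193 ^ 2 * volume.real (tri K) * ρ ^ 2 =
              24 * (volume.real (tri K) * (193 * ρ * (193 * ρ))) by ring,
            ENNReal.ofReal_mul (p := 24) (by norm_num),
            ENNReal.ofReal_mul (p := volume.real (tri K)) measureReal_nonneg,
            ofReal_measureReal (IsTriangle.volume_tri_lt_top K).ne, ENNReal.ofReal_ofNat]
          simp only [nsmul_eq_mul]
          push_cast
          ring

  have hfin : ENNReal.ofReal (∑ T ∈ S, volume.real (tri T) * ‖A T (cen T) - A T₀ (cen T₀)‖ ^ 2) ≤
      ENNReal.ofReal (24 * 193 ^ 2 * volume.real (tri K) * ρ ^ 2) := by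
    refine le_trans ?_ hΦint
    rw [ENNReal.ofReal_sum_of_nonneg fun T _ => by positivity, ← hK,
      lintegral_biUnion_finset₀ (fun T hT T' hT' hne => hS.aedisjoint hT hT' hne)
        fun T _ => (IsTriangle.isClosed_tri T).measurableSet.nullMeasurableSet]
    refine Finset.sum_le_sum fun T hT => ?_
    rw [ENNReal.ofReal_mul (by positivity), ofReal_measureReal (IsTriangle.volume_tri_lt_top T).ne,
      mul_comm, ← setLIntegral_const]
    refine setLIntegral_mono_ae' (IsTriangle.isClosed_tri T).measurableSet ?_
    filter_upwards [measure_eq_zero_iff_ae_notMem.1 hN0] with x hxN hx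
    exact hpt T hT x hx hxN
  exact (ENNReal.ofReal_le_ofReal_iff (by positivity)).1 hfin

end IsMesh

/-! ### The discrete divergence theorem -/

/-- The midpoint of an edge, given by the set of its end points. -/
def edgeMid (e : Finset Plane) : Plane := ∑ p ∈ e, (2⁻¹ : ℝ) • p

theorem edgeMid_pair {a b : Plane} (hab : a ≠ b) : edgeMid {a, b} = midpoint ℝ a b := by
  rw [edgeMid, Finset.sum_pair hab, midpoint_eq_smul_add, smul_add, invOf_eq_inv]

/-- The flux of the constant field `x` through the edge of `T` opposite to `c`. -/
def flux (T : Finset Plane) (c x : Plane) : ℝ :=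
  -2 * (volume.real (tri T) * (bary T c).linear x)

/-- The length of an edge, given by the set of its end points. -/
def edgeLen (e : Finset Plane) : ℝ := Metric.diam (e : Set Plane)

/-- The edges of a family of triangles. -/
def edges (S : Finset (Finset Plane)) : Finset (Finset Plane) :=
  S.biUnion fun T => T.image fun c => T.erase c

theorem mem_edges {S : Finset (Finset Plane)} {e : Finset Plane} :
    e ∈ edges S ↔ ∃ T ∈ S, ∃ c ∈ T, T.erase c = e := by
  simp [edges]

namespace IsTriangle

variable {T K : Finset Plane} {a b c x y C p : Plane}

theorem bary_edgeMid_self (h : IsTriangle T) (hc : c ∈ T) :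
    bary T c (edgeMid (T.erase c)) = 0 := by
  rw [edgeMid, affineMap_sum_smul _ _ _ _ (by simp [Finset.card_erase_of_mem hc, h.card_eq])]
  refine Finset.sum_eq_zero fun p hp => ?_
  obtain ⟨hpc, hp⟩ := Finset.mem_erase.1 hp
  simp [h.bary_ne hc hp hpc]

theorem map_cen (h : IsTriangle T) (A : Plane →ᵃ[ℝ] Plane) :
    A (cen T) = ∑ c ∈ T, (3⁻¹ : ℝ) • A c :=
  affineMap_sum_smul _ _ _ _ (by simp [h.card_eq])

/-- The divergence theorem for an affine field and a multiple of the identity plus a constant. -/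
theorem green (h : IsTriangle T) (A : Plane →ᵃ[ℝ] Plane) (α : ℝ) (d : Plane) :
    volume.real (tri T) • ((2 * α) • A (cen T) + A.linear (α • cen T + d)) =
      ∑ c ∈ T, flux T c (α • edgeMid (T.erase c) + d) • A (edgeMid (T.erase c)) := by
  -- The identity integrates the divergence of `A` times `y ↦ α y + d`, whose own divergence is `2
  -- α`; centroid and midpoint rules are exact. Here midpoint values are expressed by the centroid
  -- value and the opposite vertex.
  have h1 : ∀ c ∈ T, A (edgeMid (T.erase c)) =
      (2⁻¹ : ℝ) • ((3 : ℝ) • A (cen T) - A c) := fun c hc => by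
    rw [edgeMid, affineMap_sum_smul _ _ _ _ (by simp [Finset.card_erase_of_mem hc, h.card_eq]),
      ← Finset.smul_sum, h.map_cen, ← Finset.smul_sum, ← Finset.add_sum_erase T A hc]
    module
  -- Between the midpoint of the opposite edge and the centroid the coordinate of `c` grows from `0`
  -- to `1/3`.
  have h2 : ∀ c ∈ T, (bary T c).linear (α • edgeMid (T.erase c) + d) =
      (bary T c).linear (α • cen T + d) - α / 3 := fun c hc => by
    have h3 := affineMap_add (bary T c) (cen T) (edgeMid (T.erase c) - cen T)
    rw [add_sub_cancel, h.bary_edgeMid_self hc, h.bary_cen hc] at h3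
    have h4 : α • edgeMid (T.erase c) + d =
        α • (edgeMid (T.erase c) - cen T) + (α • cen T + d) := by module
    rw [h4, map_add, map_smul, smul_eq_mul]
    linear_combination α * (- h3)
  have h5 := h.linear_eq A (α • cen T + d)
  have h6 := h.sum_bary_linear (α • cen T + d)
  have h7 := h.map_cen A
  set ℓ : Plane → ℝ := fun c => (bary T c).linear (α • cen T + d) with hℓ
  have h8 : ∀ c ∈ T, flux T c (α • edgeMid (T.erase c) + d) • A (edgeMid (T.erase c)) =
      volume.real (tri T) • (ℓ c • A c - ℓ c • (3 : ℝ) • A (cen T) + α • A (cen T)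
        - α • (3⁻¹ : ℝ) • A c) := fun c hc => by
    rw [flux, h2 c hc, h1 c hc]
    module
  rw [Finset.sum_congr rfl h8, ← Finset.smul_sum, Finset.sum_sub_distrib, Finset.sum_add_distrib,
    Finset.sum_sub_distrib, ← h5, ← Finset.sum_smul, h6, ← Finset.smul_sum, ← Finset.smul_sum, ← h7, Finset.sum_const,
    h.card_eq]
  module

/-- Apart from the edge vector only the orientation of the triangle enters. Hence triangles on
opposite sides of an edge have opposite fluxes. -/
theorem flux_eq (h : IsTriangle {a, b, c}) (x : Plane) :
    flux {a, b, c} c x =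
      -2 * (refArea * SignType.sign (cross (b - a) (c - a)) * cross (b - a) x) := by
  rw [flux, h.volume_mul_bary_linear]

/-- The opposite edge is the zero set of a barycentric coordinate. -/
theorem mem_convexHull_erase (h : IsTriangle K) (hC : C ∈ K) :
    x ∈ convexHull ℝ (K.erase C : Set Plane) ↔ x ∈ tri K ∧ bary K C x = 0 := by
  constructor
  · intro hx
    refine ⟨convexHull_mono (by simp) hx, ?_⟩
    exact h.bary_eq_zero_of_mem_convexHull (by simp) hC (by simp) hx
  · rintro ⟨hx, h0⟩
    have h1 := h.sum_bary_smul x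
    have h2 := h.sum_bary x
    rw [← Finset.add_sum_erase _ _ hC, h0, zero_add] at h2
    rw [← Finset.add_sum_erase _ _ hC, h0, zero_smul, zero_add] at h1
    rw [← h1]
    exact (convex_convexHull ℝ _).sum_mem
      (fun c hc => h.mem_tri.1 hx c (Finset.mem_of_mem_erase hc)) h2
      fun c hc => subset_convexHull ℝ _ hc

/-- An affine function that vanishes at all vertices is zero. -/
theorem exists_bary_ne_zero (h : IsTriangle T) (hK : IsTriangle K) (hC : C ∈ K) :
    ∃ c ∈ T, bary K C c ≠ 0 := by
  by_contra! h0
  have h1 := h.map_eq (bary K C) C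
  rw [Finset.sum_eq_zero fun c hc => by rw [h0 c hc, smul_zero], hK.bary_self hC] at h1
  exact one_ne_zero h1

end IsTriangle

/-- A short segment that is covered by finitely many triangles starts in one of them. -/
theorem exists_forall_add_smul_mem {S : Finset (Finset Plane)} {z d : Plane}
    (h : ∀ᶠ t : ℝ in 𝓝[>] 0, z + t • d ∈ ⋃ T ∈ S, tri T) :
    ∃ T ∈ S, z ∈ tri T ∧ ∃ t : ℝ, 0 < t ∧ z + t • d ∈ tri T := by
  -- Among finitely many triangles one contains points of the segment arbitrarily close to `z`, and
  -- closedness gives `z` itself.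
  obtain ⟨T, hT, hfr⟩ : ∃ T ∈ S, ∃ᶠ t : ℝ in 𝓝[>] 0, z + t • d ∈ tri T := by
    by_contra! h1
    have h2 : ∀ᶠ t : ℝ in 𝓝[>] 0, ∀ T ∈ S, z + t • d ∉ tri T :=
      (Filter.eventually_all_finset S).2 fun T hT => h1 T hT
    obtain ⟨t, ht, ht'⟩ := (h.and h2).exists
    obtain ⟨T, hT, hz⟩ := mem_iUnion₂.1 ht
    exact ht' T hT hz
  refine ⟨T, hT, ?_, ?_⟩
  · have h3 : Filter.Tendsto (fun t : ℝ => z + t • d) (𝓝[>] 0) (𝓝 z) := by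
      have : Filter.Tendsto (fun t : ℝ => z + t • d) (𝓝 0) (𝓝 (z + (0 : ℝ) • d)) :=
        Continuous.tendsto (by fun_prop) 0
      rw [zero_smul, add_zero] at this
      exact this.mono_left nhdsWithin_le_nhds
    exact (IsTriangle.isClosed_tri T).mem_of_frequently_of_tendsto hfr h3
  · obtain ⟨t, ht, ht0⟩ := (hfr.and_eventually self_mem_nhdsWithin).exists
    exact ⟨t, ht0, ht⟩

namespace IsTriangle

variable {a b c d : Plane}

theorem bary_midpoint (h : IsTriangle {a, b, c}) :
    bary {a, b, c} a (midpoint ℝ a b) = 2⁻¹ ∧ bary {a, b, c} b (midpoint ℝ a b) = 2⁻¹ ∧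
      bary {a, b, c} c (midpoint ℝ a b) = 0 := by
  obtain ⟨hab, hac, hbc⟩ := h.ne_of_insert
  rw [AffineMap.map_midpoint, AffineMap.map_midpoint, AffineMap.map_midpoint]
  simp only [midpoint_eq_smul_add, invOf_eq_inv]
  rw [h.bary_self (by simp), h.bary_self (by simp), h.bary_ne (c := a) (by simp) (by simp) hab.symm,
    h.bary_ne (c := b) (by simp) (by simp) hab, h.bary_ne (c := c) (by simp) (by simp) hac,
    h.bary_ne (c := c) (by simp) (by simp) hbc]
  simp

end IsTriangle

/-! ### The elements on either side of an edge -/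

namespace IsMesh

variable {S : Finset (Finset Plane)} {K T T' : Finset Plane} {a b c c' d C : Plane}

/-- Two triangles on the same side of a common edge coincide. -/
theorem eq_of_cross_mul_pos (hS : IsMesh S) (hT : {a, b, c} ∈ S) (hT' : {a, b, c'} ∈ S)
    (h : 0 < cross (b - a) (c - a) * cross (b - a) (c' - a)) : c = c' := by
  have h1 := hS.isTriangle _ hT
  have h1' := hS.isTriangle _ hT'
  obtain ⟨ha, hb, hc⟩ := h1'.bary_midpoint
  set z := midpoint ℝ a b with hz
  -- From the midpoint towards `c` the coordinate of `c'` increases from zero while those of `a` and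
  -- `b` stay near `1/2`. Points of the first triangle thus enter the interior of the second one.
  have hpos : 0 < (bary {a, b, c'} c').linear (c - z) := by
    have h2 := affineMap_add (bary {a, b, c'} c') z (c - z)
    rw [add_sub_cancel, hc, zero_add] at h2
    rw [← h2]
    have h3 := h1'.bary_mul_cross c
    by_contra hle
    have : cross (b - a) (c - a) * cross (b - a) (c' - a) ≤ 0 := by
      rw [← h3]
      have := mul_self_nonneg (cross (b - a) (c' - a))
      nlinarith
    linarith
  have hev : ∀ p, 0 < bary {a, b, c'} p z →
      ∀ᶠ t : ℝ in 𝓝[>] 0, 0 < bary {a, b, c'} p (z + t • (c - z)) := fun p hp => by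
    have h4 : Filter.Tendsto (fun t : ℝ => bary {a, b, c'} p (z + t • (c - z))) (𝓝 0)
        (𝓝 (bary {a, b, c'} p (z + (0 : ℝ) • (c - z)))) :=
      ((IsTriangle.continuous_bary _ p).comp (by fun_prop)).tendsto 0
    rw [zero_smul, add_zero] at h4
    exact (h4.mono_left nhdsWithin_le_nhds).eventually_const_lt hp
  have hlt : ∀ᶠ t : ℝ in 𝓝[>] 0, t ∈ Ioo (0 : ℝ) 1 := Ioo_mem_nhdsGT zero_lt_one
  obtain ⟨t, ⟨hta, htb⟩, ht0, ht1⟩ := (((hev a (by rw [ha]; norm_num)).and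
    (hev b (by rw [hb]; norm_num))).and hlt).exists
  have hin : z + t • (c - z) ∈ interior (tri {a, b, c'}) := by
    refine h1'.mem_interior.2 fun p hp => ?_
    simp only [Finset.mem_insert, Finset.mem_singleton] at hp
    rcases hp with rfl | rfl | rfl
    · exact hta
    · exact htb
    · rw [affineMap_add, hc, map_smul, zero_add]
      exact mul_pos ht0 hpos
  have hin' : z + t • (c - z) ∈ tri {a, b, c} :=
    (convex_convexHull ℝ _).add_smul_sub_mem (IsTriangle.midpoint_mem (by simp) (by simp))
      (IsTriangle.mem_tri_of_mem (by simp)) ⟨ht0.le, ht1.le⟩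
  have he := hS.eq_of_mem_interior hT' hT hin hin'
  obtain ⟨hab, hac, hbc⟩ := h1.ne_of_insert
  have : c ∈ ({a, b, c'} : Finset Plane) := by rw [he]; simp
  simp only [Finset.mem_insert, Finset.mem_singleton] at this
  rcases this with h5 | h5 | h5
  · exact absurd h5.symm hac
  · exact absurd h5.symm hbc
  · exact h5

/-- If points beyond the midpoint of an edge in direction `d` are covered, then there is an
element with this edge on the side of `d`. -/
theorem exists_insert_mem (hS : IsMesh S) {R : Finset (Finset Plane)} (hR : R ⊆ S)
    (hT : {a, b, c} ∈ S)
    (h : ∀ᶠ t : ℝ in 𝓝[>] 0, midpoint ℝ a b + t • d ∈ ⋃ T ∈ R, tri T) :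
    ∃ c', {a, b, c'} ∈ R ∧ 0 ≤ cross (b - a) d * cross (b - a) (c' - a) := by
  obtain ⟨T', hT', hz, t, ht0, ht⟩ := exists_forall_add_smul_mem h
  have h1 := hS.isTriangle _ hT
  obtain ⟨ha, hb, hc⟩ := h1.bary_midpoint
  obtain ⟨hab, hac, hbc⟩ := h1.ne_of_insert
  have hzT := IsTriangle.midpoint_mem (K := {a, b, c}) (a := a) (b := b) (by simp) (by simp)
  -- At the midpoint the coordinates of `a` and `b` are `1/2`, so conformity makes both of them
  -- vertices of every element that contains it.
  have haT := hS.mem_of_bary_ne_zero hT (hR hT') hzT hz (c := a) (by simp) (by rw [ha]; norm_num)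
  have hbT := hS.mem_of_bary_ne_zero hT (hR hT') hzT hz (c := b) (by simp) (by rw [hb]; norm_num)
  obtain ⟨c', hc', -, -, rfl⟩ := (hS.isTriangle _ (hR hT')).exists_third haT hbT hab
  refine ⟨c', hT', ?_⟩
  have h1' := hS.isTriangle _ (hR hT')
  have h2 := h1'.mem_tri.1 ht c' hc'
  rw [affineMap_add, h1'.bary_midpoint.2.2, zero_add, map_smul, smul_eq_mul] at h2
  have h3 := nonneg_of_mul_nonneg_right h2 ht0
  rw [← h1'.bary_linear_mul_cross, mul_assoc]
  exact mul_nonneg h3 (mul_self_nonneg _)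

end IsMesh

namespace IsTriangle

variable {T K e : Finset Plane} {a b c x y C p : Plane}

theorem eventually_mem_of_mem_interior {s : Set Plane} {z : Plane} (hz : z ∈ interior s)
    (d : Plane) : ∀ᶠ t : ℝ in 𝓝[>] 0, z + t • d ∈ s := by
  have h3 : Filter.Tendsto (fun t : ℝ => z + t • d) (𝓝[>] 0) (𝓝 z) := by
    have : Filter.Tendsto (fun t : ℝ => z + t • d) (𝓝 0) (𝓝 (z + (0 : ℝ) • d)) :=
      Continuous.tendsto (by fun_prop) 0
    rw [zero_smul, add_zero] at this
    exact this.mono_left nhdsWithin_le_nhds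
  exact h3.eventually (mem_interior_iff_mem_nhds.1 hz)

theorem eventually_mem_of_mem {s : Set Plane} (hs : Convex ℝ s) {z w : Plane} (hz : z ∈ s)
    (hw : w ∈ s) : ∀ᶠ t : ℝ in 𝓝[>] 0, z + t • (w - z) ∈ s := by
  have hlt : ∀ᶠ t : ℝ in 𝓝[>] 0, t ∈ Ioo (0 : ℝ) 1 := Ioo_mem_nhdsGT zero_lt_one
  filter_upwards [hlt] with t ht
  exact hs.add_smul_sub_mem hz hw ⟨ht.1.le, ht.2.le⟩

/-- A vector along the edge opposite to `C`. -/
theorem eq_smul_of_bary_linear_eq_zero {P Q : Plane} (h : IsTriangle {P, Q, C}) {d : Plane}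
    (hd : (bary {P, Q, C} C).linear d = 0) : d = (bary {P, Q, C} Q).linear d • (Q - P) := by
  obtain ⟨h1, h2, h3⟩ := h.ne_of_insert
  have h4 := h.sum_bary_linear d
  have h5 := h.sum_bary_linear_smul d
  rw [sum_three _ h1 h2 h3, hd] at h4 h5
  conv_lhs => rw [← h5]
  rw [show (bary {P, Q, C} P).linear d = - (bary {P, Q, C} Q).linear d by linarith]
  module

theorem edgeLen_pair (a b : Plane) : edgeLen {a, b} = dist a b := by
  rw [edgeLen]; push_cast; exact Metric.diam_pair

/-- The flux through a part of an edge of `K` is the corresponding part of the flux. -/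
theorem flux_eq_ratio {P Q : Plane} (h : IsTriangle {a, b, c}) (hK : IsTriangle {P, Q, C})
    (ha : bary {P, Q, C} C a = 0) (hb : bary {P, Q, C} C b = 0)
    (hc : 0 < bary {P, Q, C} C c) (x : Plane) :
    flux {a, b, c} c x = edgeLen {a, b} / edgeLen {P, Q} * flux {P, Q, C} C x := by
  obtain ⟨hPQ, hPC, hQC⟩ := hK.ne_of_insert
  obtain ⟨hab, hac, hbc⟩ := h.ne_of_insert
  have hlin : ∀ y z, (bary {P, Q, C} C).linear (y - z) =
      bary {P, Q, C} C y - bary {P, Q, C} C z := fun y z =>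
    (bary {P, Q, C} C).linearMap_vsub y z
  have h1 := hK.eq_smul_of_bary_linear_eq_zero (d := b - a) (by rw [hlin, ha, hb, sub_zero])
  set r := (bary {P, Q, C} Q).linear (b - a) with hr
  have h2 : cross (Q - P) (c - a) = bary {P, Q, C} C c * cross (Q - P) (C - P) := by
    rw [← hK.bary_linear_mul_cross, hlin, ha, sub_zero]
  have hr0 : r ≠ 0 := fun h0 => hab (by rw [h0, zero_smul, sub_eq_zero] at h1; exact h1.symm)
  have h3 : edgeLen {a, b} / edgeLen {P, Q} = |r| := by
    rw [edgeLen_pair, edgeLen_pair, dist_comm, dist_eq_norm, h1, norm_smul, dist_comm P Q,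
      dist_eq_norm, Real.norm_eq_abs, mul_div_assoc, div_self, mul_one]
    exact norm_ne_zero_iff.2 (sub_ne_zero.2 hPQ.symm)
  rw [h.flux_eq, hK.flux_eq, h3, h1, cross_smul_left, cross_smul_left, h2]
  -- The factor `r` of the edge vector meets its own sign from the orientation; their product is
  -- `|r|`, the ratio of the lengths.
  simp only [sign_mul, SignType.coe_mul, sign_pos hc, SignType.coe_one, ← self_mul_sign r]
  ring

end IsTriangle

theorem flux_sub {T : Finset Plane} {c : Plane} (x y : Plane) :
    flux T c (x - y) = -2 * (volume.real (tri T) * (bary T c x - bary T c y)) := by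
  have := (bary T c).linearMap_vsub x y
  simp only [vsub_eq_sub] at this
  rw [flux, this]

theorem flux_add (T : Finset Plane) (c x y : Plane) :
    flux T c (x + y) = flux T c x + flux T c y := by
  simp only [flux, map_add]; ring

theorem flux_smul (T : Finset Plane) (c x : Plane) (t : ℝ) :
    flux T c (t • x) = t * flux T c x := by
  simp only [flux, map_smul, smul_eq_mul]; ring

namespace IsMesh

variable {S : Finset (Finset Plane)} {K T e : Finset Plane} {a b c c' d C : Plane}

theorem subset_tri_of_mem (hK : ⋃ T ∈ S, tri T = tri K) (hT : T ∈ S) : tri T ⊆ tri K :=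
  hK ▸ subset_biUnion_of_mem (u := fun T => tri T) hT

/-- The pairs of an element and an opposite vertex that represent the edge `e`. -/
def _root_.StokesCR.sides (S : Finset (Finset Plane)) (e : Finset Plane) :
    Finset ((_ : Finset Plane) × Plane) :=
  (S.sigma fun T => T).filter fun p => p.1.erase p.2 = e

theorem _root_.StokesCR.mem_sides {p : (_ : Finset Plane) × Plane} :
    p ∈ sides S e ↔ p.1 ∈ S ∧ p.2 ∈ p.1 ∧ p.1.erase p.2 = e := by
  simp [sides, and_assoc]

/-- An element with edge `{a, b}`, written with the end points in this order. -/
theorem eq_insert_of_erase_eq (hc : c ∈ T) (he : T.erase c = {a, b}) :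
    T = {a, b, c} ∧ a ≠ c ∧ b ≠ c := by
  have ha : a ∈ T.erase c := by simp [he]
  have hb : b ∈ T.erase c := by simp [he]
  refine ⟨?_, Finset.ne_of_mem_erase ha, Finset.ne_of_mem_erase hb⟩
  rw [← Finset.insert_erase hc, he]
  ext x; simp; tauto

/-- The fluxes through an edge in the interior of `K` cancel. -/
theorem sum_sides_flux_eq_zero (hS : IsMesh S) (h : IsTriangle K)
    (hK : ⋃ T ∈ S, tri T = tri K) (he : e ∈ edges S)
    (hint : ∀ C ∈ K, ∃ p ∈ e, bary K C p ≠ 0) (x : Plane) :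
    ∑ p ∈ sides S e, flux p.1 p.2 x = 0 := by
  obtain ⟨T, hT, c, hc, rfl⟩ := mem_edges.1 he
  obtain ⟨a, b, hab, hac, hbc, rfl, hce⟩ := (hS.isTriangle T hT).exists_eq hc
  rw [hce] at hint ⊢
  have h1 := hS.isTriangle _ hT
  have hsub := subset_tri_of_mem hK hT
  have haK : a ∈ tri K := hsub (IsTriangle.mem_tri_of_mem (by simp))
  have hbK : b ∈ tri K := hsub (IsTriangle.mem_tri_of_mem (by simp))
  -- For each coordinate of `K` an end point of the edge has a positive value, hence so has the
  -- midpoint.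
  have hz : midpoint ℝ a b ∈ interior (tri K) := by
    refine h.mem_interior.2 fun C hC => ?_
    obtain ⟨p, hp, hp0⟩ := hint C hC
    rw [AffineMap.map_midpoint, midpoint_eq_smul_add, invOf_eq_inv, smul_eq_mul]
    have h2 := h.mem_tri.1 haK C hC
    have h3 := h.mem_tri.1 hbK C hC
    simp only [Finset.mem_insert, Finset.mem_singleton] at hp
    rcases hp with rfl | rfl
    · have := lt_of_le_of_ne h2 hp0.symm; positivity
    · have := lt_of_le_of_ne h3 hp0.symm; positivity
  -- Points just across the edge from `c` are still in `K`, so an element of the mesh lies on that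
  -- side too.
  obtain ⟨c', hT', hside⟩ := hS.exists_insert_mem Subset.rfl hT (d := -(c - a)) (by
    rw [hK]; exact IsTriangle.eventually_mem_of_mem_interior hz _)
  have h1' := hS.isTriangle _ hT'
  obtain ⟨-, hac', hbc'⟩ := h1'.ne_of_insert
  have hneg : cross (b - a) (-(c - a)) = - cross (b - a) (c - a) := by
    rw [← neg_one_smul ℝ, cross_smul_right]; ring
  have h0 := h1.cross_ne_zero
  have h0' := h1'.cross_ne_zero
  have hlt : cross (b - a) (c - a) * cross (b - a) (c' - a) < 0 := by
    rw [hneg] at hside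
    exact lt_of_le_of_ne (by linarith) (mul_ne_zero h0 h0')
  have hcc' : c ≠ c' := by
    rintro rfl
    linarith [mul_self_nonneg (cross (b - a) (c - a))]
  -- There is at most one element on each side, so these two are all.
  have hfib : sides S {a, b} = {⟨{a, b, c}, c⟩, ⟨{a, b, c'}, c'⟩} := by
    ext ⟨T'', c''⟩
    simp only [mem_sides, Finset.mem_insert, Finset.mem_singleton]
    constructor
    · rintro ⟨hT'', hc'', he''⟩
      obtain ⟨rfl, -, -⟩ := eq_insert_of_erase_eq hc'' he''
      have h0'' := (hS.isTriangle _ hT'').cross_ne_zero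
      rcases lt_or_gt_of_ne (mul_ne_zero h0 h0'') with h5 | h5
      · right
        have h6 := hS.eq_of_cross_mul_pos hT' hT'' (by
          have := mul_pos_of_neg_of_neg h5 hlt
          have h7 : 0 < cross (b - a) (c - a) ^ 2 := by positivity
          by_contra hle
          nlinarith)
        rw [h6]
      · left
        have h6 := hS.eq_of_cross_mul_pos hT hT'' h5
        rw [h6]
    · have key : ∀ c, a ≠ c → b ≠ c → ({a, b, c} : Finset Plane).erase c = {a, b} := by
        intro c hac hbc
        ext x; simp only [Finset.mem_erase, Finset.mem_insert, Finset.mem_singleton]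
        constructor
        · tauto
        · rintro (rfl | rfl) <;> tauto
      rintro (h7 | h7) <;> cases h7
      · exact ⟨hT, by simp, key c hac hbc⟩
      · exact ⟨hT', by simp, key c' hac' hbc'⟩
  rw [hfib, Finset.sum_pair (by
    intro h8
    exact hcc' (congrArg (fun p : (_ : Finset Plane) × Plane => p.2) h8)), h1.flux_eq, h1'.flux_eq]
  have hs : (SignType.sign (cross (b - a) (c - a)) : ℝ) +
      SignType.sign (cross (b - a) (c' - a)) = 0 := by
    rcases mul_neg_iff.1 hlt with ⟨h8, h9⟩ | ⟨h8, h9⟩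
    · simp [sign_pos h8, sign_neg h9]
    · simp [sign_pos h9, sign_neg h8]
  linear_combination (-2 * refArea * cross (b - a) x) * hs

/-- The flux through an edge on the boundary of `K`. -/
theorem sum_sides_flux_eq (hS : IsMesh S) (h : IsTriangle K)
    (hK : ⋃ T ∈ S, tri T = tri K) (he : e ∈ edges S) (hC : C ∈ K)
    (hbd : ∀ p ∈ e, bary K C p = 0) (x : Plane) :
    ∑ p ∈ sides S e, flux p.1 p.2 x = edgeLen e / edgeLen (K.erase C) * flux K C x := by
  obtain ⟨T, hT, c, hc, rfl⟩ := mem_edges.1 he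
  obtain ⟨a, b, hab, hac, hbc, rfl, hce⟩ := (hS.isTriangle T hT).exists_eq hc
  rw [hce] at hbd ⊢
  obtain ⟨P, Q, hPQ, hPC, hQC, rfl, hCe⟩ := h.exists_eq hC
  rw [hCe]
  have ha := hbd a (by simp)
  have hb := hbd b (by simp)
  -- Otherwise the coordinate of `C` would vanish at all vertices of the element and hence
  -- everywhere.
  have hpos : ∀ c, {a, b, c} ∈ S → 0 < bary {P, Q, C} C c := by
    intro c hT
    refine lt_of_le_of_ne (h.mem_tri.1 (subset_tri_of_mem hK hT
      (IsTriangle.mem_tri_of_mem (by simp))) C hC) fun h0 => ?_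
    obtain ⟨p, hp, hp0⟩ := (hS.isTriangle _ hT).exists_bary_ne_zero h hC
    simp only [Finset.mem_insert, Finset.mem_singleton] at hp
    rcases hp with rfl | rfl | rfl
    exacts [hp0 ha, hp0 hb, hp0 h0.symm]
  have h1 := hS.isTriangle _ hT
  have hlin : ∀ y z, (bary {P, Q, C} C).linear (y - z) =
      bary {P, Q, C} C y - bary {P, Q, C} C z := fun y z =>
    (bary {P, Q, C} C).linearMap_vsub y z
  have h2 := h.eq_smul_of_bary_linear_eq_zero (d := b - a) (by rw [hlin, ha, hb, sub_zero])
  have hcross : ∀ c, {a, b, c} ∈ S → cross (b - a) (c - a) = bary {P, Q, C} C c *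
      ((bary {P, Q, C} Q).linear (b - a) * cross (Q - P) (C - P)) := by
    intro c hT
    conv_lhs => rw [h2]
    rw [cross_smul_left, ← h.bary_linear_mul_cross, hlin, ha, sub_zero]
    ring
  -- All elements at this edge lie on the inner side of the boundary of `K`, so there is just one.
  have hfib : sides S {a, b} = {⟨{a, b, c}, c⟩} := by
    ext ⟨T'', c''⟩
    simp only [mem_sides, Finset.mem_singleton]
    constructor
    · rintro ⟨hT'', hc'', he''⟩
      obtain ⟨rfl, -, -⟩ := eq_insert_of_erase_eq hc'' he''
      have h6 := hS.eq_of_cross_mul_pos hT hT'' (by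
        have h3 := h1.cross_ne_zero
        rw [hcross c hT] at h3 ⊢
        rw [hcross c'' hT'']
        have h4 := right_ne_zero_of_mul h3
        have h5 := hpos c hT
        have h7 := hpos c'' hT''
        have h8 := mul_self_pos.2 h4
        have := mul_pos (mul_pos h5 h7) h8
        linarith)
      rw [h6]
    · intro h7
      cases h7
      exact ⟨hT, hc, hce⟩
  rw [hfib, Finset.sum_singleton]
  exact h1.flux_eq_ratio h ha hb (hpos c hT) x

/-- **Discrete divergence theorem** on a triangulated triangle. -/
theorem sum_green (hS : IsMesh S) (h : IsTriangle K) (hK : ⋃ T ∈ S, tri T = tri K)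
    {A : Finset Plane → Plane →ᵃ[ℝ] Plane} {m : Finset Plane → Plane}
    (hm : ∀ T ∈ S, ∀ c ∈ T, A T (edgeMid (T.erase c)) = m (T.erase c)) (α : ℝ) (d : Plane) :
    ∑ T ∈ S, volume.real (tri T) • ((2 * α) • A T (cen T) + (A T).linear (α • cen T + d)) =
      ∑ C ∈ K, flux K C (α • edgeMid (K.erase C) + d) •
        ∑ e ∈ edges S with (∀ p ∈ e, bary K C p = 0),
          (edgeLen e / edgeLen (K.erase C)) • m e := by
  have hcard : ∀ e ∈ edges S, e.card = 2 := fun e he => by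
    obtain ⟨T, hT, c, hc, rfl⟩ := mem_edges.1 he
    rw [Finset.card_erase_of_mem hc, (hS.isTriangle T hT).card_eq]
  have h1 : ∑ T ∈ S, volume.real (tri T) •
        ((2 * α) • A T (cen T) + (A T).linear (α • cen T + d)) =
      ∑ e ∈ edges S, (∑ p ∈ sides S e, flux p.1 p.2 (α • edgeMid e + d)) • m e := by
    have h2 : ∀ T ∈ S, volume.real (tri T) •
        ((2 * α) • A T (cen T) + (A T).linear (α • cen T + d)) =
        ∑ c ∈ T, flux T c (α • edgeMid (T.erase c) + d) • m (T.erase c) := fun T hT => by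
      rw [(hS.isTriangle T hT).green]
      exact Finset.sum_congr rfl fun c hc => by rw [hm T hT c hc]
    rw [Finset.sum_congr rfl h2, Finset.sum_sigma', ← Finset.sum_fiberwise_of_maps_to
      (g := fun p : (_ : Finset Plane) × Plane => p.1.erase p.2) (t := edges S)]
    · refine Finset.sum_congr rfl fun e he => ?_
      rw [Finset.sum_smul]
      refine Finset.sum_congr rfl fun p hp => ?_
      obtain ⟨-, -, h3⟩ := mem_sides.1 hp
      rw [h3]
    · rintro p hp
      rw [Finset.mem_sigma] at hp
      exact mem_edges.2 ⟨p.1, hp.1, p.2, hp.2, rfl⟩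
  have h2 : ∀ e ∈ edges S, (∑ p ∈ sides S e, flux p.1 p.2 (α • edgeMid e + d)) • m e =
      ∑ C ∈ K, if (∀ p ∈ e, bary K C p = 0) then
        flux K C (α • edgeMid (K.erase C) + d) • (edgeLen e / edgeLen (K.erase C)) • m e
        else 0 := by
    intro e he
    by_cases hbd : ∃ C ∈ K, ∀ p ∈ e, bary K C p = 0
    · obtain ⟨C, hC, hC0⟩ := hbd
      rw [Finset.sum_eq_single_of_mem C hC, if_pos hC0, hS.sum_sides_flux_eq h hK he hC hC0,
        smul_smul, mul_comm]
      · congr 2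
        -- Fine and coarse midpoint lie on the same side of `K`, and the flux sees only the
        -- coordinate of `C`, so either may serve as evaluation point.
        have h4 : bary K C (edgeMid e) = 0 := by
          rw [edgeMid, affineMap_sum_smul _ _ _ _ (by simp [hcard e he])]
          exact Finset.sum_eq_zero fun p hp => by rw [hC0 p hp, smul_zero]
        have h5 := h.bary_edgeMid_self hC
        have h6 := flux_sub (T := K) (c := C) (edgeMid e) (edgeMid (K.erase C))
        rw [h4, h5, sub_self, mul_zero, mul_zero, sub_eq_add_neg, flux_add, ← neg_one_smul ℝ,
          flux_smul] at h6
        rw [flux_add, flux_add, flux_smul, flux_smul]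
        linear_combination α * h6
      · intro C' hC' hne
        rw [if_neg]
        intro h0
        obtain ⟨k, hk, hik, hjk, hKe⟩ := h.exists_third hC hC' hne.symm
        -- Two sides of `K` meet in a single vertex and contain no common edge.
        have h4 : ∀ p ∈ e, p = k := fun p hp => by
          have h5 := h.sum_bary p
          have h6 := h.sum_bary_smul p
          rw [hKe, IsTriangle.sum_three _ hne.symm hik hjk, ← hKe, hC0 p hp, h0 p hp] at h5 h6
          rw [show bary K k p = 1 by linarith] at h6
          simpa using h6.symm
        have h5 : e ⊆ {k} := fun p hp => by simp [h4 p hp]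
        have := Finset.card_le_card h5
        rw [hcard e he] at this
        simp at this
    · push Not at hbd
      rw [hS.sum_sides_flux_eq_zero h hK he hbd, zero_smul]
      refine (Finset.sum_eq_zero fun C hC => if_neg ?_).symm
      intro h0
      obtain ⟨p, hp, hp0⟩ := hbd C hC
      exact hp0 (h0 p hp)
  rw [h1, Finset.sum_congr rfl h2, Finset.sum_comm]
  refine Finset.sum_congr rfl fun C hC => ?_
  rw [← Finset.sum_filter, Finset.smul_sum]

end IsMesh

/-! ### The nonconforming interpolation onto the coarse mesh -/

/-- The mean over the edge `E` of a field with mean `m e` over the fine edges `e`. -/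
def edgeMean (F : Finset (Finset Plane)) (m : Finset Plane → Plane) (E : Finset Plane) : Plane :=
  ∑ e ∈ (edges F).filter fun e : Finset Plane => (e : Set Plane) ⊆ convexHull ℝ (E : Set Plane),
    (edgeLen e / edgeLen E) • m e

/-- The affine field with the value `M E` at the midpoint of each edge `E` of `K`. -/
def crInterp (M : Finset Plane → Plane) (K : Finset Plane) : Plane →ᵃ[ℝ] Plane :=
  ∑ C ∈ K, (LinearMap.toSpanSingleton ℝ Plane (M (K.erase C))).toAffineMap.comp
    (AffineMap.const ℝ Plane 1 - (2 : ℝ) • bary K C)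

theorem affineMap_sum_apply {ι : Type*} (s : Finset ι) (f : ι → Plane →ᵃ[ℝ] Plane) (x : Plane) :
    (∑ i ∈ s, f i) x = ∑ i ∈ s, f i x := by
  induction s using Finset.induction_on with
  | empty => simp
  | insert a s ha ih => rw [Finset.sum_insert ha, Finset.sum_insert ha, AffineMap.coe_add, Pi.add_apply, ih]

theorem crInterp_apply (M : Finset Plane → Plane) (K : Finset Plane) (x : Plane) :
    crInterp M K x = ∑ C ∈ K, (1 - 2 * bary K C x) • M (K.erase C) := by
  rw [crInterp, affineMap_sum_apply]
  refine Finset.sum_congr rfl fun C _ => ?_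
  simp

namespace IsTriangle

variable {K : Finset Plane} {C c : Plane}

theorem bary_edgeMid_ne (h : IsTriangle K) (hC : C ∈ K) (hc : c ∈ K) (hne : c ≠ C) :
    bary K c (edgeMid (K.erase C)) = 2⁻¹ := by
  rw [edgeMid, affineMap_sum_smul _ _ _ _ (by simp [Finset.card_erase_of_mem hC, h.card_eq]),
    Finset.sum_eq_single_of_mem c (Finset.mem_erase.2 ⟨hne, hc⟩)]
  · rw [h.bary_self hc]; simp
  · intro p hp hpc
    rw [h.bary_ne hc (Finset.mem_of_mem_erase hp) hpc, smul_zero]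

/-- The functions `1 - 2 λ_C` are the nodal basis: one at the midpoint opposite to `C`, zero at the
other two. -/
theorem crInterp_edgeMid (h : IsTriangle K) (M : Finset Plane → Plane) (hC : C ∈ K) :
    crInterp M K (edgeMid (K.erase C)) = M (K.erase C) := by
  rw [crInterp_apply, Finset.sum_eq_single_of_mem C hC, h.bary_edgeMid_self hC]
  · simp
  · intro c hc hne
    rw [h.bary_edgeMid_ne hC hc hne]; simp

end IsTriangle

namespace IsMesh

variable {F S : Finset (Finset Plane)} {K T e : Finset Plane} {C : Plane}

theorem edges_mono {S F : Finset (Finset Plane)} (h : S ⊆ F) : edges S ⊆ edges F :=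
  Finset.biUnion_subset_biUnion_of_subset_left _ h

/-- The fine edges in an edge of `K` are edges of triangles in `K`. -/
theorem filter_edges_eq (hF : IsMesh F) (hSF : S ⊆ F) (h : IsTriangle K)
    (hK : ⋃ T ∈ S, tri T = tri K) (hC : C ∈ K) :
    ((edges F).filter fun e : Finset Plane =>
        (e : Set Plane) ⊆ convexHull ℝ ((K.erase C : Finset Plane) : Set Plane)) =
      {e ∈ edges S | ∀ p ∈ e, bary K C p = 0} := by
  ext e
  simp only [Finset.mem_filter]
  constructor
  · rintro ⟨he, hsub⟩
    have hmem : ∀ p ∈ e, p ∈ tri K ∧ bary K C p = 0 := fun p hp =>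
      (h.mem_convexHull_erase hC).1 (hsub hp)
    refine ⟨?_, fun p hp => (hmem p hp).2⟩
    obtain ⟨T, hT, c, hc, rfl⟩ := mem_edges.1 he
    obtain ⟨a, b, hab, hac, hbc, rfl, hce⟩ := (hF.isTriangle T hT).exists_eq hc
    rw [hce] at hmem ⊢
    have hz : midpoint ℝ a b ∈ tri K :=
      (convex_convexHull ℝ (K : Set Plane)).segment_subset (hmem a (by simp)).1
        (hmem b (by simp)).1 (midpoint_mem_segment a b)
    -- The fine edge may stem from an element outside `K`, because `edgeMean` uses all fine edges in
    -- order to agree for both coarse neighbours. A step from its midpoint towards `C` finds an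
    -- element inside `K` with the same edge.
    obtain ⟨c', hc', -⟩ := hF.exists_insert_mem hSF hT (d := C - midpoint ℝ a b) (by
      rw [hK]
      exact IsTriangle.eventually_mem_of_mem (convex_convexHull ℝ _) hz
        (IsTriangle.mem_tri_of_mem hC))
    obtain ⟨-, hac', hbc'⟩ := (hF.isTriangle _ (hSF hc')).ne_of_insert
    refine mem_edges.2 ⟨_, hc', c', by simp, ?_⟩
    ext x; simp only [Finset.mem_erase, Finset.mem_insert, Finset.mem_singleton]
    constructor
    · tauto
    · rintro (rfl | rfl) <;> tauto
  · rintro ⟨he, h0⟩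
    refine ⟨edges_mono hSF he, fun p hp => (h.mem_convexHull_erase hC).2 ⟨?_, h0 p hp⟩⟩
    obtain ⟨T, hT, c, hc, rfl⟩ := mem_edges.1 he
    exact subset_tri_of_mem hK hT (IsTriangle.mem_tri_of_mem (Finset.mem_of_mem_erase hp))

/-- The interpolation preserves the integrals in the divergence theorem. -/
theorem sum_green_interp (hF : IsMesh F) (hSF : S ⊆ F) (h : IsTriangle K)
    (hK : ⋃ T ∈ S, tri T = tri K) {A : Finset Plane → Plane →ᵃ[ℝ] Plane} {m : Finset Plane → Plane}
    (hm : ∀ T ∈ F, ∀ c ∈ T, A T (edgeMid (T.erase c)) = m (T.erase c)) (α : ℝ) (d : Plane) :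
    ∑ T ∈ S, volume.real (tri T) • ((2 * α) • A T (cen T) + (A T).linear (α • cen T + d)) =
      volume.real (tri K) • ((2 * α) • crInterp (edgeMean F m) K (cen K) +
        (crInterp (edgeMean F m) K).linear (α • cen K + d)) := by
  rw [(hF.mono hSF).sum_green h hK (fun T hT => hm T (hSF hT)) α d, h.green]
  refine Finset.sum_congr rfl fun C hC => ?_
  rw [h.crInterp_edgeMid _ hC, edgeMean, hF.filter_edges_eq hSF h hK hC]

end IsMesh

/-- The shape regularity of a single triangle. -/
def IsShapeRegular (κ : ℝ) (K : Finset Plane) : Prop :=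
  ∃ (x : Plane) (r : ℝ), 0 < r ∧ Metric.closedBall x r ⊆ tri K ∧
    Metric.diam (tri K) ≤ κ * (2 * r)

/-! ### Metric consequences of shape regularity -/

namespace IsShapeRegular

variable {κ : ℝ} {K : Finset Plane}

theorem volume_closedBall (x : Plane) {r : ℝ} (hr : 0 ≤ r) :
    volume.real (Metric.closedBall x r) = Real.pi * r ^ 2 := by
  rw [Measure.real, EuclideanSpace.volume_closedBall_fin_two]
  rw [ENNReal.toReal_mul, ENNReal.toReal_pow, ENNReal.toReal_ofReal hr, mul_comm,
    ENNReal.toReal_ofReal Real.pi_pos.le]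

theorem volume_le_diam_sq (K : Finset Plane) : volume.real (tri K) ≤ 4 * Metric.diam (tri K) ^ 2 := by
  rcases (tri K).eq_empty_or_nonempty with h | ⟨x, hx⟩
  · simp [h]
  · have h1 : tri K ⊆ Metric.closedBall x (Metric.diam (tri K)) := fun y hy =>
      Metric.dist_le_diam_of_mem (IsTriangle.isCompact_tri K).isBounded hy hx
    have h2 := measureReal_mono h1 (μ := volume) measure_closedBall_lt_top.ne
    rw [volume_closedBall x Metric.diam_nonneg] at h2
    nlinarith [Real.pi_lt_four, sq_nonneg (Metric.diam (tri K))]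

theorem diam_sq_le (h : IsShapeRegular κ K) :
    Metric.diam (tri K) ^ 2 ≤ 4 * κ ^ 2 * volume.real (tri K) := by
  obtain ⟨x, r, hr, hsub, hd⟩ := h
  have h1 := measureReal_mono hsub (μ := volume) (IsTriangle.volume_tri_lt_top K).ne
  rw [volume_closedBall x hr.le] at h1
  have h2 : r ^ 2 ≤ volume.real (tri K) := by
    nlinarith [Real.pi_gt_three, sq_nonneg r]
  calc Metric.diam (tri K) ^ 2 ≤ (κ * (2 * r)) ^ 2 := by
        have := Metric.diam_nonneg (s := tri K); gcongr
    _ = 4 * κ ^ 2 * r ^ 2 := by ring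
    _ ≤ _ := by gcongr

/-- The gradients of the barycentric coordinates are bounded. -/
theorem exists_lipschitz (h : IsShapeRegular κ K) (hK : IsTriangle K) :
    ∃ Λ : ℝ, 0 ≤ Λ ∧ (∀ i ∈ K, ∀ x y, |bary K i x - bary K i y| ≤ Λ * ‖x - y‖) ∧
      Λ ^ 2 * volume.real (tri K) ≤ 4 * κ ^ 2 := by
  obtain ⟨z, r, hr, hsub, hd⟩ := h
  refine ⟨(2 * r)⁻¹, by positivity, fun i hi x y => ?_, ?_⟩
  · have hsubl : ∀ x y, bary K i x - bary K i y = (bary K i).linear (x - y) := fun x y =>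
      ((bary K i).linearMap_vsub x y).symm
    rw [hsubl]
    -- Along a diameter of the inscribed disc the coordinate stays in `[0, 1]`, so its slope is at
    -- most `1 / (2 r)`.
    have key : ∀ d : Plane, ‖d‖ ≤ 1 → (bary K i).linear d ≤ (2 * r)⁻¹ := by
      intro d hd1
      have hm : ∀ s : ℝ, |s| ≤ r → z + s • d ∈ tri K := fun s hs => hsub (by
        rw [Metric.mem_closedBall, dist_eq_norm, add_sub_cancel_left, norm_smul, Real.norm_eq_abs]
        nlinarith [norm_nonneg d, abs_nonneg s])
      have h1 := hK.bary_le_one hi (hm r (abs_of_pos hr).le)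
      have h2 := hK.mem_tri.1 (hm (-r) (by rw [abs_neg, abs_of_pos hr])) i hi
      rw [affineMap_add, map_smul, smul_eq_mul] at h1 h2
      rw [inv_eq_one_div, le_div_iff₀ (by positivity)]
      linarith
    have key2 : ∀ d : Plane, (bary K i).linear d ≤ (2 * r)⁻¹ * ‖d‖ := by
      intro d
      rcases eq_or_ne d 0 with rfl | hd0
      · simp
      · have hn : 0 < ‖d‖ := norm_pos_iff.2 hd0
        have h1 := key (‖d‖⁻¹ • d) (by rw [norm_smul, norm_inv, norm_norm, inv_mul_cancel₀ hn.ne'])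
        rw [map_smul, smul_eq_mul, inv_mul_le_iff₀ hn] at h1
        linarith
    rw [abs_le]
    refine ⟨?_, key2 _⟩
    have := key2 (-(x - y))
    rw [map_neg, norm_neg] at this
    linarith
  · have h1 := volume_le_diam_sq K
    have h2 : Metric.diam (tri K) ^ 2 ≤ (κ * (2 * r)) ^ 2 := by
      have := Metric.diam_nonneg (s := tri K); gcongr
    rw [inv_pow, inv_mul_le_iff₀ (by positivity)]
    nlinarith

end IsShapeRegular

theorem sq_sum_mul_le {ι : Type*} (s : Finset ι) {w x : ι → ℝ} (hw : ∀ i ∈ s, 0 ≤ w i) :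
    (∑ i ∈ s, w i * x i) ^ 2 ≤ (∑ i ∈ s, w i) * ∑ i ∈ s, w i * x i ^ 2 :=
  Finset.sum_sq_le_sum_mul_sum_of_sq_le_mul s hw
    (fun i hi => mul_nonneg (hw i hi) (sq_nonneg _)) fun i _ => le_of_eq (by ring)

/-! ### Stability and error of the interpolation on a coarse element -/

namespace IsMesh

variable {F S : Finset (Finset Plane)} {K T : Finset Plane}
  {A : Finset Plane → Plane →ᵃ[ℝ] Plane} {m : Finset Plane → Plane}

theorem isCR_of_edgeMid (hS : IsMesh S)
    (hm : ∀ T ∈ S, ∀ c ∈ T, A T (edgeMid (T.erase c)) = m (T.erase c)) : IsCR S A := by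
  have key : ∀ T ∈ S, ∀ a b : Plane, a ≠ b → a ∈ T → b ∈ T →
      A T (midpoint ℝ a b) = m {a, b} := by
    intro T hT a b hab ha hb
    obtain ⟨c, hc, hac, hbc, hTe⟩ := (hS.isTriangle T hT).exists_third ha hb hab
    have he : T.erase c = {a, b} := by
      rw [hTe]
      ext x; simp only [Finset.mem_erase, Finset.mem_insert, Finset.mem_singleton]
      constructor
      · tauto
      · rintro (rfl | rfl) <;> tauto
    rw [← edgeMid_pair hab, ← he, hm T hT c hc]
  intro T hT T' hT' a b hab ha hb ha' hb'
  rw [key T hT a b hab ha hb, key T' hT' a b hab ha' hb']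

/-- The gradient of the interpolation is the mean of the elementwise gradient. -/
theorem linear_crInterp (hF : IsMesh F) (hSF : S ⊆ F) (h : IsTriangle K)
    (hK : ⋃ T ∈ S, tri T = tri K)
    (hm : ∀ T ∈ F, ∀ c ∈ T, A T (edgeMid (T.erase c)) = m (T.erase c)) (d : Plane) :
    volume.real (tri K) • (crInterp (edgeMean F m) K).linear d =
      ∑ T ∈ S, volume.real (tri T) • (A T).linear d := by
  have h1 := hF.sum_green_interp hSF h hK hm 0 d
  simp only [mul_zero, zero_smul, zero_add] at h1
  exact h1.symm

/-- The gradient of the interpolation is a weighted mean of the fine gradients, so Jensen's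
inequality applies to each entry. -/
theorem volume_mul_frob_sq_le (hF : IsMesh F) (hSF : S ⊆ F) (h : IsTriangle K)
    (hK : ⋃ T ∈ S, tri T = tri K)
    (hm : ∀ T ∈ F, ∀ c ∈ T, A T (edgeMid (T.erase c)) = m (T.erase c)) :
    volume.real (tri K) * frob (crInterp (edgeMean F m) K).linear ^ 2 ≤
      ∑ T ∈ S, volume.real (tri T) * frob (A T).linear ^ 2 := by
  have hpos := h.volume_tri_pos
  have hvol : ∑ T ∈ S, volume.real (tri T) = volume.real (tri K) := by
    rw [← (hF.mono hSF).volume_biUnion, hK]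
  simp only [frob_sq, Finset.mul_sum]
  rw [Finset.sum_comm (s := S)]
  refine Finset.sum_le_sum fun i _ => ?_
  rw [Finset.sum_comm (s := S)]
  refine Finset.sum_le_sum fun j _ => ?_
  have h1 := congrArg (fun v : Plane => v i) (hF.linear_crInterp hSF h hK hm (unitVec j))
  simp only [PiLp.smul_apply, smul_eq_mul, WithLp.ofLp_sum, Finset.sum_apply] at h1
  have h2 := sq_sum_mul_le S (w := fun T => volume.real (tri T))
    (x := fun T => (A T).linear (unitVec j) i) fun T _ => measureReal_nonneg
  rw [hvol, ← h1, mul_pow, sq (volume.real (tri K)), mul_assoc] at h2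
  exact le_of_mul_le_mul_left h2 hpos

/-- The interpolation is exact on an element that is not refined. -/
theorem crInterp_eq_of_mem (hF : IsMesh F) (hKF : K ∈ F)
    (hm : ∀ T ∈ F, ∀ c ∈ T, A T (edgeMid (T.erase c)) = m (T.erase c)) :
    crInterp (edgeMean F m) K = A K := by
  have h := hF.isTriangle K hKF
  have hK : ⋃ T ∈ ({K} : Finset (Finset Plane)), tri T = tri K := by simp
  have hpos := h.volume_tri_pos
  have hlin : ∀ d, (crInterp (edgeMean F m) K).linear d = (A K).linear d := fun d => by
    have h1 := hF.linear_crInterp (Finset.singleton_subset_iff.2 hKF) h hK hm d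
    rw [Finset.sum_singleton] at h1
    exact smul_right_injective Plane hpos.ne' h1
  -- With `α = 1` and `d = -cen K` the gradient terms vanish for the single element, and the
  -- centroid values remain.
  have h2 := hF.sum_green_interp (Finset.singleton_subset_iff.2 hKF) h hK hm 1 (-cen K)
  simp only [Finset.sum_singleton, one_smul, add_neg_cancel, map_zero, add_zero, mul_one] at h2
  have h3 := smul_right_injective Plane two_ne_zero (smul_right_injective Plane hpos.ne' h2)
  ext1 x
  have h4 := affineMap_add (A K) (cen K) (x - cen K)
  have h5 := affineMap_add (crInterp (edgeMean F m) K) (cen K) (x - cen K)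
  rw [add_sub_cancel] at h4 h5
  rw [h4, h5, hlin, h3]

/-- The divergence theorem with `α = 1` and `d = -cen K` makes the centroid value of the
interpolation a weighted mean of the fine centroid values plus gradient terms of size `diam K`. The
rest is Cauchy–Schwarz. -/
theorem linear_interp_error_le (hF : IsMesh F) (hSF : S ⊆ F) (h : IsTriangle K)
    (hK : ⋃ T ∈ S, tri T = tri K)
    (hm : ∀ T ∈ F, ∀ c ∈ T, A T (edgeMid (T.erase c)) = m (T.erase c)) (c₀ : Plane) :
    volume.real (tri K) * ‖crInterp (edgeMean F m) K (cen K) - c₀‖ ^ 2 ≤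
      2 * ∑ T ∈ S, volume.real (tri T) * ‖A T (cen T) - c₀‖ ^ 2 +
      Metric.diam (tri K) ^ 2 * ∑ T ∈ S, volume.real (tri T) * frob (A T).linear ^ 2 := by
  have hpos := h.volume_tri_pos
  have hvol : ∑ T ∈ S, volume.real (tri T) = volume.real (tri K) := by
    rw [← (hF.mono hSF).volume_biUnion, hK]
  set B := crInterp (edgeMean F m) K with hB
  set H := Metric.diam (tri K) with hH
  have h2 := hF.sum_green_interp hSF h hK hm 1 (-cen K)
  simp only [one_smul, add_neg_cancel, map_zero, add_zero, mul_one] at h2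
  have h3 : volume.real (tri K) • (B (cen K) - c₀) = ∑ T ∈ S, volume.real (tri T) •
      ((A T (cen T) - c₀) + (2⁻¹ : ℝ) • (A T).linear (cen T + -cen K)) := by
    have h4 : ∑ T ∈ S, volume.real (tri T) •
        ((A T (cen T) - c₀) + (2⁻¹ : ℝ) • (A T).linear (cen T + -cen K)) =
        (2⁻¹ : ℝ) • ∑ T ∈ S, volume.real (tri T) •
          ((2 : ℝ) • A T (cen T) + (A T).linear (cen T + -cen K)) -
          (∑ T ∈ S, volume.real (tri T)) • c₀ := by
      rw [Finset.sum_smul, Finset.smul_sum, ← Finset.sum_sub_distrib]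
      exact Finset.sum_congr rfl fun T _ => by module
    rw [h4, h2, hvol]
    module
  have h5 : volume.real (tri K) * ‖B (cen K) - c₀‖ ≤ ∑ T ∈ S, volume.real (tri T) *
      (‖A T (cen T) - c₀‖ + 2⁻¹ * (frob (A T).linear * H)) := by
    calc volume.real (tri K) * ‖B (cen K) - c₀‖ = ‖volume.real (tri K) • (B (cen K) - c₀)‖ := by
          rw [norm_smul, Real.norm_of_nonneg hpos.le]
      _ ≤ _ := by
          rw [h3]
          refine (norm_sum_le _ _).trans (Finset.sum_le_sum fun T hT => ?_)
          rw [norm_smul, Real.norm_of_nonneg measureReal_nonneg]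
          gcongr
          refine (norm_add_le _ _).trans ?_
          gcongr
          rw [norm_smul, Real.norm_of_nonneg (by norm_num)]
          gcongr
          refine (norm_apply_le_frob _ _).trans ?_
          gcongr
          · exact frob_nonneg _
          · rw [← sub_eq_add_neg, ← dist_eq_norm]
            exact Metric.dist_le_diam_of_mem (IsTriangle.isCompact_tri K).isBounded
              (subset_tri_of_mem hK hT ((hF.isTriangle T (hSF hT)).cen_mem)) h.cen_mem
  have h6 : (volume.real (tri K) * ‖B (cen K) - c₀‖) ^ 2 ≤ volume.real (tri K) *
      ∑ T ∈ S, volume.real (tri T) * (‖A T (cen T) - c₀‖ + 2⁻¹ * (frob (A T).linear * H)) ^ 2 := by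
    rw [← hvol]
    refine le_trans ?_ (sq_sum_mul_le S fun T _ => measureReal_nonneg)
    rw [hvol]
    gcongr
  rw [mul_pow, sq (volume.real (tri K)), mul_assoc] at h6
  refine (le_of_mul_le_mul_left h6 hpos).trans ?_
  rw [Finset.mul_sum, Finset.mul_sum, ← Finset.sum_add_distrib]
  refine Finset.sum_le_sum fun T _ => ?_
  have h7 : (‖A T (cen T) - c₀‖ + 2⁻¹ * (frob (A T).linear * H)) ^ 2 ≤
      2 * ‖A T (cen T) - c₀‖ ^ 2 + H ^ 2 * frob (A T).linear ^ 2 := by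
    nlinarith [sq_nonneg (‖A T (cen T) - c₀‖ - 2⁻¹ * (frob (A T).linear * H)),
      sq_nonneg (frob (A T).linear * H)]
  have := mul_le_mul_of_nonneg_left h7 (measureReal_nonneg (μ := volume) (s := tri T))
  linarith

/-- Here `W` stands for the `L¹` norm of the gradient and `N` for its squared `L²` norm. The scaling
bound on `Λ² V` leaves one factor `V`, that is `h_K²`; the constant is `256 = 4 * 16 * 4`. -/
theorem sq_le_of_le_of_sq_le {V Λ κ s W N : ℝ} (hV : 0 ≤ V) (hs : 0 ≤ s)
    (h1 : s ≤ Λ * (4 * κ ^ 2) * W) (h2 : W ^ 2 ≤ V * N) (h3 : Λ ^ 2 * V ≤ 4 * κ ^ 2) :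
    24 * 193 ^ 2 * V * (2 * s) ^ 2 ≤ 24 * 193 ^ 2 * 256 * κ ^ 6 * (V * N) := by
  have h4 : V * s ^ 2 ≤ V * (Λ * (4 * κ ^ 2) * W) ^ 2 :=
    mul_le_mul_of_nonneg_left (pow_le_pow_left₀ hs h1 2) hV
  have h5 : Λ ^ 2 * V * W ^ 2 ≤ 4 * κ ^ 2 * (V * N) :=
    mul_le_mul h3 h2 (sq_nonneg W) (by positivity)
  have h6 : κ ^ 4 * (Λ ^ 2 * V * W ^ 2) ≤ κ ^ 4 * (4 * κ ^ 2 * (V * N)) :=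
    mul_le_mul_of_nonneg_left h5 (by positivity)
  have h7 : V * (Λ * (4 * κ ^ 2) * W) ^ 2 = 16 * (κ ^ 4 * (Λ ^ 2 * V * W ^ 2)) := by ring
  have h8 : κ ^ 4 * (4 * κ ^ 2 * (V * N)) = 4 * (κ ^ 6 * (V * N)) := by ring
  rw [h7] at h4
  rw [h8] at h6
  linarith

/-- The constant of the local interpolation estimate. -/
def _root_.StokesCR.interpConst (κ : ℝ) : ℝ := 12 * (24 * 193 ^ 2 * 256 * κ ^ 6) + 48 * κ ^ 2

/-- **Interpolation error estimate** on an element of the coarse mesh. -/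
theorem exists_interp_error_le (hF : IsMesh F) (hSF : S ⊆ F) (h : IsTriangle K)
    (hK : ⋃ T ∈ S, tri T = tri K)
    (hm : ∀ T ∈ F, ∀ c ∈ T, A T (edgeMid (T.erase c)) = m (T.erase c)) {κ : ℝ}
    (hκK : IsShapeRegular κ K) (hκ : ∀ T ∈ S, IsShapeRegular κ T) :
    ∃ D : Finset Plane → ℝ,
      (∀ T ∈ S, ∀ x ∈ tri T, ‖A T x - crInterp (edgeMean F m) K x‖ ^ 2 ≤ D T) ∧
      ∑ T ∈ S, volume.real (tri T) * D T ≤ interpConst κ * volume.real (tri K) *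
        ∑ T ∈ S, volume.real (tri T) * frob (A T).linear ^ 2 := by
  have hS := hF.mono hSF
  have hpos := h.volume_tri_pos
  have hvol : ∑ T ∈ S, volume.real (tri T) = volume.real (tri K) := by
    rw [← (hF.mono hSF).volume_biUnion, hK]
  obtain ⟨Λ, hΛ0, hΛ, hΛκ⟩ := hκK.exists_lipschitz h
  obtain ⟨c₀, hc₀⟩ := hS.exists_sum_norm_cen_sub_sq_le
    (hS.isCR_of_edgeMid fun T hT => hm T (hSF hT)) h hK hΛ0 hΛ
  set N := ∑ T ∈ S, volume.real (tri T) * frob (A T).linear ^ 2 with hN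
  set P := ∑ T ∈ S, volume.real (tri T) * ‖A T (cen T) - c₀‖ ^ 2 with hP
  set B := crInterp (edgeMean F m) K with hB
  set H := Metric.diam (tri K) with hH
  set V := volume.real (tri K) with hV
  have hN0 : 0 ≤ N := Finset.sum_nonneg fun T _ => by positivity
  have hPN : P ≤ 24 * 193 ^ 2 * 256 * κ ^ 6 * (V * N) := by
    -- Since `osc` contains one more diameter, shape regularity of the fine elements turns `diam²`
    -- into area. The sum becomes an `L¹` norm, whatever the number of fine elements.
    have h1 : ∑ T ∈ S, Λ * Metric.diam (tri T) * osc A T ≤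
        Λ * (4 * κ ^ 2) * ∑ T ∈ S, volume.real (tri T) * frob (A T).linear := by
      rw [Finset.mul_sum]
      refine Finset.sum_le_sum fun T hT => ?_
      have h2 := mul_le_mul_of_nonneg_right (hκ T hT).diam_sq_le
        (mul_nonneg hΛ0 (frob_nonneg (A T).linear))
      rw [osc]
      linarith
    have h2 := sq_sum_mul_le S (w := fun T => volume.real (tri T))
      (x := fun T => frob (A T).linear) fun T _ => measureReal_nonneg
    rw [hvol] at h2
    have h0 : 0 ≤ ∑ T ∈ S, Λ * Metric.diam (tri T) * osc A T := Finset.sum_nonneg fun T _ =>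
      mul_nonneg (mul_nonneg hΛ0 Metric.diam_nonneg) (osc_nonneg A T)
    exact hc₀.trans (sq_le_of_le_of_sq_le hpos.le h0 h1 h2 hΛκ)
  have hHV : H ^ 2 ≤ 4 * κ ^ 2 * V := hκK.diam_sq_le
  have hBN : V * frob B.linear ^ 2 ≤ N := hF.volume_mul_frob_sq_le hSF h hK hm
  have hBc : V * ‖B (cen K) - c₀‖ ^ 2 ≤ 2 * P + H ^ 2 * N :=
    hF.linear_interp_error_le hSF h hK hm c₀
  -- The error is split through the two centroids and `c₀` into four terms; the factor 4 comes from
  -- squaring their sum.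
  refine ⟨fun T => 4 * (H ^ 2 * frob (A T).linear ^ 2 + ‖A T (cen T) - c₀‖ ^ 2 +
    ‖B (cen K) - c₀‖ ^ 2 + H ^ 2 * frob B.linear ^ 2), fun T hT x hx => ?_, ?_⟩
  · have hTK := subset_tri_of_mem hK hT
    have h1 : ‖A T x - A T (cen T)‖ ≤ frob (A T).linear * H := by
      refine (norm_affine_sub_le _ _ _).trans ?_
      gcongr
      · exact frob_nonneg _
      · rw [← dist_eq_norm]
        exact Metric.dist_le_diam_of_mem (IsTriangle.isCompact_tri K).isBounded
          (hTK hx) (hTK (hS.isTriangle T hT).cen_mem)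
    have h2 : ‖B x - B (cen K)‖ ≤ frob B.linear * H := by
      refine (norm_affine_sub_le _ _ _).trans ?_
      gcongr
      · exact frob_nonneg _
      · rw [← dist_eq_norm]
        exact Metric.dist_le_diam_of_mem (IsTriangle.isCompact_tri K).isBounded
          (hTK hx) h.cen_mem
    have h3 : ‖A T x - B x‖ ≤ frob (A T).linear * H + ‖A T (cen T) - c₀‖ +
        ‖B (cen K) - c₀‖ + frob B.linear * H := by
      have h4 : A T x - B x = (A T x - A T (cen T)) + (A T (cen T) - c₀) - (B (cen K) - c₀)
          - (B x - B (cen K)) := by abel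
      rw [h4]
      refine (norm_sub_le _ _).trans (add_le_add ?_ h2)
      refine (norm_sub_le _ _).trans (add_le_add ?_ le_rfl)
      exact (norm_add_le _ _).trans (add_le_add h1 le_rfl)
    calc ‖A T x - B x‖ ^ 2 ≤ (frob (A T).linear * H + ‖A T (cen T) - c₀‖ +
        ‖B (cen K) - c₀‖ + frob B.linear * H) ^ 2 := by gcongr
      _ ≤ _ := by
        beta_reduce
        set a := frob (A T).linear * H
        set b := ‖A T (cen T) - c₀‖
        set c := ‖B (cen K) - c₀‖
        set d := frob B.linear * H
        rw [show H ^ 2 * frob (A T).linear ^ 2 = a ^ 2 by ring,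
          show H ^ 2 * frob B.linear ^ 2 = d ^ 2 by ring]
        nlinarith [sq_nonneg (a - b), sq_nonneg (a - c), sq_nonneg (a - d), sq_nonneg (b - c),
          sq_nonneg (b - d), sq_nonneg (c - d)]
  · have h1 : ∑ T ∈ S, volume.real (tri T) * (4 * (H ^ 2 * frob (A T).linear ^ 2 +
        ‖A T (cen T) - c₀‖ ^ 2 + ‖B (cen K) - c₀‖ ^ 2 + H ^ 2 * frob B.linear ^ 2)) =
        4 * (H ^ 2 * N + P + V * ‖B (cen K) - c₀‖ ^ 2 + H ^ 2 * (V * frob B.linear ^ 2)) := by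
      have h2 : ∀ T, volume.real (tri T) * (4 * (H ^ 2 * frob (A T).linear ^ 2 +
        ‖A T (cen T) - c₀‖ ^ 2 + ‖B (cen K) - c₀‖ ^ 2 + H ^ 2 * frob B.linear ^ 2)) =
        4 * H ^ 2 * (volume.real (tri T) * frob (A T).linear ^ 2) +
        4 * (volume.real (tri T) * ‖A T (cen T) - c₀‖ ^ 2) +
        volume.real (tri T) * (4 * (‖B (cen K) - c₀‖ ^ 2 + H ^ 2 * frob B.linear ^ 2)) :=
        fun T => by ring
      simp only [h2]
      rw [Finset.sum_add_distrib, Finset.sum_add_distrib, ← Finset.mul_sum, ← Finset.mul_sum,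
        ← Finset.sum_mul, hvol]
      ring
    -- The bounds for the interpolation add up to `12 P + 12 H² N`; inserting those for `P` and `H²`
    -- gives the two terms of the constant.
    rw [h1, interpConst]
    have h3 := mul_le_mul_of_nonneg_left hBN (sq_nonneg H)
    have h4 := mul_le_mul_of_nonneg_right hHV hN0
    linarith

end IsMesh

/-! ### Weak derivatives of elementwise affine fields -/

theorem isWeakPartial_affine {U : Set Plane} (A : Plane →ᵃ[ℝ] Plane) (i j : Fin 2) :
    IsWeakPartial U j (fun x => A x i) (fun _ => A.linear (unitVec j) i) := by
  intro φ hφ hc hsupp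
  have hA : ∀ x, HasFDerivAt (fun x => A x i)
      ((EuclideanSpace.proj i).comp A.linear.toContinuousLinearMap) x := fun x => by
    have h1 : (fun x => A x i) = fun x => A 0 i +
        ((EuclideanSpace.proj i : Plane →L[ℝ] ℝ).comp A.linear.toContinuousLinearMap) x := by
      ext x
      have := affineMap_add A 0 x
      rw [zero_add] at this
      rw [this]; simp
    rw [h1]
    exact (ContinuousLinearMap.hasFDerivAt _).const_add _
  have hdiff : Differentiable ℝ fun x => A x i := fun x => (hA x).differentiableAt
  have hφd : Differentiable ℝ φ := hφ.differentiable (by simp)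
  have hφ' : Continuous fun x => fderiv ℝ φ x (EuclideanSpace.single j 1) :=
    (hφ.continuous_fderiv (by simp)).clm_apply continuous_const
  have hsupp' : ∀ x, x ∉ U → φ x = 0 := fun x hx =>
    image_eq_zero_of_notMem_tsupport fun h => hx (hsupp h)
  have hsupp'' : ∀ x, x ∉ U → fderiv ℝ φ x = 0 := fun x hx =>
    image_eq_zero_of_notMem_tsupport fun h => hx (hsupp (tsupport_fderiv_subset ℝ h))
  rw [setIntegral_eq_integral_of_forall_compl_eq_zero fun x hx => by rw [hsupp'' x hx]; simp,
    setIntegral_eq_integral_of_forall_compl_eq_zero fun x hx => by rw [hsupp' x hx]; simp]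
  have hcφ' : HasCompactSupport fun x => fderiv ℝ φ x (EuclideanSpace.single j 1) :=
    hc.fderiv_apply ℝ _
  have h2 := integral_mul_fderiv_eq_neg_fderiv_mul_of_integrable (μ := volume)
    (f := fun x => A x i) (g := φ) (v := EuclideanSpace.single j 1) ?_ ?_ ?_ (fun x _ => hdiff x) (fun x _ => hφd x)
  · rw [h2]
    congr 1
    refine integral_congr_ae (Filter.Eventually.of_forall fun x => ?_)
    simp only [(hA x).fderiv]
    simp [unitVec]
  · have h3 : (fun x => fderiv ℝ (fun x => A x i) x (EuclideanSpace.single j 1) * φ x) =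
        fun x => A.linear (unitVec j) i * φ x := by
      ext x; simp [(hA x).fderiv, unitVec]
    rw [h3]
    exact (hφ.continuous.integrable_of_hasCompactSupport hc).const_mul _
  · exact (hdiff.continuous.mul hφ').integrable_of_hasCompactSupport hcφ'.mul_left
  · exact (hdiff.continuous.mul hφ.continuous).integrable_of_hasCompactSupport hc.mul_left

/-- Weak derivatives are unique. -/
theorem IsWeakPartial.ae_eq {U : Set Plane} (hU : IsOpen U) {j : Fin 2} {f h₁ h₂ : Plane → ℝ}
    (H₁ : IsWeakPartial U j f h₁) (H₂ : IsWeakPartial U j f h₂)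
    (hi₁ : IntegrableOn h₁ U) (hi₂ : IntegrableOn h₂ U) : h₁ =ᵐ[volume.restrict U] h₂ := by
  have h1 : ∀ᵐ x, x ∈ U → (h₁ - h₂) x = 0 := by
    refine hU.ae_eq_zero_of_integral_contDiff_smul_eq_zero (hi₁.sub hi₂).locallyIntegrableOn ?_
    intro φ hφ hc hsupp
    have hb : ∃ C, ∀ x, ‖φ x‖ ≤ C := hc.exists_bound_of_continuous hφ.continuous
    obtain ⟨C, hC⟩ := hb
    have hint : ∀ h : Plane → ℝ, IntegrableOn h U → IntegrableOn (fun x => h x * φ x) U := fun h hh =>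
      hh.mul_bdd (c := C) hφ.continuous.aestronglyMeasurable
        (Filter.Eventually.of_forall hC)
    have h2 : ∫ x in U, φ x • (h₁ - h₂) x = 0 := by
      have h3 := (H₁ φ hφ hc hsupp).symm.trans (H₂ φ hφ hc hsupp)
      have h4 : ∀ x, φ x • (h₁ - h₂) x = h₁ x * φ x - h₂ x * φ x := fun x => by
        simp only [Pi.sub_apply, smul_eq_mul]; ring
      simp_rw [h4]
      rw [integral_sub (hint _ hi₁) (hint _ hi₂)]
      linarith
    rwa [setIntegral_eq_integral_of_forall_compl_eq_zero] at h2
    intro x hx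
    rw [image_eq_zero_of_notMem_tsupport fun h => hx (hsupp h), zero_smul]
  filter_upwards [(ae_restrict_iff' hU.measurableSet).2 h1] with x hx
  exact sub_eq_zero.1 hx

theorem IsWeakPartial.congr_ae {U : Set Plane} {j : Fin 2} {f f' h : Plane → ℝ}
    (H : IsWeakPartial U j f h) (hf : f =ᵐ[volume.restrict U] f') : IsWeakPartial U j f' h := by
  intro φ hφ hc hsupp
  rw [← H φ hφ hc hsupp]
  refine integral_congr_ae ?_
  filter_upwards [hf] with x hx
  rw [hx]

namespace IsPolygonalDomain

variable {Ω : Set Plane}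

theorem volume_segment (a b : Plane) : volume (segment ℝ a b) = 0 := by
  obtain ⟨c, hc⟩ : ∃ c : Plane, c ∉ affineSpan ℝ {a, b} := by
    by_contra! h
    have h1 : affineSpan ℝ {a, b} = ⊤ := by
      ext x; simp [h x]
    have h2 : Module.finrank ℝ (vectorSpan ℝ ({a, b} : Set Plane)) ≤ 1 := by
      have := finrank_vectorSpan_insert_le_set ℝ ({b} : Set Plane) a
      rwa [vectorSpan_singleton, finrank_bot, zero_add] at this
    rw [← direction_affineSpan, h1, AffineSubspace.direction_top, finrank_top] at h2
    simp at h2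
  refine measure_mono_null ?_ (Measure.addHaar_affineSubspace volume (affineSpan ℝ {a, b}) ?_)
  · rw [← convexHull_pair]; exact convexHull_subset_affineSpan _
  · intro h; rw [h] at hc; exact hc trivial

theorem volume_frontier (h : IsPolygonalDomain Ω) : volume (frontier Ω) = 0 := by
  obtain ⟨S, hS⟩ := h.frontier_eq
  rw [hS]
  exact (measure_biUnion_null_iff S.countable_toSet).2 fun s _ => volume_segment _ _

theorem ae_eq_closure (h : IsPolygonalDomain Ω) : Ω =ᵐ[volume] closure Ω :=
  (closure_ae_eq_of_null_frontier h.volume_frontier).symm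

theorem restrict_eq (h : IsPolygonalDomain Ω) (T : Triangulation Ω) :
    volume.restrict Ω = volume.restrict (⋃ K ∈ T.elems, tri K) := by
  rw [T.cover]
  exact Measure.restrict_congr_set h.ae_eq_closure

theorem restrict_tri_le (h : IsPolygonalDomain Ω) (T : Triangulation Ω) {K : Finset Plane}
    (hK : K ∈ T.elems) : volume.restrict (tri K) ≤ volume.restrict Ω := by
  rw [h.restrict_eq T]
  exact Measure.restrict_mono (subset_biUnion_of_mem (u := fun K => tri K) hK) le_rfl

theorem setIntegral_eq_sum (h : IsPolygonalDomain Ω) (T : Triangulation Ω) {E : Type*}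
    [NormedAddCommGroup E] [NormedSpace ℝ E] {f : Plane → E}
    (hf : ∀ K ∈ T.elems, IntegrableOn f (tri K)) :
    ∫ x in Ω, f x = ∑ K ∈ T.elems, ∫ x in tri K, f x := by
  rw [h.restrict_eq T, T.isMesh.setIntegral_biUnion hf]

theorem setIntegral_eq_sum_const (h : IsPolygonalDomain Ω) (T : Triangulation Ω)
    {f : Plane → ℝ} {c : Finset Plane → ℝ}
    (hf : ∀ K ∈ T.elems, f =ᵐ[volume.restrict (tri K)] fun _ => c K) :
    ∫ x in Ω, f x = ∑ K ∈ T.elems, volume.real (tri K) * c K := by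
  have hc : ∀ K : Finset Plane, IntegrableOn (fun _ => c K) (tri K) := fun K =>
    integrableOn_const (IsTriangle.volume_tri_lt_top K).ne
  rw [h.setIntegral_eq_sum T fun K hK => (hc K).congr (hf K hK).symm]
  refine Finset.sum_congr rfl fun K hK => ?_
  rw [integral_congr_ae (hf K hK)]
  simp

end IsPolygonalDomain

namespace Triangulation

variable {Ω : Set Plane} {T : Triangulation Ω} {v : Plane → Plane}
  {A : Finset Plane → Plane →ᵃ[ℝ] Plane} {K : Finset Plane}

/-- Existence rules out the default value `0` of `brokenGrad`; uniqueness of weak derivatives then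
identifies it almost everywhere. -/
theorem exists_isBrokenGrad (hA : ∀ K ∈ T.elems, v =ᵐ[volume.restrict (tri K)] A K) :
    ∃ G, IsBrokenGrad T v G := by
  let G : Plane → Matrix (Fin 2) (Fin 2) ℝ := fun x => Matrix.of fun i j =>
    ∑ K ∈ T.elems, (interior (tri K)).indicator (fun _ => (A K).linear (unitVec j) i) x
  refine ⟨G, fun i j => ?_, fun K hK i j => ?_⟩
  · refine memLp_finsetSum T.elems fun K _ => ?_
    refine memLp_indicator_const 2 isOpen_interior.measurableSet _ (Or.inr ?_)
    exact ((Measure.restrict_apply_le _ _).trans_lt ((measure_mono interior_subset).trans_lt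
      (IsTriangle.volume_tri_lt_top K))).ne
  · have h1 : IsWeakPartial (interior (tri K)) j (fun x => v x i)
        (fun _ => (A K).linear (unitVec j) i) := by
      refine (isWeakPartial_affine (A K) i j).congr_ae ?_
      filter_upwards [ae_restrict_of_ae_restrict_of_subset interior_subset (hA K hK)] with x hx
      rw [hx]
    intro φ hφ hc hsupp
    rw [h1 φ hφ hc hsupp]
    congr 1
    refine setIntegral_congr_fun isOpen_interior.measurableSet fun x hx => ?_
    have h2 : G x i j = (A K).linear (unitVec j) i := by
      show ∑ L ∈ T.elems, (interior (tri L)).indicator (fun _ => (A L).linear (unitVec j) i) x = _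
      rw [Finset.sum_eq_single_of_mem K hK, indicator_of_mem hx]
      intro L hL hne
      refine indicator_of_notMem (fun hxL => hne ?_) _
      exact (T.isMesh.eq_of_mem_interior hK hL hx (interior_subset hxL)).symm
    simp only [h2]

/-- The elementwise gradient of an elementwise affine field. -/
theorem brokenGrad_ae_eq (hΩ : IsPolygonalDomain Ω)
    (hA : ∀ K ∈ T.elems, v =ᵐ[volume.restrict (tri K)] A K) (hK : K ∈ T.elems) :
    ∀ᵐ x ∂volume.restrict (tri K), ∀ i j, brokenGrad T v x i j = (A K).linear (unitVec j) i := by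
  have hex := exists_isBrokenGrad hA
  have hG : IsBrokenGrad T v (brokenGrad T v) := by
    rw [brokenGrad, dif_pos hex]; exact hex.choose_spec
  rw [← Measure.restrict_congr_set (IsTriangle.interior_ae_eq K)]
  refine ae_all_iff.2 fun i => ae_all_iff.2 fun j => ?_
  have h1 : IsWeakPartial (interior (tri K)) j (fun x => v x i)
      (fun _ => (A K).linear (unitVec j) i) := by
    refine (isWeakPartial_affine (A K) i j).congr_ae ?_
    filter_upwards [ae_restrict_of_ae_restrict_of_subset interior_subset (hA K hK)] with x hx
    rw [hx]
  have hfin : volume (interior (tri K)) < ⊤ :=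
    (measure_mono interior_subset).trans_lt (IsTriangle.volume_tri_lt_top K)
  refine (hG.2 K hK i j).ae_eq isOpen_interior h1 ?_ (integrableOn_const hfin.ne)
  have h2 : MemLp (fun x => brokenGrad T v x i j) 2 (volume.restrict (tri K)) :=
    (hG.1 i j).mono_measure (hΩ.restrict_tri_le T hK)
  have : IsFiniteMeasure (volume.restrict (tri K)) :=
    ⟨by simpa using IsTriangle.volume_tri_lt_top K⟩
  exact IntegrableOn.mono_set (h2.integrable (by norm_num)) interior_subset

theorem formA_eq (hΩ : IsPolygonalDomain Ω) {u : Plane → Plane}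
    {B : Finset Plane → Plane →ᵃ[ℝ] Plane} (μ : ℝ)
    (hB : ∀ K ∈ T.elems, u =ᵐ[volume.restrict (tri K)] B K)
    (hA : ∀ K ∈ T.elems, v =ᵐ[volume.restrict (tri K)] A K) :
    formA T μ u v = μ * ∑ K ∈ T.elems, volume.real (tri K) *
      ∑ i, ∑ j, (B K).linear (unitVec j) i * (A K).linear (unitVec j) i := by
  rw [formA, hΩ.setIntegral_eq_sum_const T]
  intro K hK
  filter_upwards [brokenGrad_ae_eq hΩ hB hK, brokenGrad_ae_eq hΩ hA hK] with x h1 h2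
  simp only [h1, h2]

theorem formB_eq (hΩ : IsPolygonalDomain Ω) {q : Plane → ℝ} {c : Finset Plane → ℝ}
    (hA : ∀ K ∈ T.elems, v =ᵐ[volume.restrict (tri K)] A K)
    (hq : ∀ K ∈ T.elems, q =ᵐ[volume.restrict (tri K)] fun _ => c K) :
    formB T v q = ∑ K ∈ T.elems, volume.real (tri K) *
      ((∑ i, (A K).linear (unitVec i) i) * c K) := by
  rw [formB, hΩ.setIntegral_eq_sum_const T]
  intro K hK
  filter_upwards [brokenGrad_ae_eq hΩ hA hK, hq K hK] with x h1 h2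
  rw [h2, brokenDiv, Matrix.trace]
  simp only [Matrix.diag_apply, h1]

theorem brokenGradNorm_eq (hΩ : IsPolygonalDomain Ω)
    (hA : ∀ K ∈ T.elems, v =ᵐ[volume.restrict (tri K)] A K) :
    brokenGradNorm T v = Real.sqrt (∑ K ∈ T.elems, volume.real (tri K) *
      frob (A K).linear ^ 2) := by
  rw [brokenGradNorm, hΩ.setIntegral_eq_sum_const T]
  intro K hK
  filter_upwards [brokenGrad_ae_eq hΩ hA hK] with x h1
  simp only [h1, frob_sq]

end Triangulation

/-! ### Nested triangulations -/

namespace Triangulation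

variable {Ω : Set Plane} {Tc Tf : Triangulation Ω} {K L T : Finset Plane}

/-- The elements of the fine triangulation in the coarse element `K`. -/
def children (Tf : Triangulation Ω) (K : Finset Plane) : Finset (Finset Plane) :=
  Tf.elems.filter fun T => tri T ⊆ tri K

theorem mem_children : T ∈ Tf.children K ↔ T ∈ Tf.elems ∧ tri T ⊆ tri K := Finset.mem_filter

theorem children_subset : Tf.children K ⊆ Tf.elems := Finset.filter_subset _ _

theorem eq_of_mem_children (hK : K ∈ Tc.elems) (hL : L ∈ Tc.elems) (hTK : T ∈ Tf.children K)
    (hTL : T ∈ Tf.children L) : K = L := by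
  obtain ⟨hT, h1⟩ := mem_children.1 hTK
  obtain ⟨-, h2⟩ := mem_children.1 hTL
  obtain ⟨x, hx⟩ := (Tf.isTriangle hT).interior_nonempty
  exact Tc.isMesh.eq_of_mem_interior hK hL (interior_mono h1 hx) (h2 (interior_subset hx))

theorem Refines.exists_mem_children (h : Tf.Refines Tc) (hT : T ∈ Tf.elems) :
    ∃ K ∈ Tc.elems, T ∈ Tf.children K := by
  obtain ⟨K, hK, hTK⟩ := h T hT
  exact ⟨K, hK, mem_children.2 ⟨hT, hTK⟩⟩

/-- An interior point of `K` lies in some fine element, whose coarse container meets the interior of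
`K` and hence is `K`. The boundary follows by closure, as a finite union of triangles is closed. -/
theorem Refines.biUnion_children (h : Tf.Refines Tc) (hK : K ∈ Tc.elems) :
    ⋃ T ∈ Tf.children K, tri T = tri K := by
  refine Subset.antisymm (iUnion₂_subset fun T hT => (mem_children.1 hT).2) ?_
  have hcl : IsClosed (⋃ T ∈ Tf.children K, tri T) :=
    isClosed_biUnion_finset fun T _ => IsTriangle.isClosed_tri T
  rw [← (Tc.isTriangle hK).closure_interior]
  refine closure_minimal (fun x hx => ?_) hcl
  have hxΩ : x ∈ ⋃ T ∈ Tf.elems, tri T := by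
    rw [Tf.cover, ← Tc.cover]
    exact mem_iUnion₂.2 ⟨K, hK, interior_subset hx⟩
  obtain ⟨T, hT, hxT⟩ := mem_iUnion₂.1 hxΩ
  obtain ⟨L, hL, hTL⟩ := h T hT
  have hKL := Tc.isMesh.eq_of_mem_interior hK hL hx (hTL hxT)
  subst hKL
  exact mem_iUnion₂.2 ⟨T, mem_children.2 ⟨hT, hTL⟩, hxT⟩

theorem Refines.sum_eq_sum_children (h : Tf.Refines Tc) {M : Type*} [AddCommMonoid M]
    (f : Finset Plane → M) :
    ∑ T ∈ Tf.elems, f T = ∑ K ∈ Tc.elems, ∑ T ∈ Tf.children K, f T := by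
  simp only [children, Finset.sum_filter]
  rw [Finset.sum_comm]
  refine Finset.sum_congr rfl fun T hT => ?_
  obtain ⟨K, hK, hTK⟩ := h.exists_mem_children hT
  rw [Finset.sum_eq_single_of_mem K hK, if_pos (mem_children.1 hTK).2]
  intro L hL hne
  rw [if_neg fun hTL => hne (eq_of_mem_children hL hK (mem_children.2 ⟨hT, hTL⟩) hTK)]

/-- The coarse element that contains `T`. -/
def parent (Tc : Triangulation Ω) (T : Finset Plane) : Finset Plane :=
  if h : ∃ K ∈ Tc.elems, tri T ⊆ tri K then h.choose else ∅

theorem parent_eq (hK : K ∈ Tc.elems) (hT : T ∈ Tf.children K) : Tc.parent T = K := by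
  obtain ⟨hT1, hT2⟩ := mem_children.1 hT
  have h : ∃ K ∈ Tc.elems, tri T ⊆ tri K := ⟨K, hK, hT2⟩
  rw [parent, dif_pos h]
  exact eq_of_mem_children h.choose_spec.1 hK (mem_children.2 ⟨hT1, h.choose_spec.2⟩) hT

theorem Refines.ae_eq_parent (h : Tf.Refines Tc) {E : Type*} {v : Plane → E}
    {f : Finset Plane → Plane → E}
    (hv : ∀ K ∈ Tc.elems, v =ᵐ[volume.restrict (tri K)] f K) :
    ∀ T ∈ Tf.elems, v =ᵐ[volume.restrict (tri T)] f (Tc.parent T) := by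
  intro T hT
  obtain ⟨K, hK, hTK⟩ := h.exists_mem_children hT
  rw [parent_eq hK hTK]
  exact ae_restrict_of_ae_restrict_of_subset (mem_children.1 hTK).2 (hv K hK)

/-- Elementwise affine functions are square integrable. -/
theorem exists_elementwise (T : Triangulation Ω) (B : Finset Plane → Plane →ᵃ[ℝ] Plane) :
    ∃ v : Plane → Plane, MemLp v 2 (volume.restrict Ω) ∧
      ∀ K ∈ T.elems, v =ᵐ[volume.restrict (tri K)] B K := by
  -- With interiors at most one summand is non-zero at any point; the edges form a null set.
  refine ⟨fun x => ∑ K ∈ T.elems, (interior (tri K)).indicator (B K) x, ?_, fun K hK => ?_⟩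
  · refine memLp_finsetSum T.elems fun K _ => ?_
    rw [memLp_indicator_iff_restrict isOpen_interior.measurableSet,
      Measure.restrict_restrict isOpen_interior.measurableSet]
    have hB : Continuous (B K) := (B K).continuous_of_finiteDimensional
    obtain ⟨C, hC⟩ := (IsTriangle.isCompact_tri K).exists_bound_of_continuousOn hB.continuousOn
    have hfin : volume (interior (tri K) ∩ Ω) < ⊤ :=
      (measure_mono (inter_subset_left.trans interior_subset)).trans_lt
        (IsTriangle.volume_tri_lt_top K)
    have : IsFiniteMeasure (volume.restrict (interior (tri K) ∩ Ω)) := ⟨by simpa using hfin⟩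
    refine MemLp.of_bound hB.aestronglyMeasurable C ?_
    have h1 : ∀ᵐ x ∂volume.restrict (interior (tri K)), ‖B K x‖ ≤ C :=
      (ae_restrict_mem isOpen_interior.measurableSet).mono fun x hx => hC x (interior_subset hx)
    exact ae_restrict_of_ae_restrict_of_subset inter_subset_left h1
  · rw [← Measure.restrict_congr_set (IsTriangle.interior_ae_eq K)]
    filter_upwards [ae_restrict_mem isOpen_interior.measurableSet] with x hx
    rw [Finset.sum_eq_single_of_mem K hK, indicator_of_mem hx]
    intro L hL hne
    refine indicator_of_notMem (fun hxL => hne ?_) _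
    exact (T.isMesh.eq_of_mem_interior hK hL hx (interior_subset hxL)).symm

end Triangulation

/-! ### The Crouzeix–Raviart space -/

/-- The midpoint rule is exact for affine fields. It turns the mean value conditions of
`velocitySpace` into conditions at edge midpoints. -/
theorem edgeIntegral_affine (a b : Plane) (A : Plane →ᵃ[ℝ] Plane) :
    edgeIntegral a b A = dist a b • A (midpoint ℝ a b) := by
  rw [edgeIntegral]
  congr 1
  have h1 : ∀ t : ℝ, A (AffineMap.lineMap a b t) = A a + t • (A b - A a) := fun t => by
    rw [AffineMap.apply_lineMap, AffineMap.lineMap_apply, vsub_eq_sub, vadd_eq_add, add_comm]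
  simp_rw [h1]
  rw [intervalIntegral.integral_add (by simp) (by
    apply Continuous.intervalIntegrable; fun_prop), intervalIntegral.integral_smul_const,
    integral_id, AffineMap.map_midpoint, midpoint_eq_smul_add, intervalIntegral.integral_const,
    invOf_eq_inv]
  module

theorem edgeIntegral_affine_eq_zero {a b : Plane} (hab : a ≠ b) (A : Plane →ᵃ[ℝ] Plane) :
    edgeIntegral a b A = 0 ↔ A (midpoint ℝ a b) = 0 := by
  rw [edgeIntegral_affine, smul_eq_zero, or_iff_right (dist_pos.2 hab).ne']

theorem edgeIntegral_sub_eq_zero {a b : Plane} (hab : a ≠ b) (A B : Plane →ᵃ[ℝ] Plane) :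
    edgeIntegral a b (fun x => A x - B x) = 0 ↔ A (midpoint ℝ a b) = B (midpoint ℝ a b) := by
  have h1 : (fun x => A x - B x) = ⇑(A - B) := by ext x; simp
  rw [h1, edgeIntegral_affine_eq_zero hab, AffineMap.coe_sub, Pi.sub_apply, sub_eq_zero]

/-- The value at the midpoint of the edge `e`. -/
def edgeVal (F : Finset (Finset Plane)) (A : Finset Plane → Plane →ᵃ[ℝ] Plane) (e : Finset Plane) :
    Plane :=
  if h : ∃ T ∈ F, ∃ c ∈ T, T.erase c = e then A h.choose (edgeMid e) else 0

namespace IsMesh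

variable {F : Finset (Finset Plane)} {A : Finset Plane → Plane →ᵃ[ℝ] Plane}

theorem apply_edgeMid_eq_edgeVal (hF : IsMesh F)
    (hjump : ∀ K ∈ F, ∀ L ∈ F, K ≠ L → ∀ a b : Plane, a ≠ b →
        a ∈ K → b ∈ K → a ∈ L → b ∈ L → edgeIntegral a b (fun x => A K x - A L x) = 0) :
    ∀ T ∈ F, ∀ c ∈ T, A T (edgeMid (T.erase c)) = edgeVal F A (T.erase c) := by
  intro T hT c hc
  have h : ∃ T' ∈ F, ∃ c' ∈ T', T'.erase c' = T.erase c := ⟨T, hT, c, hc, rfl⟩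
  rw [edgeVal, dif_pos h]
  obtain ⟨hL, c', hc', he⟩ := h.choose_spec
  set L := h.choose
  by_cases hTL : T = L
  · rw [← hTL]
  · obtain ⟨a, b, hab, -, -, -, hTe⟩ := (hF.isTriangle T hT).exists_eq hc
    have hmemT : ∀ p ∈ T.erase c, p ∈ T := fun p hp => Finset.mem_of_mem_erase hp
    have hmemL : ∀ p ∈ T.erase c, p ∈ L := fun p hp => by
      rw [← he] at hp; exact Finset.mem_of_mem_erase hp
    rw [hTe] at hmemT hmemL ⊢
    rw [edgeMid_pair hab]
    exact (edgeIntegral_sub_eq_zero hab _ _).1 (hjump T hT L hL hTL a b hab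
      (hmemT a (by simp)) (hmemT b (by simp)) (hmemL a (by simp)) (hmemL b (by simp)))

end IsMesh

theorem IsTriangle.crInterp_midpoint {K : Finset Plane} (h : IsTriangle K)
    (M : Finset Plane → Plane) {a b : Plane} (ha : a ∈ K) (hb : b ∈ K) (hab : a ≠ b) :
    crInterp M K (midpoint ℝ a b) = M {a, b} := by
  obtain ⟨c, hc, hac, hbc, hKe⟩ := h.exists_third ha hb hab
  have he : K.erase c = {a, b} := by
    rw [hKe]
    ext x; simp only [Finset.mem_erase, Finset.mem_insert, Finset.mem_singleton]
    constructor
    · tauto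
    · rintro (rfl | rfl) <;> tauto
  rw [← edgeMid_pair hab, ← he, h.crInterp_edgeMid M hc]

/-- The interpolation belongs to the Crouzeix–Raviart space. -/
theorem mem_velocitySpace_of_crInterp {Ω : Set Plane} {Tc Tf : Triangulation Ω}
    {A : Finset Plane → Plane →ᵃ[ℝ] Plane}
    (hjump : ∀ K ∈ Tf.elems, ∀ L ∈ Tf.elems, K ≠ L → ∀ a b : Plane, a ≠ b →
        a ∈ K → b ∈ K → a ∈ L → b ∈ L → edgeIntegral a b (fun x => A K x - A L x) = 0)
    (hbd : ∀ K ∈ Tf.elems, ∀ a b : Plane, a ≠ b → a ∈ K → b ∈ K →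
        segment ℝ a b ⊆ frontier Ω → edgeIntegral a b (A K) = 0) {w : Plane → Plane}
    (hw : MemLp w 2 (volume.restrict Ω))
    (hwB : ∀ K ∈ Tc.elems, w =ᵐ[volume.restrict (tri K)]
      crInterp (edgeMean Tf.elems (edgeVal Tf.elems A)) K) : w ∈ velocitySpace Tc := by
  refine ⟨hw, crInterp (edgeMean Tf.elems (edgeVal Tf.elems A)), hwB, ?_, ?_⟩
  · intro K hK L hL _ a b hab haK hbK haL hbL
    rw [edgeIntegral_sub_eq_zero hab, (Tc.isTriangle hK).crInterp_midpoint _ haK hbK hab,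
      (Tc.isTriangle hL).crInterp_midpoint _ haL hbL hab]
  · intro K hK a b hab haK hbK hfr
    rw [edgeIntegral_affine_eq_zero hab, (Tc.isTriangle hK).crInterp_midpoint _ haK hbK hab,
      edgeMean]
    -- Every fine edge in a coarse boundary edge lies in the frontier as well, so its midpoint value
    -- is zero.
    refine Finset.sum_eq_zero fun e he => ?_
    obtain ⟨he, hsub⟩ := Finset.mem_filter.1 he
    obtain ⟨T, hT, c, hc, rfl⟩ := mem_edges.1 he
    rw [← Tf.isMesh.apply_edgeMid_eq_edgeVal hjump T hT c hc]
    obtain ⟨p, q, hpq, -, -, hTe, hce⟩ := (Tf.isTriangle hT).exists_eq hc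
    rw [hce] at hsub ⊢
    have hp := hsub (by simp : p ∈ (({p, q} : Finset Plane) : Set Plane))
    have hq := hsub (by simp : q ∈ (({p, q} : Finset Plane) : Set Plane))
    rw [Finset.coe_insert, Finset.coe_singleton, convexHull_pair] at hp hq
    have h0 := hbd T hT p q hpq (by rw [hTe]; simp) (by rw [hTe]; simp)
      (((convex_segment a b).segment_subset hp hq).trans hfr)
    rw [edgeMid_pair hpq, (edgeIntegral_affine_eq_zero hpq _).1 h0, smul_zero]

/-! ### The residual -/

theorem normL2_sq (S : Set Plane) (f : Plane → Plane) : normL2 S f ^ 2 = ∫ x in S, ‖f x‖ ^ 2 :=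
  Real.sq_sqrt (integral_nonneg fun _ => by positivity)

theorem integrableOn_inner {S : Set Plane} {f g : Plane → Plane}
    (hf : MemLp f 2 (volume.restrict S)) (hg : MemLp g 2 (volume.restrict S)) :
    IntegrableOn (fun x => inner ℝ (f x) (g x)) S := by
  refine (hf.norm.integrable_mul hg.norm).mono (hf.1.inner hg.1)
    (Filter.Eventually.of_forall fun x => ?_)
  simpa using abs_real_inner_le_norm (f x) (g x)

theorem abs_innerL2_le {S : Set Plane} {f g : Plane → Plane}
    (hf : MemLp f 2 (volume.restrict S)) (hg : MemLp g 2 (volume.restrict S)) :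
    |innerL2 S f g| ≤ normL2 S f * normL2 S g := by
  have h1 : |innerL2 S f g| ≤ ∫ x in S, ‖f x‖ * ‖g x‖ := by
    refine (abs_integral_le_integral_abs).trans ?_
    exact integral_mono (integrableOn_inner hf hg).abs (hf.norm.integrable_mul hg.norm)
      fun x => abs_real_inner_le_norm (f x) (g x)
  refine h1.trans ?_
  have h2 := integral_mul_norm_le_Lp_mul_Lq (μ := volume.restrict S) (f := f) (g := g)
    Real.HolderConjugate.two_two (by simpa using hf) (by simpa using hg)
  simpa [normL2, Real.sqrt_eq_rpow] using h2

variable {Ω : Set Plane} {Tc Tf : Triangulation Ω}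

/-- The residual of the coarse solution is the error functional of the interpolation. -/
theorem residual_eq (hΩ : IsPolygonalDomain Ω) (href : Tf.Refines Tc) {μ : ℝ}
    {g u v w : Plane → Plane} {p : Plane → ℝ} (hsol : IsDiscreteSolution Tc μ g u p)
    {A : Finset Plane → Plane →ᵃ[ℝ] Plane} {m : Finset Plane → Plane}
    (hA : ∀ T ∈ Tf.elems, v =ᵐ[volume.restrict (tri T)] A T)
    (hm : ∀ T ∈ Tf.elems, ∀ c ∈ T, A T (edgeMid (T.erase c)) = m (T.erase c))
    (hw : w ∈ velocitySpace Tc)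
    (hwB : ∀ K ∈ Tc.elems, w =ᵐ[volume.restrict (tri K)] crInterp (edgeMean Tf.elems m) K) :
    residual Tf μ g u p v = innerL2 Ω g v - innerL2 Ω g w := by
  obtain ⟨⟨-, U, hU, -⟩, ⟨-, -, hp⟩, heq⟩ := hsol
  have hp' : ∃ c : Finset Plane → ℝ, ∀ K ∈ Tc.elems, p =ᵐ[volume.restrict (tri K)] fun _ => c K := by
    choose! c hc using hp
    exact ⟨c, hc⟩
  obtain ⟨c, hc⟩ := hp'
  have hzero : (fun _ => 0 : Plane → ℝ) ∈ pressureSpace Tc :=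
    ⟨MemLp.zero', by simp, fun K _ => ⟨0, Filter.EventuallyEq.rfl⟩⟩
  have h1 := heq w hw _ hzero
  have h2 : formB Tc u (fun _ => 0) = 0 := by simp [formB]
  rw [h2, add_zero] at h1
  have hB : ∀ K ∈ Tc.elems, ∀ i j, volume.real (tri K) *
      (crInterp (edgeMean Tf.elems m) K).linear (unitVec j) i =
      ∑ T ∈ Tf.children K, volume.real (tri T) * (A T).linear (unitVec j) i := by
    intro K hK i j
    have h3 := congrArg (fun v : Plane => v i) (Tf.isMesh.linear_crInterp
      Triangulation.children_subset (Tc.isTriangle hK) (href.biUnion_children hK) hm (unitVec j))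
    simpa only [PiLp.smul_apply, smul_eq_mul, WithLp.ofLp_sum, Finset.sum_apply] using h3
  -- The gradient of `u` is constant on `K`, so only the integral over `K` of the gradient of `v`
  -- enters, which `w` reproduces. The same argument with the trace serves the pressure term.
  have hformA : formA Tf μ u v = formA Tc μ u w := by
    rw [Triangulation.formA_eq hΩ μ (href.ae_eq_parent (f := fun K => U K) hU) hA,
      Triangulation.formA_eq hΩ μ hU hwB, href.sum_eq_sum_children]
    congr 1
    refine Finset.sum_congr rfl fun K hK => ?_
    have h3 : volume.real (tri K) * ∑ i, ∑ j, (U K).linear (unitVec j) i *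
        (crInterp (edgeMean Tf.elems m) K).linear (unitVec j) i =
        ∑ i, ∑ j, (U K).linear (unitVec j) i *
          ∑ T ∈ Tf.children K, volume.real (tri T) * (A T).linear (unitVec j) i := by
      simp only [← hB K hK, Finset.mul_sum]
      exact Finset.sum_congr rfl fun i _ => Finset.sum_congr rfl fun j _ => by ring
    rw [h3]
    simp only [Finset.mul_sum]
    rw [Finset.sum_comm]
    refine Finset.sum_congr rfl fun i _ => ?_
    rw [Finset.sum_comm]
    refine Finset.sum_congr rfl fun j _ => Finset.sum_congr rfl fun T hT => ?_
    rw [Triangulation.parent_eq hK hT]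
    ring
  have hformB : formB Tf v p = formB Tc w p := by
    rw [Triangulation.formB_eq hΩ hA (href.ae_eq_parent (f := fun K _ => c K) hc),
      Triangulation.formB_eq hΩ hwB hc, href.sum_eq_sum_children]
    refine Finset.sum_congr rfl fun K hK => ?_
    have h3 : volume.real (tri K) * ((∑ i,
        (crInterp (edgeMean Tf.elems m) K).linear (unitVec i) i) * c K) =
        ∑ i, (∑ T ∈ Tf.children K, volume.real (tri T) * (A T).linear (unitVec i) i) * c K := by
      simp only [← hB K hK, Finset.mul_sum, Finset.sum_mul]
      exact Finset.sum_congr rfl fun i _ => by ring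
    rw [h3]
    simp only [Finset.mul_sum, Finset.sum_mul]
    rw [Finset.sum_comm]
    refine Finset.sum_congr rfl fun i _ => Finset.sum_congr rfl fun T hT => ?_
    rw [Triangulation.parent_eq hK hT]
    ring
  rw [residual, hformA, hformB, ← h1]
  ring

/-- The local `L²` interpolation estimate. -/
theorem normL2_sub_le (hΩ : IsPolygonalDomain Ω) (href : Tf.Refines Tc) {κ : ℝ}
    (hκc : Tc.ShapeRegular κ) (hκf : Tf.ShapeRegular κ) {v w : Plane → Plane}
    (hv : MemLp v 2 (volume.restrict Ω)) (hwm : MemLp w 2 (volume.restrict Ω))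
    {A : Finset Plane → Plane →ᵃ[ℝ] Plane} {m : Finset Plane → Plane}
    (hA : ∀ T ∈ Tf.elems, v =ᵐ[volume.restrict (tri T)] A T)
    (hm : ∀ T ∈ Tf.elems, ∀ c ∈ T, A T (edgeMid (T.erase c)) = m (T.erase c))
    (hwB : ∀ K ∈ Tc.elems, w =ᵐ[volume.restrict (tri K)] crInterp (edgeMean Tf.elems m) K)
    {K : Finset Plane} (hK : K ∈ Tc.elems) :
    normL2 (tri K) (v - w) ≤ Real.sqrt (interpConst κ) * (elemSize K * Real.sqrt
      (∑ T ∈ Tf.children K, volume.real (tri T) * frob (A T).linear ^ 2)) := by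
  have hU := href.biUnion_children hK
  obtain ⟨D, hD, hDsum⟩ := Tf.isMesh.exists_interp_error_le Triangulation.children_subset
    (Tc.isTriangle hK) hU hm (hκc K hK) fun T hT => hκf T (Triangulation.children_subset hT)
  have hint : IntegrableOn (fun x => ‖(v - w) x‖ ^ 2) (tri K) :=
    (((hv.sub hwm).mono_measure (hΩ.restrict_tri_le Tc hK)).norm).integrable_sq
  have hsum : ∫ x in tri K, ‖(v - w) x‖ ^ 2 ≤
      ∑ T ∈ Tf.children K, volume.real (tri T) * D T := by
    rw [← hU, (Tf.isMesh.mono Triangulation.children_subset).setIntegral_biUnion fun T hT =>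
      hint.mono_set (Triangulation.mem_children.1 hT).2]
    refine Finset.sum_le_sum fun T hT => ?_
    obtain ⟨hTf, hTK⟩ := Triangulation.mem_children.1 hT
    have hconst : ∫ _ in tri T, D T = volume.real (tri T) * D T := by simp
    rw [← hconst]
    refine integral_mono_ae (hint.mono_set hTK)
      (integrableOn_const (IsTriangle.volume_tri_lt_top T).ne) ?_
    filter_upwards [hA T hTf, ae_restrict_of_ae_restrict_of_subset hTK (hwB K hK),
      ae_restrict_mem (IsTriangle.isClosed_tri T).measurableSet] with x h1 h2 hx
    rw [Pi.sub_apply, h1, h2]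
    exact hD T hT x hx
  have hκ0 : 0 ≤ interpConst κ := by rw [interpConst]; positivity
  rw [normL2, elemSize, ← Real.sqrt_mul measureReal_nonneg, ← Real.sqrt_mul hκ0, ← mul_assoc]
  exact Real.sqrt_le_sqrt (hsum.trans hDsum)

/-- The functional `(g, v - w)` sees refined elements only. Cauchy–Schwarz is used on each of them
and then for the sum; their children carry part of the full broken gradient norm. -/
theorem abs_residual_le (hΩ : IsPolygonalDomain Ω) (href : Tf.Refines Tc) {κ : ℝ}
    (hκc : Tc.ShapeRegular κ) (hκf : Tf.ShapeRegular κ) {μ : ℝ}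
    {g u v : Plane → Plane} {p : Plane → ℝ} (hg : MemLp g 2 (volume.restrict Ω))
    (hsol : IsDiscreteSolution Tc μ g u p) (hv : v ∈ velocitySpace Tf) :
    |residual Tf μ g u p v| ≤ Real.sqrt (interpConst κ) *
      Real.sqrt (∑ K ∈ Tc.refined Tf, elemSize K ^ 2 * normL2 (tri K) g ^ 2) *
        brokenGradNorm Tf v := by
  obtain ⟨hvm, A, hA, hjump, hbd⟩ := hv
  have hm := Tf.isMesh.apply_edgeMid_eq_edgeVal hjump
  set m := edgeVal Tf.elems A
  obtain ⟨w, hwm, hwB⟩ := Tc.exists_elementwise (crInterp (edgeMean Tf.elems m))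
  have hw : w ∈ velocitySpace Tc := mem_velocitySpace_of_crInterp hjump hbd hwm hwB
  set N : Finset Plane → ℝ := fun K =>
    ∑ T ∈ Tf.children K, volume.real (tri T) * frob (A T).linear ^ 2 with hN
  have hN0 : ∀ K, 0 ≤ N K := fun K => Finset.sum_nonneg fun T _ => by positivity
  have hres : residual Tf μ g u p v = ∑ K ∈ Tc.elems, innerL2 (tri K) g (v - w) := by
    rw [residual_eq hΩ href hsol hA hm hw hwB]
    have hi : ∀ K ∈ Tc.elems, IntegrableOn (fun x => inner ℝ (g x) ((v - w) x)) (tri K) :=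
      fun K hK => integrableOn_inner (hg.mono_measure (hΩ.restrict_tri_le Tc hK))
        ((hvm.sub hwm).mono_measure (hΩ.restrict_tri_le Tc hK))
    simp only [innerL2]
    rw [← hΩ.setIntegral_eq_sum Tc hi, ← integral_sub (integrableOn_inner hg hvm)
      (integrableOn_inner hg hwm)]
    simp only [Pi.sub_apply, inner_sub_right]
  have hrefd : ∀ {K}, K ∈ Tc.refined Tf ↔ K ∈ Tc.elems ∧ K ∉ Tf.elems := fun {K} => by
    simp [Triangulation.refined]
  have hsub : Tc.refined Tf ⊆ Tc.elems := fun K hK => (hrefd.1 hK).1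
  have hzero : ∀ K ∈ Tc.elems, K ∉ Tc.refined Tf → innerL2 (tri K) g (v - w) = 0 := by
    intro K hK hKr
    have hKf : K ∈ Tf.elems := by
      by_contra h
      exact hKr (hrefd.2 ⟨hK, h⟩)
    refine integral_eq_zero_of_ae ?_
    filter_upwards [hA K hKf, hwB K hK] with x h1 h2
    rw [Pi.sub_apply, h1, h2, Tf.isMesh.crInterp_eq_of_mem hKf hm, sub_self, inner_zero_right]
    rfl
  rw [hres, ← Finset.sum_subset hsub hzero]
  have hloc : ∀ K ∈ Tc.refined Tf, |innerL2 (tri K) g (v - w)| ≤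
      Real.sqrt (interpConst κ) * ((elemSize K * normL2 (tri K) g) * Real.sqrt (N K)) := by
    intro K hK
    have hK' := hsub hK
    refine (abs_innerL2_le (hg.mono_measure (hΩ.restrict_tri_le Tc hK'))
        ((hvm.sub hwm).mono_measure (hΩ.restrict_tri_le Tc hK'))).trans ?_
    have h1 := normL2_sub_le hΩ href hκc hκf hvm hwm hA hm hwB hK'
    have h2 := mul_le_mul_of_nonneg_left h1 (Real.sqrt_nonneg (∫ x in tri K, ‖g x‖ ^ 2))
    calc _ ≤ _ := h2
      _ = _ := by rw [← normL2]; ring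
  refine (Finset.abs_sum_le_sum_abs _ _).trans ((Finset.sum_le_sum hloc).trans ?_)
  rw [← Finset.mul_sum, mul_assoc]
  refine mul_le_mul_of_nonneg_left ?_ (Real.sqrt_nonneg _)
  refine (Real.sum_mul_le_sqrt_mul_sqrt _ _ _).trans ?_
  simp only [mul_pow, Real.sq_sqrt (hN0 _)]
  refine mul_le_mul_of_nonneg_left ?_ (Real.sqrt_nonneg _)
  rw [Triangulation.brokenGradNorm_eq hΩ hA, href.sum_eq_sum_children]
  exact Real.sqrt_le_sqrt (Finset.sum_le_sum_of_subset_of_nonneg hsub fun K _ _ => hN0 K)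

end StokesCR

end

theorem mainTheorem9 (κ : ℝ) :
    ∃ C : ℝ, 0 < C ∧
      ∀ (Ω : Set StokesCR.Plane), StokesCR.IsPolygonalDomain Ω →
      ∀ (Tc Tf : StokesCR.Triangulation Ω),
        Tc.ShapeRegular κ → Tf.ShapeRegular κ → Tf.Refines Tc →
      ∀ (μ : ℝ), 0 < μ →
      ∀ (g : StokesCR.Plane → StokesCR.Plane), MemLp g 2 (volume.restrict Ω) →
      ∀ (u : StokesCR.Plane → StokesCR.Plane) (p : StokesCR.Plane → ℝ),
        StokesCR.IsDiscreteSolution Tc μ g u p →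
      ∀ v ∈ StokesCR.velocitySpace Tf,
        |StokesCR.residual Tf μ g u p v| ≤
          C * Real.sqrt (∑ K ∈ Tc.refined Tf,
              StokesCR.elemSize K ^ 2 * StokesCR.normL2 (StokesCR.tri K) g ^ 2) *
            StokesCR.brokenGradNorm Tf v := by
  -- The summand 1 ensures positivity, since `interpConst` vanishes at `κ = 0`.
  refine ⟨Real.sqrt (StokesCR.interpConst κ) + 1, by positivity, ?_⟩
  intro Ω hΩ Tc Tf hκc hκf href μ _ g hg u p hsol v hv
  refine (StokesCR.abs_residual_le hΩ href hκc hκf hg hsol hv).trans ?_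
  have h1 : 0 ≤ StokesCR.brokenGradNorm Tf v := Real.sqrt_nonneg _
  gcongr
  linarith
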